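/- Let $d\ge 1$. For a closed dyadic cube $Q\subset\mathbb R^d$ and $t>0$ let $tQ$ be the cube with the same center and $t$ times the side length. Let $\mathcal O\subsetneq\mathbb R^d$ be open. A Whitney covering of $\mathcal O$ is a countable family $(Q_i)$ of closed dyadic cubes with pairwise disjoint interiors such that $\bigcup_i Q_i=\mathcal O$, $\operatorname{diam}Q_i<\operatorname{dist}(Q_i,\mathcal O^c)\le 4\operatorname{diam}Q_i$, and $\operatorname{diam}Q_i\le 2\operatorname{diam}Q_j$ whenever $Q_i\cap Q_j\ne\emptyset$. A partition of unity with constant $K$ for it is a family of functions $\psi_i:\mathbb R^d\to\mathbb R$ with $\sum_i\psi_i=1$ on $\mathcal O$, $\chi_{\frac12Q_i}\le\psi_i\le\chi_{\frac98Q_i}$, and $\psi_i$ Lipschitz continuous with constant $K/\operatorname{diam}Q_i$ (that is, $\operatorname{diam}(Q_i)|\nabla\psi_i|\le K$). There is a constant $K=K(d)$ such that every open $\mathcal O\subsetneq\mathbb R^d$ has a Whitney covering with a partition of unity with constant $K$. Let $\Omega\subset\mathbb R^d$ be a bounded Lipschitz domain. Let $u\in W^{1,p}_0(\Omega;\mathbb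 R^N)$, where $1\le p<\infty$, and extend $u$ by $0$ outside $\Omega$. Given a Whitney covering $(Q_i)$ of $\mathcal O$ and a partition of unity $(\psi_i)$ with constant $K$, put $\bar u_i:=\frac{1}{|\frac98Q_i|}\int_{\frac98Q_i}u\,dx$ if $\frac98Q_i\subset\Omega$ and $\bar u_i:=0$ otherwise, and define the relative truncation $$u_{\mathcal O}(x):=\begin{cases}u(x),&x\in\mathbb R^d\setminus\mathcal O,\\ \sum_i\psi_i(x)\,\bar u_i,&x\in\mathcal O.\end{cases}$$ **Lemma (Stability).** For all $K\ge0$, $1\le p<\infty$ and every bounded Lipschitz domain $\Omega\subset\mathbb R^d$ there is a constant $c=c(d,p,\Omega,K)$ such that for every open $\mathcal O\subsetneq\mathbb R^d$, every Whitney covering of $\mathcal O$, every partition of unity with constant $K$ for it, every $N$ and every $u\in W^{1,p}_0(\Omega;\mathbb R^N)$, we have $u_{\mathcal O}\in W^{1,p}_0(\Omega;\mathbb R^N)$ and $$\int_\Omega|\nabla(u-u_{\mathcal O})|^p\,dx\le c\int_{\mathcal O\cap\Omega}|\nabla u|^p\,dx .$$ In particular, with $K=K(d)$ the constant depends only on $d$,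 $p$ and $\Omega$. -/

import Mathlib

open MeasureTheory Set Filter Topology
open scoped NNReal ENNReal ContDiff

noncomputable section

/-- The Euclidean space `ℝ^n`. -/
abbrev Euc (n : ℕ) : Type := EuclideanSpace ℝ (Fin n)

/-- The space `ℝ^{d × N}` of gradients, as the `d`-tuples of partial derivatives in `ℝ^N`,
with the Frobenius norm. -/
abbrev GradSpace (d N : ℕ) : Type := PiLp 2 (fun _ : Fin d => Euc N)

/-! ### Lipschitz domains -/

/-- `Ω` is open and, near each of its boundary points, in a suitable orthonormal coordinate system,
it is the region strictly above the graph of a Lipschitz function `γ` of the `d - 1` coordinates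
orthogonal to the direction `e`. Connectedness is not required. -/
def IsLipschitzDomain {d : ℕ} (Ω : Set (Euc d)) : Prop :=
  IsOpen Ω ∧ ∀ x ∈ frontier Ω, ∃ e : Euc d, ‖e‖ = 1 ∧ ∃ r : ℝ, 0 < r ∧
    ∃ (L : ℝ≥0) (γ : (Submodule.span ℝ {e})ᗮ → ℝ), LipschitzWith L γ ∧
      ∀ y ∈ Metric.ball x r,
        (y ∈ Ω ↔ γ ((Submodule.span ℝ {e})ᗮ.orthogonalProjectionOnto y) < inner ℝ e y)

/-! ### Sobolev spaces -/

/-- `φ ∈ C_c^∞(Ω; F)`. -/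
def IsTestFunction {d : ℕ} {F : Type*} [NormedAddCommGroup F] [NormedSpace ℝ F]
    (Ω : Set (Euc d)) (φ : Euc d → F) : Prop :=
  ContDiff ℝ ∞ φ ∧ HasCompactSupport φ ∧ tsupport φ ⊆ Ω

/-- The classical gradient, the tuple of the partial derivatives. -/
def classicalGradient {d N : ℕ} (φ : Euc d → Euc N) (x : Euc d) : GradSpace d N :=
  WithLp.toLp 2 (fun i => fderiv ℝ φ x (EuclideanSpace.single i (1 : ℝ)))

/-- `G` is a weak (distributional) gradient of `u` in the open set `Ω`. -/
def HasWeakGradient {d N : ℕ} (Ω : Set (Euc d)) (u : Euc d → Euc N)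
    (G : Euc d → GradSpace d N) : Prop :=
  LocallyIntegrableOn u Ω ∧ LocallyIntegrableOn G Ω ∧
    ∀ φ : Euc d → ℝ, IsTestFunction Ω φ → ∀ i : Fin d,
      ∫ x in Ω, (fderiv ℝ φ x (EuclideanSpace.single i (1 : ℝ))) • u x
        = - ∫ x in Ω, φ x • G x i

/-- `u|_Ω ∈ W^{1,p}_0(Ω; ℝ^N)`: `u` and its weak gradient are in `L^p(Ω)`, and `u` is the limit in
the norm of `W^{1,p}(Ω)` of functions in `C_c^∞(Ω; ℝ^N)`. The values of `u` outside `Ω` are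
irrelevant. -/
def MemW1p0 {d N : ℕ} (Ω : Set (Euc d)) (p : ℝ) (u : Euc d → Euc N) : Prop :=
  MemLp u (ENNReal.ofReal p) (volume.restrict Ω) ∧
    ∃ G : Euc d → GradSpace d N, HasWeakGradient Ω u G ∧
      MemLp G (ENNReal.ofReal p) (volume.restrict Ω) ∧
      ∃ φ : ℕ → Euc d → Euc N, (∀ n, IsTestFunction Ω (φ n)) ∧
        Tendsto (fun n => eLpNorm (fun x => φ n x - u x) (ENNReal.ofReal p) (volume.restrict Ω))
          atTop (𝓝 0) ∧
        Tendsto (fun n => eLpNorm (fun x => classicalGradient (φ n) x - G x) (ENNReal.ofReal p)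
          (volume.restrict Ω)) atTop (𝓝 0)

/-! ### Dyadic cubes and Whitney coverings -/

/-- The closed dyadic cube `∏ᵢ [2^k mᵢ, 2^k (mᵢ + 1)]`, given by `k ∈ ℤ` (`level`) and
`m ∈ ℤ^d` (`index`). -/
structure DyadicCube (d : ℕ) where
  level : ℤ
  index : Fin d → ℤ

namespace DyadicCube

variable {d : ℕ}

/-- The side length. -/
def side (Q : DyadicCube d) : ℝ := (2 : ℝ) ^ Q.level

/-- The set of points of the cube. -/
def carrier (Q : DyadicCube d) : Set (Euc d) :=
  {x | ∀ i, x i ∈ Icc (Q.side * (Q.index i : ℝ)) (Q.side * ((Q.index i : ℝ) + 1))}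

/-- `t Q`, the closed cube with the same center as `Q` and `t` times its side length. -/
def dilate (Q : DyadicCube d) (t : ℝ) : Set (Euc d) :=
  {x | ∀ i, |x i - Q.side * ((Q.index i : ℝ) + 1 / 2)| ≤ t * Q.side / 2}

theorem dilate_one (Q : DyadicCube d) : Q.dilate 1 = Q.carrier := by
  ext x
  simp only [dilate, carrier, mem_ofPred_eq, mem_Icc, abs_le]
  refine forall_congr' fun i => ⟨fun h => ⟨?_, ?_⟩, fun h => ⟨?_, ?_⟩⟩ <;> linarith [h.1, h.2]

end DyadicCube

/-- The distance `inf {|x - y| : x ∈ A, y ∈ B}` of two sets. -/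
def setDist {d : ℕ} (A B : Set (Euc d)) : ℝ := sInf (image2 dist A B)

/-- `𝒬` is a Whitney covering of `O` by closed dyadic cubes. (A set of dyadic cubes is
automatically countable. The bound on the number of neighbors of a cube and the finite overlap of
the cubes `3/2 Q` follow from these properties.) -/
structure IsWhitneyCovering {d : ℕ} (O : Set (Euc d)) (𝒬 : Set (DyadicCube d)) : Prop where
  iUnion_eq : ⋃ Q ∈ 𝒬, Q.carrier = O
  disjoint_interior : 𝒬.Pairwise fun Q Q' => Disjoint (interior Q.carrier) (interior Q'.carrier)
  diam_lt_dist : ∀ Q ∈ 𝒬, Metric.diam Q.carrier < setDist Q.carrier Oᶜ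
  dist_le_diam : ∀ Q ∈ 𝒬, setDist Q.carrier Oᶜ ≤ 4 * Metric.diam Q.carrier
  diam_le_of_touch : ∀ Q ∈ 𝒬, ∀ Q' ∈ 𝒬, (Q.carrier ∩ Q'.carrier).Nonempty →
    Metric.diam Q.carrier ≤ 2 * Metric.diam Q'.carrier

/-- `(ψ_Q)_{Q ∈ 𝒬}` is a partition of unity on `O` with `χ_{1/2 Q} ≤ ψ_Q ≤ χ_{9/8 Q}`, where
`ψ_Q` is Lipschitz continuous on `ℝ^d` with constant `K / diam Q`, that is,
`diam Q * |∇ψ_Q| ≤ K`. -/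
structure IsWhitneyPartition {d : ℕ} (O : Set (Euc d)) (𝒬 : Set (DyadicCube d))
    (ψ : DyadicCube d → Euc d → ℝ) (K : ℝ≥0) : Prop where
  sum_eq_one : ∀ x ∈ O, ∑' Q : 𝒬, ψ Q x = 1
  indicator_le : ∀ Q ∈ 𝒬, ∀ x, (Q.dilate (1 / 2)).indicator (fun _ => (1 : ℝ)) x ≤ ψ Q x
  le_indicator : ∀ Q ∈ 𝒬, ∀ x, ψ Q x ≤ (Q.dilate (9 / 8)).indicator (fun _ => (1 : ℝ)) x
  lipschitz : ∀ Q ∈ 𝒬, ∀ x y, |ψ Q x - ψ Q y| ≤ K / Metric.diam Q.carrier * dist x y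

/-! ### The relative truncation -/

open Classical in
/-- The mean value of `u` over `9/8 Q` if `9/8 Q ⊆ Ω`, and `0` otherwise. -/
def whitneyMean {d N : ℕ} (Ω : Set (Euc d)) (u : Euc d → Euc N) (Q : DyadicCube d) : Euc N :=
  if Q.dilate (9 / 8) ⊆ Ω then ⨍ x in Q.dilate (9 / 8), u x else 0

open Classical in
/-- The relative truncation `u_O` of `u : Ω → ℝ^N` (extended by `0` outside `Ω`) with respect to
`O`, the Whitney covering `𝒬` of `O` and the partition of unity `ψ`. -/
def relativeTruncation {d N : ℕ} (Ω O : Set (Euc d)) (𝒬 : Set (DyadicCube d))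
    (ψ : DyadicCube d → Euc d → ℝ) (u : Euc d → Euc N) (x : Euc d) : Euc N :=
  if x ∈ O then ∑' Q : 𝒬, ψ Q x • whitneyMean Ω u Q else Ω.indicator u x

end

/-! ### Geometry of dyadic cubes -/

/-! Write `T φ` for the relative truncation. In `O` the partition functions sum to one, so a
constant may be subtracted from all means: the gradient of `T φ` at `x` is bounded by a sum of terms
`K |φ x - mean_Q| / diam Q` over the boundedly many cubes `Q` whose doubles contain `x`. The
Poincaré inequality on `2 Q` bounds the `p`-th power integral of `φ - mean_Q` by `(diam Q)^p` times
that of `∇φ`. The doubles lie in `O` and overlap boundedly, so summation gives `∫_O |∇T φ|^p ≤ C ∫_O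
|∇φ|^p` (`lintegral_enorm_fderiv_relativeTruncation_rpow_le`). Outside `O` the difference `φ - T φ`
vanishes, hence so does its gradient almost everywhere.

The shape of `Ω` matters only for cubes with `9/8 Q` not contained in `Ω`, whose mean is replaced by
`0`. A bounded Lipschitz domain satisfies an exterior corkscrew condition
(`IsLipschitzDomain.exists_corkscrew`), so `2 Q` contains a ball of comparable size outside `Ω`.
There `φ = 0`, so `0` is the mean over this ball and the same Poincaré inequality applies
(`lintegral_enorm_sub_whitneyMean_rpow_le`).

For a test function `φ`, `T φ` is Lipschitz on the whole space (`lipschitzWith_relativeTruncation`)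
and vanishes outside `Ω`; cutting off and mollifying shows that it is a limit of test functions
(`LipschitzWith.isTestLimit`). For general `u`, approximated by test functions `φ_n`, `T` is linear
and bounded in `L^p`, and stability applied to `φ_n - φ_m` makes `∇(φ_n - T φ_n)` a Cauchy sequence.
Thus both membership and estimate pass to the limit (`exists_isTestLimit_relativeTruncation`).

Existence of coverings comes from the maximal dyadic cubes that are small compared to their distance
to the complement, and existence of partitions from normalized bumps. -/

theorem Euc.abs_apply_le {d : ℕ} (x : Euc d) (i : Fin d) : |x i| ≤ ‖x‖ := by
  simpa using PiLp.norm_apply_le x i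

theorem Euc.norm_le_of_forall_abs_le {d : ℕ} {x : Euc d} {a : ℝ} (ha : 0 ≤ a)
    (h : ∀ i, |x i| ≤ a) : ‖x‖ ≤ √d * a := by
  rw [EuclideanSpace.norm_eq]
  calc √(∑ i, ‖x i‖ ^ 2) ≤ √(∑ _i : Fin d, a ^ 2) := by
        gcongr with i
        exact h i
    _ = √d * a := by simp [ha]

namespace DyadicCube

variable {d : ℕ} (Q : DyadicCube d)

theorem side_pos : 0 < Q.side := by unfold side; positivity

/-- The center of the cube. -/
noncomputable def center : Euc d := WithLp.toLp 2 fun i => Q.side * ((Q.index i : ℝ) + 1 / 2)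

theorem mem_dilate {t : ℝ} {x : Euc d} :
    x ∈ Q.dilate t ↔ ∀ i, |x i - Q.center i| ≤ t * Q.side / 2 := Iff.rfl

theorem mem_carrier_iff {x : Euc d} : x ∈ Q.carrier ↔ ∀ i, |x i - Q.center i| ≤ Q.side / 2 := by
  rw [← dilate_one, mem_dilate, one_mul]

theorem dilate_mono {s t : ℝ} (h : s ≤ t) : Q.dilate s ⊆ Q.dilate t := fun x hx i =>
  (hx i).trans (by have := Q.side_pos; gcongr)

theorem carrier_subset_dilate {t : ℝ} (h : 1 ≤ t) : Q.carrier ⊆ Q.dilate t := by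
  rw [← dilate_one]; exact Q.dilate_mono h

theorem dilate_subset_closedBall {t : ℝ} (ht : 0 ≤ t) :
    Q.dilate t ⊆ Metric.closedBall Q.center (√d * (t * Q.side / 2)) := fun x hx => by
  rw [mem_closedBall_iff_norm]
  exact Euc.norm_le_of_forall_abs_le (by have := Q.side_pos; positivity) hx

theorem closedBall_subset_dilate (t : ℝ) :
    Metric.closedBall Q.center (t * Q.side / 2) ⊆ Q.dilate t := fun x hx i => by
  rw [mem_closedBall_iff_norm] at hx
  exact (Euc.abs_apply_le (x - Q.center) i).trans hx

theorem isClosed_dilate (t : ℝ) : IsClosed (Q.dilate t) := by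
  have : Q.dilate t = ⋂ i, {x : Euc d | |x i - Q.center i| ≤ t * Q.side / 2} := by
    ext x; simp [mem_dilate]
  rw [this]
  exact isClosed_iInter fun i => isClosed_le (by fun_prop) continuous_const

theorem isCompact_dilate (t : ℝ) : IsCompact (Q.dilate t) := by
  refine Metric.isCompact_of_isClosed_isBounded (Q.isClosed_dilate t) ?_
  exact Metric.isBounded_closedBall.subset
    ((Q.dilate_mono (le_max_left t 0)).trans (Q.dilate_subset_closedBall (le_max_right t 0)))

theorem convex_dilate (t : ℝ) : Convex ℝ (Q.dilate t) := by
  intro x hx y hy a b ha hb hab i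
  have h1 := hx i
  have h2 := hy i
  rw [abs_le] at *
  have : (a • x + b • y) i = a * x i + b * y i := by simp
  obtain rfl : b = 1 - a := by linarith
  rw [this]
  constructor
  · linarith [mul_le_mul_of_nonneg_left h1.1 ha, mul_le_mul_of_nonneg_left h2.1 hb]
  · linarith [mul_le_mul_of_nonneg_left h1.2 ha, mul_le_mul_of_nonneg_left h2.2 hb]

theorem isCompact_carrier : IsCompact Q.carrier := by
  rw [← dilate_one]; exact Q.isCompact_dilate 1

theorem center_mem_carrier : Q.center ∈ Q.carrier := by
  rw [mem_carrier_iff]; intro i; simpa using (half_pos Q.side_pos).le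

theorem nonempty_carrier : Q.carrier.Nonempty := ⟨_, Q.center_mem_carrier⟩

theorem dist_le_of_mem_dilate {t : ℝ} (ht : 0 ≤ t) {x y : Euc d} (hx : x ∈ Q.dilate t)
    (hy : y ∈ Q.dilate t) : dist x y ≤ √d * (t * Q.side) := by
  rw [dist_eq_norm]
  refine Euc.norm_le_of_forall_abs_le (by have := Q.side_pos; positivity) fun i => ?_
  have h1 := hx i
  have h2 := hy i
  rw [abs_le] at *
  have : (x - y) i = x i - y i := by simp
  rw [this]
  constructor <;> linarith

theorem diam_carrier : Metric.diam Q.carrier = √d * Q.side := by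
  apply le_antisymm
  · refine Metric.diam_le_of_forall_dist_le (by have := Q.side_pos; positivity) fun x hx y hy => ?_
    rw [← dilate_one] at hx hy
    simpa using Q.dist_le_of_mem_dilate zero_le_one hx hy
  · set a : Euc d := WithLp.toLp 2 fun i => Q.side * (Q.index i : ℝ)
    set b : Euc d := WithLp.toLp 2 fun i => Q.side * ((Q.index i : ℝ) + 1)
    have hs := Q.side_pos
    have ha : a ∈ Q.carrier := fun i => ⟨le_rfl, by simp only [a]; gcongr; linarith⟩
    have hb : b ∈ Q.carrier := fun i => ⟨by simp only [b]; gcongr; linarith, le_rfl⟩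
    refine le_trans (le_of_eq ?_) (Metric.dist_le_diam_of_mem Q.isCompact_carrier.isBounded hb ha)
    have : ∀ i, dist (b i) (a i) = Q.side := fun i => by
      rw [Real.dist_eq]; simp only [a, b]
      rw [show Q.side * ((Q.index i : ℝ) + 1) - Q.side * (Q.index i : ℝ) = Q.side by ring,
        abs_of_pos hs]
    rw [EuclideanSpace.dist_eq]
    simp [this, hs.le]

/-- The contraction by `1 / 2` towards the center maps `2 Q` into `Q` and moves each coordinate by
at most `side / 2`. -/
theorem exists_mem_carrier_dist_le {x : Euc d} (hx : x ∈ Q.dilate 2) :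
    ∃ y ∈ Q.carrier, dist x y ≤ √d * (Q.side / 2) := by
  have hs := Q.side_pos
  refine ⟨Q.center + (1 / 2 : ℝ) • (x - Q.center), ?_, ?_⟩
  · rw [mem_carrier_iff]
    intro i
    have := hx i
    rw [show (Q.center + (1 / 2 : ℝ) • (x - Q.center)) i - Q.center i
      = 1 / 2 * (x i - Q.center i) by simp, abs_mul, abs_of_pos (by norm_num : (0 : ℝ) < 1 / 2)]
    change |x i - Q.center i| ≤ _ at this
    linarith
  · rw [dist_eq_norm]
    refine Euc.norm_le_of_forall_abs_le (by positivity) fun i => ?_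
    have := hx i
    rw [show (x - (Q.center + (1 / 2 : ℝ) • (x - Q.center))) i
      = 1 / 2 * (x i - Q.center i) by simp; ring, abs_mul,
      abs_of_pos (by norm_num : (0 : ℝ) < 1 / 2)]
    change |x i - Q.center i| ≤ _ at this
    linarith

instance instCountable : Countable (DyadicCube d) := by
  refine Function.Injective.countable (f := fun Q : DyadicCube d => (Q.level, Q.index)) ?_
  rintro ⟨a, b⟩ ⟨a', b'⟩ h
  simp_all

/-- The dyadic cubes of four consecutive levels, three per direction. -/
noncomputable def window (k₀ : ℤ) (x : Euc d) (j : Fin 4 × (Fin d → Fin 3)) : DyadicCube d where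
  level := k₀ + (j.1 : ℕ)
  index i := ⌈x i / (2 : ℝ) ^ (k₀ + (j.1 : ℕ)) - 3 / 2⌉ + (j.2 i : ℕ)

/-- With `z = x i / side`, membership in `2 Q` confines the index to `[z - 3/2, z + 1/2]`. An
interval of length two contains at most three integers, counted from `⌈z - 3/2⌉`. -/
theorem mem_range_window {k₀ : ℤ} {x : Euc d} (h₀ : k₀ ≤ Q.level) (h₁ : Q.level < k₀ + 4)
    (hx : x ∈ Q.dilate 2) : Q ∈ range (window k₀ x) := by
  have hs := Q.side_pos
  have key : ∀ i, ∃ n : Fin 3, Q.index i = ⌈x i / Q.side - 3 / 2⌉ + (n : ℕ) := by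
    intro i
    have h := hx i
    rw [abs_le] at h
    have e : x i = Q.side * (x i / Q.side) := by field_simp
    set z := x i / Q.side
    rw [e] at h
    have h2 : z ≤ (Q.index i : ℝ) + 3 / 2 := by
      by_contra hc; push Not at hc; nlinarith [h.2]
    have h3 : (Q.index i : ℝ) - 1 / 2 ≤ z := by
      by_contra hc; push Not at hc; nlinarith [h.1]
    have h4 : ⌈z - 3 / 2⌉ ≤ Q.index i := Int.ceil_le.2 (by linarith)
    have h5 : (Q.index i : ℝ) - 2 ≤ ⌈z - 3 / 2⌉ := (by linarith : _ ≤ z - 3 / 2).trans (Int.le_ceil _)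
    have h6 : Q.index i - 2 ≤ ⌈z - 3 / 2⌉ := by exact_mod_cast h5
    refine ⟨⟨(Q.index i - ⌈z - 3 / 2⌉).toNat, by omega⟩, ?_⟩
    simp only []
    omega
  choose n hn using key
  have hl : k₀ + (((Q.level - k₀).toNat : ℕ) : ℤ) = Q.level := by omega
  refine ⟨(⟨(Q.level - k₀).toNat, by omega⟩, n), ?_⟩
  obtain ⟨k, m⟩ := Q
  simp only [window, DyadicCube.mk.injEq]
  refine ⟨hl, ?_⟩
  funext i
  have := hn i
  simp only [side] at this
  rw [hl]
  exact this.symm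

end DyadicCube

/-! ### Distance to the complement, comparable sizes and bounded overlap of Whitney cubes. -/

theorem setDist_le_dist {d : ℕ} {A B : Set (Euc d)} {a b : Euc d} (ha : a ∈ A) (hb : b ∈ B) :
    setDist A B ≤ dist a b :=
  csInf_le ⟨0, by rintro _ ⟨x, -, y, -, rfl⟩; exact dist_nonneg⟩ ⟨a, ha, b, hb, rfl⟩

theorem setDist_le_infDist {d : ℕ} {A B : Set (Euc d)} {a : Euc d} (ha : a ∈ A)
    (hB : B.Nonempty) : setDist A B ≤ Metric.infDist a B :=
  (Metric.le_infDist hB).2 fun _ hb => setDist_le_dist ha hb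

theorem infDist_le_setDist_add {d : ℕ} {A B : Set (Euc d)} {a : Euc d} (ha : a ∈ A)
    (hA : Bornology.IsBounded A) (hB : B.Nonempty) :
    Metric.infDist a B ≤ setDist A B + Metric.diam A := by
  rw [← sub_le_iff_le_add]
  refine le_csInf (Nonempty.image2 ⟨a, ha⟩ hB) ?_
  rintro _ ⟨x, hx, y, hy, rfl⟩
  have h1 := Metric.infDist_le_dist_of_mem (x := a) hy
  have h2 := dist_triangle a x y
  have h3 := Metric.dist_le_diam_of_mem hA ha hx
  linarith

namespace IsWhitneyCovering

variable {d : ℕ} {O : Set (Euc d)} {𝒬 : Set (DyadicCube d)}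

/-- A point of `2 Q` is within half a diameter of `Q`. This leaves a distance to `Oᶜ` of more than
`1 - 1/2` diameters here and of at most `4 + 1 + 1/2 = 11/2` diameters in `infDist_le`. -/
theorem lt_infDist (h : IsWhitneyCovering O 𝒬) (hO : O ≠ univ) {Q : DyadicCube d} (hQ : Q ∈ 𝒬)
    {x : Euc d} (hx : x ∈ Q.dilate 2) : √d * (Q.side / 2) < Metric.infDist x Oᶜ := by
  obtain ⟨y, hy, hxy⟩ := Q.exists_mem_carrier_dist_le hx
  have hne : Oᶜ.Nonempty := nonempty_compl.2 hO
  have h1 := h.diam_lt_dist Q hQ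
  have h2 := setDist_le_infDist hy hne
  have h3 := Metric.infDist_le_infDist_add_dist (s := Oᶜ) (x := y) (y := x)
  rw [Q.diam_carrier] at h1
  rw [dist_comm] at h3
  linarith

theorem infDist_le (h : IsWhitneyCovering O 𝒬) (hO : O ≠ univ) {Q : DyadicCube d} (hQ : Q ∈ 𝒬)
    {x : Euc d} (hx : x ∈ Q.dilate 2) : Metric.infDist x Oᶜ ≤ 11 * (√d * (Q.side / 2)) := by
  obtain ⟨y, hy, hxy⟩ := Q.exists_mem_carrier_dist_le hx
  have hne : Oᶜ.Nonempty := nonempty_compl.2 hO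
  have h1 := h.dist_le_diam Q hQ
  have h2 := infDist_le_setDist_add hy Q.isCompact_carrier.isBounded hne
  have h3 := Metric.infDist_le_infDist_add_dist (s := Oᶜ) (x := x) (y := y)
  rw [Q.diam_carrier] at h1 h2
  linarith

theorem mem_of_mem_dilate (h : IsWhitneyCovering O 𝒬) (hO : O ≠ univ) {Q : DyadicCube d}
    (hQ : Q ∈ 𝒬) {x : Euc d} (hx : x ∈ Q.dilate 2) : x ∈ O := by
  by_contra hc
  have h1 := h.lt_infDist hO hQ hx
  rw [Metric.infDist_zero_of_mem hc] at h1
  have := Q.side_pos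
  have : 0 ≤ √d * (Q.side / 2) := by positivity
  linarith

/-- Cubes of the covering whose doubles share a point have comparable sizes. -/
theorem side_lt_of_mem (h : IsWhitneyCovering O 𝒬) (hO : O ≠ univ) {Q Q' : DyadicCube d}
    (hQ : Q ∈ 𝒬) (hQ' : Q' ∈ 𝒬) {x : Euc d} (hx : x ∈ Q.dilate 2) (hx' : x ∈ Q'.dilate 2) :
    Q.side < 11 * Q'.side := by
  have h1 := h.lt_infDist hO hQ hx
  have h2 := h.infDist_le hO hQ' hx'
  have hd : 0 ≤ √(d : ℝ) := Real.sqrt_nonneg _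
  by_contra hc
  push Not at hc
  nlinarith

/-- Since `11 < 2 ^ 4`, the cubes whose doubles contain `x` occupy at most four consecutive levels.
The window starts at the lowest of them. -/
theorem exists_subset_range_window (h : IsWhitneyCovering O 𝒬) (hO : O ≠ univ) (x : Euc d) :
    ∃ k₀, {Q ∈ 𝒬 | x ∈ Q.dilate 2} ⊆ range (DyadicCube.window k₀ x) := by
  by_cases hne : {Q ∈ 𝒬 | x ∈ Q.dilate 2}.Nonempty
  · obtain ⟨Q₁, h₁⟩ := hne
    have bdd : ∀ Q ∈ {Q ∈ 𝒬 | x ∈ Q.dilate 2}, ∀ Q' ∈ {Q ∈ 𝒬 | x ∈ Q.dilate 2},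
        Q.level < Q'.level + 4 := by
      intro Q hQ Q' hQ'
      have := h.side_lt_of_mem hO hQ.1 hQ'.1 hQ.2 hQ'.2
      unfold DyadicCube.side at this
      rw [← zpow_lt_zpow_iff_right₀ (one_lt_two : (1 : ℝ) < 2), zpow_add₀ two_ne_zero]
      refine this.trans ?_
      have : (0 : ℝ) < 2 ^ Q'.level := by positivity
      norm_num
      linarith
    obtain ⟨k₀, ⟨Q₀, hQ₀, rfl⟩, hk⟩ := Int.exists_least_of_bdd
      (P := fun k => ∃ Q ∈ {Q ∈ 𝒬 | x ∈ Q.dilate 2}, Q.level = k)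
      ⟨Q₁.level - 4, by rintro _ ⟨Q, hQ, rfl⟩; have := bdd _ h₁ _ hQ; omega⟩ ⟨_, Q₁, h₁, rfl⟩
    exact ⟨Q₀.level, fun Q hQ => Q.mem_range_window (hk _ ⟨Q, hQ, rfl⟩) (bdd _ hQ _ hQ₀) hQ.2⟩
  · rw [not_nonempty_iff_eq_empty] at hne
    exact ⟨0, by rw [hne]; exact empty_subset _⟩

theorem finite_setOf_mem (h : IsWhitneyCovering O 𝒬) (hO : O ≠ univ) (x : Euc d) :
    {Q ∈ 𝒬 | x ∈ Q.dilate 2}.Finite :=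
  let ⟨_, hk⟩ := h.exists_subset_range_window hO x
  (finite_range _).subset hk

theorem ncard_setOf_mem_le (h : IsWhitneyCovering O 𝒬) (hO : O ≠ univ) (x : Euc d) :
    {Q ∈ 𝒬 | x ∈ Q.dilate 2}.ncard ≤ 4 * 3 ^ d := by
  obtain ⟨k, hk⟩ := h.exists_subset_range_window hO x
  refine (ncard_le_ncard hk (finite_range _)).trans ?_
  rw [← image_univ]
  refine (ncard_image_le finite_univ).trans ?_
  simp [ncard_univ]

theorem exists_mem (h : IsWhitneyCovering O 𝒬) {x : Euc d} (hx : x ∈ O) :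
    ∃ Q ∈ 𝒬, x ∈ Q.carrier := by
  rw [← h.iUnion_eq] at hx
  simpa using hx

end IsWhitneyCovering

/-! ### Existence of Whitney coverings -/

namespace DyadicCube

variable {d : ℕ}

/-- The dyadic cube of side length `2 ^ k` that contains `x`. -/
noncomputable def cubeAt (k : ℤ) (x : Euc d) : DyadicCube d := ⟨k, fun i => ⌊x i / (2 : ℝ) ^ k⌋⟩

/-- The dyadic cube of twice the side length that contains `Q`. -/
def parent (Q : DyadicCube d) : DyadicCube d := ⟨Q.level + 1, fun i => Q.index i / 2⟩

theorem side_parent (Q : DyadicCube d) : Q.parent.side = 2 * Q.side := by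
  simp [side, parent, zpow_add₀, mul_comm]

theorem carrier_subset_parent (Q : DyadicCube d) : Q.carrier ⊆ Q.parent.carrier := by
  intro x hx i
  have hs := Q.side_pos
  obtain ⟨h1, h2⟩ := hx i
  have h3 : 2 * (Q.index i / 2) ≤ Q.index i := by omega
  have h4 : Q.index i + 1 ≤ 2 * (Q.index i / 2 + 1) := by omega
  have h3' : 2 * ((Q.index i / 2 : ℤ) : ℝ) ≤ Q.index i := by exact_mod_cast h3
  have h4' : (Q.index i : ℝ) + 1 ≤ 2 * (((Q.index i / 2 : ℤ) : ℝ) + 1) := by exact_mod_cast h4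
  rw [side_parent]
  change 2 * Q.side * ((Q.index i / 2 : ℤ) : ℝ) ≤ _ ∧ _ ≤ 2 * Q.side * (((Q.index i / 2 : ℤ) : ℝ) + 1)
  constructor <;> nlinarith

theorem mem_cubeAt (k : ℤ) (x : Euc d) : x ∈ (cubeAt k x).carrier := by
  intro i
  have h1 := Int.floor_le (x i / (2 : ℝ) ^ k)
  have h2 := (Int.lt_floor_add_one (x i / (2 : ℝ) ^ k)).le
  have h3 : (0 : ℝ) < 2 ^ k := by positivity
  rw [le_div_iff₀ h3] at h1
  rw [div_le_iff₀ h3] at h2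
  change (2 : ℝ) ^ k * _ ≤ _ ∧ _ ≤ (2 : ℝ) ^ k * _
  rw [mul_comm, mul_comm ((2 : ℝ) ^ k)]
  exact ⟨h1, h2⟩

theorem parent_cubeAt (k : ℤ) (x : Euc d) : (cubeAt k x).parent = cubeAt (k + 1) x := by
  simp only [parent, cubeAt, DyadicCube.mk.injEq, true_and]
  funext i
  have h3 : (0 : ℝ) < 2 ^ k := by positivity
  rw [zpow_add_one₀ two_ne_zero, ← div_div]
  set z := x i / (2 : ℝ) ^ k
  have := Int.floor_div_natCast z 2
  simpa using this.symm

/-- The interior excludes the upper faces, where the floor would select the next cube. -/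
theorem eq_cubeAt_of_mem_interior (Q : DyadicCube d) {x : Euc d} (hx : x ∈ interior Q.carrier) :
    Q = cubeAt Q.level x := by
  obtain ⟨k, m⟩ := Q
  simp only [cubeAt, DyadicCube.mk.injEq, true_and]
  funext i
  have h3 : (0 : ℝ) < 2 ^ k := by positivity
  have hlt : x i < (2 : ℝ) ^ k * ((m i : ℝ) + 1) := by
    rw [mem_interior_iff_mem_nhds, Metric.mem_nhds_iff] at hx
    obtain ⟨ε, hε, h⟩ := hx
    have : x + EuclideanSpace.single i (ε / 2) ∈ Metric.ball x ε := by
      rw [mem_ball_iff_norm]; simp [abs_of_pos hε]; exact hε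
    have := (h this i).2
    change x i + EuclideanSpace.single i (ε / 2) i ≤ (2 : ℝ) ^ k * ((m i : ℝ) + 1) at this
    simp only [PiLp.single_apply, if_true] at this
    linarith
  have hle := (interior_subset hx i).1
  change (2 : ℝ) ^ k * (m i : ℝ) ≤ x i at hle
  symm
  rw [Int.floor_eq_iff, le_div_iff₀ h3, div_lt_iff₀ h3]
  constructor <;> linarith

end DyadicCube

section Covering

variable {d : ℕ} {O : Set (Euc d)}

open DyadicCube

/-- The cube is small compared to its distance to the complement of `O`. -/
def IsSmallCube (O : Set (Euc d)) (Q : DyadicCube d) : Prop :=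
  Metric.diam Q.carrier < setDist Q.carrier Oᶜ

/-- A subcube has a smaller diameter and a larger distance to `Oᶜ`. Hence the levels at which the
cube at `x` is small are closed downwards, which makes "maximal small cube" meaningful. -/
theorem IsSmallCube.of_parent (hO : Oᶜ.Nonempty) {Q : DyadicCube d}
    (h : IsSmallCube O Q.parent) : IsSmallCube O Q := by
  have h1 : Metric.diam Q.carrier ≤ Metric.diam Q.parent.carrier :=
    Metric.diam_mono Q.carrier_subset_parent Q.parent.isCompact_carrier.isBounded
  refine h1.trans_lt (h.trans_le ?_)
  refine csInf_le_csInf ⟨0, ?_⟩ (Q.nonempty_carrier.image2 hO)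
    (image2_subset_right Q.carrier_subset_parent)
  rintro _ ⟨x, -, y, -, rfl⟩
  exact dist_nonneg

theorem IsSmallCube.cubeAt_of_le (hO : Oᶜ.Nonempty) {x : Euc d} {k l : ℤ} (hkl : k ≤ l)
    (h : IsSmallCube O (cubeAt l x)) : IsSmallCube O (cubeAt k x) := by
  induction k, hkl using Int.leInductionDown with
  | base => exact h
  | pred n hn ih =>
    refine IsSmallCube.of_parent hO ?_
    rwa [parent_cubeAt, sub_add_cancel]

theorem IsSmallCube.notMem_compl {Q : DyadicCube d} (h : IsSmallCube O Q) {x : Euc d}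
    (hx : x ∈ Q.carrier) : x ∈ O := by
  by_contra hc
  have h1 := setDist_le_dist hx (mem_compl hc)
  rw [dist_self] at h1
  have h2 : 0 ≤ Metric.diam Q.carrier := Metric.diam_nonneg
  unfold IsSmallCube at h
  linarith

/-- The maximal small cubes form a Whitney covering. -/
theorem isWhitneyCovering_maximal (hd : 1 ≤ d) (hO : IsOpen O) (hO' : O ≠ univ) :
    IsWhitneyCovering O {Q | IsSmallCube O Q ∧ ¬ IsSmallCube O Q.parent} := by
  have hne : Oᶜ.Nonempty := nonempty_compl.2 hO'
  have hd0 : 0 < √(d : ℝ) := by have : 0 < d := hd; positivity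
  -- Maximality enters here: a parent that is not small is at distance at most `2 diam Q` from `Oᶜ`,
  -- and crossing it costs another `2 diam Q`.
  have upper : ∀ Q : DyadicCube d, ¬ IsSmallCube O Q.parent → ∀ x ∈ Q.carrier,
      Metric.infDist x Oᶜ ≤ 4 * (√d * Q.side) := by
    intro Q hQ x hx
    have h1 := infDist_le_setDist_add (Q.carrier_subset_parent hx)
      Q.parent.isCompact_carrier.isBounded hne
    unfold IsSmallCube at hQ
    push Not at hQ
    rw [diam_carrier, side_parent] at h1 hQ
    linarith
  refine ⟨?_, ?_, fun Q hQ => hQ.1, ?_, ?_⟩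
  · ext x
    simp only [mem_iUnion]
    refine ⟨fun ⟨Q, hQ, hx⟩ => hQ.1.notMem_compl hx, fun hx => ?_⟩
    have hδ : 0 < Metric.infDist x Oᶜ :=
      (hO.isClosed_compl.notMem_iff_infDist_pos hne).1 (by simpa using hx)
    -- A largest level exists: smallness forces `√d 2^k < dist(x, Oᶜ)`, and it holds as soon as `2
    -- √d 2^k < dist(x, Oᶜ)`.
    obtain ⟨k, hk, hmax⟩ := Int.exists_greatest_of_bdd
      (P := fun k => IsSmallCube O (cubeAt k x)) (by
        obtain ⟨n, hn⟩ := pow_unbounded_of_one_lt (Metric.infDist x Oᶜ / √d)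
          (one_lt_two : (1 : ℝ) < 2)
        refine ⟨n, fun k hk => ?_⟩
        have h1 := hk.trans_le (setDist_le_infDist (mem_cubeAt k x) hne)
        rw [diam_carrier] at h1
        rw [div_lt_iff₀ hd0] at hn
        have h2 : (2 : ℝ) ^ k < 2 ^ (n : ℤ) := by
          rw [zpow_natCast]
          change √d * (2 : ℝ) ^ k < _ at h1
          nlinarith
        exact ((zpow_lt_zpow_iff_right₀ one_lt_two).1 h2).le) (by
        obtain ⟨n, hn⟩ := exists_pow_lt_of_lt_one
          (show 0 < Metric.infDist x Oᶜ / (2 * √d) by positivity) (by norm_num : (1 / 2 : ℝ) < 1)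
        refine ⟨-n, ?_⟩
        have h1 := infDist_le_setDist_add (mem_cubeAt (-n : ℤ) x)
          (cubeAt (-n : ℤ) x).isCompact_carrier.isBounded hne
        unfold IsSmallCube
        rw [lt_div_iff₀ (by positivity)] at hn
        rw [diam_carrier] at *
        have h2 : (cubeAt (-n : ℤ) x).side = (1 / 2) ^ n := by simp [side, cubeAt]
        rw [h2] at h1 ⊢
        linarith)
    refine ⟨cubeAt k x, ⟨hk, fun h => ?_⟩, mem_cubeAt k x⟩
    rw [parent_cubeAt] at h
    have := hmax _ h
    omega
  -- If `Q'` were larger and shared an interior point with `Q`, it would be an ancestor of `Q`. The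
  -- parent of `Q` would then inherit smallness from `Q'`.
  · have key : ∀ Q ∈ {Q | IsSmallCube O Q ∧ ¬ IsSmallCube O Q.parent}, ∀ Q' ∈
        {Q | IsSmallCube O Q ∧ ¬ IsSmallCube O Q.parent}, ∀ z ∈ interior Q.carrier,
        z ∈ interior Q'.carrier → Q'.level ≤ Q.level := by
      intro Q hQ Q' hQ' z hz hz'
      by_contra hlt
      push Not at hlt
      refine hQ.2 ?_
      rw [Q.eq_cubeAt_of_mem_interior hz, parent_cubeAt]
      refine IsSmallCube.cubeAt_of_le hne (l := Q'.level) (by omega) ?_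
      rw [← Q'.eq_cubeAt_of_mem_interior hz']
      exact hQ'.1
    intro Q hQ Q' hQ' hneq
    rw [Set.disjoint_left]
    intro z hz hz'
    refine hneq ?_
    rw [Q.eq_cubeAt_of_mem_interior hz, Q'.eq_cubeAt_of_mem_interior hz',
      le_antisymm (key Q' hQ' Q hQ z hz' hz) (key Q hQ Q' hQ' z hz hz')]
  · intro Q hQ
    rw [diam_carrier]
    exact (setDist_le_infDist Q.center_mem_carrier hne).trans
      (upper Q hQ.2 _ Q.center_mem_carrier)
  · rintro Q hQ Q' hQ' ⟨z, hz, hz'⟩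
    have h1 := hQ.1.trans_le (setDist_le_infDist hz hne)
    have h2 := upper Q' hQ'.2 z hz'
    rw [diam_carrier] at *
    rw [diam_carrier]
    -- The inequality is strict and the sides are powers of two, so the factor `4` improves to `2`.
    have h3 : Q.side < 4 * Q'.side := by nlinarith
    have h4 : (2 : ℝ) ^ Q.level < 2 ^ (Q'.level + 2) := by
      rw [zpow_add₀ two_ne_zero]
      unfold side at h3
      norm_num
      linarith
    rw [zpow_lt_zpow_iff_right₀ one_lt_two] at h4
    have h5 : (2 : ℝ) ^ Q.level ≤ 2 ^ (Q'.level + 1) :=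
      zpow_le_zpow_right₀ one_le_two (by omega)
    rw [zpow_add₀ two_ne_zero, zpow_one] at h5
    change √d * (2 : ℝ) ^ Q.level ≤ 2 * (√d * (2 : ℝ) ^ Q'.level)
    nlinarith

end Covering

/-! ### Existence of partitions of unity -/

namespace DyadicCube

variable {d : ℕ} (Q : DyadicCube d)

/-- A bump that is `1` on the cube and vanishes at distance `side / 32` of it. -/
noncomputable def bump (x : Euc d) : ℝ := max 0 (1 - 32 / Q.side * Metric.infDist x Q.carrier)

theorem bump_nonneg (x : Euc d) : 0 ≤ Q.bump x := le_max_left _ _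

theorem bump_eq_one {x : Euc d} (hx : x ∈ Q.carrier) : Q.bump x = 1 := by
  simp [bump, Metric.infDist_zero_of_mem hx]

theorem abs_bump_sub_le (x y : Euc d) : |Q.bump x - Q.bump y| ≤ 32 / Q.side * dist x y := by
  have hs := Q.side_pos
  unfold bump
  rw [max_comm 0, max_comm 0]
  refine (abs_max_sub_max_le_abs _ _ _).trans ?_
  rw [show 1 - 32 / Q.side * Metric.infDist x Q.carrier
    - (1 - 32 / Q.side * Metric.infDist y Q.carrier)
    = -(32 / Q.side * (Metric.infDist x Q.carrier - Metric.infDist y Q.carrier)) by ring, abs_neg,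
    abs_mul, abs_of_pos (by positivity)]
  gcongr
  simpa [Real.dist_eq] using (Metric.lipschitz_infDist_pt Q.carrier).dist_le_mul x y

theorem exists_of_bump_ne_zero {x : Euc d} (hx : Q.bump x ≠ 0) :
    ∃ y ∈ Q.carrier, dist x y < Q.side / 32 := by
  have hs := Q.side_pos
  refine (Metric.infDist_lt_iff Q.nonempty_carrier).1 ?_
  by_contra hc
  push Not at hc
  refine hx (max_eq_left ?_)
  rw [sub_nonpos]
  calc (1 : ℝ) = 32 / Q.side * (Q.side / 32) := by field_simp
    _ ≤ _ := by gcongr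

theorem mem_dilate_of_dist_le {t : ℝ} {x y : Euc d} (hy : y ∈ Q.dilate t) {r : ℝ}
    (h : dist x y ≤ r * Q.side / 2) : x ∈ Q.dilate (t + r) := by
  intro i
  have h1 := hy i
  rw [dist_eq_norm] at h
  have h2 := (Euc.abs_apply_le (x - y) i).trans h
  rw [PiLp.sub_apply] at h2
  rw [abs_le] at *
  constructor <;> linarith

theorem mem_dilate_of_bump_ne_zero {x : Euc d} (hx : Q.bump x ≠ 0) : x ∈ Q.dilate (9 / 8) := by
  obtain ⟨y, hy, h⟩ := Q.exists_of_bump_ne_zero hx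
  rw [← dilate_one] at hy
  refine Q.dilate_mono (by norm_num) (Q.mem_dilate_of_dist_le hy (r := 1 / 16) ?_)
  linarith

theorem carrier_subset_closure_interior : Q.carrier ⊆ closure (interior Q.carrier) := by
  rw [← dilate_one]
  rw [(Q.convex_dilate 1).closure_interior_eq_closure_of_nonempty_interior]
  · exact subset_closure
  · refine ⟨Q.center, mem_interior.2 ⟨Metric.ball Q.center (1 * Q.side / 2), ?_,
      Metric.isOpen_ball, Metric.mem_ball_self (by have := Q.side_pos; positivity)⟩⟩
    exact Metric.ball_subset_closedBall.trans (Q.closedBall_subset_dilate 1)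

theorem mem_interior_carrier {x : Euc d} (hx : ∀ i, |x i - Q.center i| < Q.side / 2) :
    x ∈ interior Q.carrier := by
  refine mem_interior.2 ⟨{x | ∀ i, |x i - Q.center i| < Q.side / 2}, ?_, ?_, hx⟩
  · intro y hy
    rw [mem_carrier_iff]
    exact fun i => (hy i).le
  · rw [ofPred_forall]
    exact isOpen_iInter_of_finite fun i => isOpen_lt (by fun_prop) continuous_const

end DyadicCube

namespace IsWhitneyCovering

variable {d : ℕ} {O : Set (Euc d)} {𝒬 : Set (DyadicCube d)}

/-- The sum of the bumps of a family of cubes. -/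
noncomputable def bumpSum (𝒬 : Set (DyadicCube d)) (x : Euc d) : ℝ := ∑' Q : 𝒬, Q.1.bump x

/-- The ratio of the sides is a power of two below `11`, hence at most `8`. -/
theorem side_le_of_mem_dilate (h : IsWhitneyCovering O 𝒬) (hO : O ≠ univ) {Q Q' : DyadicCube d}
    (hQ : Q ∈ 𝒬) (hQ' : Q' ∈ 𝒬) {x : Euc d} (hx : x ∈ Q.carrier)
    (hx' : x ∈ Q'.dilate (9 / 8)) : Q'.side ≤ 8 * Q.side := by
  have h1 := h.side_lt_of_mem hO hQ' hQ (Q'.dilate_mono (by norm_num) hx')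
    (Q.carrier_subset_dilate one_le_two hx)
  have : (2 : ℝ) ^ Q'.level < 2 ^ (Q.level + 4) := by
    rw [zpow_add₀ two_ne_zero]
    unfold DyadicCube.side at h1
    have : (0 : ℝ) < 2 ^ Q.level := by positivity
    norm_num
    linarith
  rw [zpow_lt_zpow_iff_right₀ one_lt_two] at this
  have h5 : (2 : ℝ) ^ Q'.level ≤ 2 ^ (Q.level + 3) :=
    zpow_le_zpow_right₀ one_le_two (by omega)
  rw [zpow_add₀ two_ne_zero] at h5
  unfold DyadicCube.side
  norm_num at h5
  linarith

/-- This dictates the width `side / 32` of the bumps. If the bump of `Q'` is nonzero at a point of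
`1/2 Q`, then `Q'` has at most `8` times the side of `Q`, so it has a point within `Q.side / 4` of
`1/2 Q`, that is, inside the interior of `Q`. -/
theorem bump_eq_zero_of_mem_half (h : IsWhitneyCovering O 𝒬) (hO : O ≠ univ)
    {Q Q' : DyadicCube d} (hQ : Q ∈ 𝒬) (hQ' : Q' ∈ 𝒬) (hne : Q' ≠ Q) {x : Euc d}
    (hx : x ∈ Q.dilate (1 / 2)) : Q'.bump x = 0 := by
  by_contra hc
  have hs := Q.side_pos
  have hxc : x ∈ Q.carrier := by
    rw [← DyadicCube.dilate_one]; exact Q.dilate_mono (by norm_num) hx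
  have h8 := h.side_le_of_mem_dilate hO hQ hQ' hxc (Q'.mem_dilate_of_bump_ne_zero hc)
  obtain ⟨y, hy, hxy⟩ := Q'.exists_of_bump_ne_zero hc
  have hyi : y ∈ interior Q.carrier := by
    refine Q.mem_interior_carrier fun i => ?_
    have h1 := hx i
    change |x i - Q.center i| ≤ _ at h1
    have h2 := (Euc.abs_apply_le (x - y) i).trans_lt (by rwa [dist_eq_norm] at hxy)
    rw [PiLp.sub_apply] at h2
    rw [abs_le] at h1
    rw [abs_lt] at *
    constructor <;> linarith
  -- The point `y` may lie on the boundary of `Q'`; interior points of `Q'` near it are still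
  -- interior to `Q`.
  obtain ⟨z, hz, hz'⟩ := mem_closure_iff.1 (Q'.carrier_subset_closure_interior hy) _
    isOpen_interior hyi
  exact Set.disjoint_left.1 (h.disjoint_interior hQ' hQ hne) hz' hz


theorem bump_eq_zero {x : Euc d} {Q : DyadicCube d}
    (hQ : Q ∈ 𝒬) {t : Finset (DyadicCube d)}
    (ht : ∀ Q ∈ 𝒬, x ∈ Q.dilate 2 → Q ∈ t) (hQt : Q ∉ t) : Q.bump x = 0 := by
  by_contra hc
  exact hQt (ht Q hQ (Q.dilate_mono (by norm_num) (Q.mem_dilate_of_bump_ne_zero hc)))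

theorem bumpSum_eq_sum {x : Euc d}
    {t : Finset (DyadicCube d)} (ht : ∀ Q ∈ 𝒬, x ∈ Q.dilate 2 → Q ∈ t) (ht' : ↑t ⊆ 𝒬) :
    bumpSum 𝒬 x = ∑ Q ∈ t, Q.bump x := by
  unfold bumpSum
  rw [tsum_subtype 𝒬 (fun Q => Q.bump x), tsum_eq_sum (s := t)]
  · refine Finset.sum_congr rfl fun Q hQ => ?_
    rw [indicator_of_mem (ht' hQ)]
  · intro Q hQ
    by_cases h1 : Q ∈ 𝒬
    · rw [indicator_of_mem h1, bump_eq_zero h1 ht hQ]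
    · rw [indicator_of_notMem h1]

theorem summable_bump (h : IsWhitneyCovering O 𝒬) (hO : O ≠ univ) (x : Euc d) :
    Summable fun Q : 𝒬 => Q.1.bump x := by
  refine summable_of_hasFiniteSupport ?_
  refine Finite.subset ((h.finite_setOf_mem hO x).preimage Subtype.val_injective.injOn) ?_
  intro Q hQ
  exact ⟨Q.2, Q.1.dilate_mono (by norm_num) (Q.1.mem_dilate_of_bump_ne_zero hQ)⟩

theorem one_le_bumpSum (h : IsWhitneyCovering O 𝒬) (hO : O ≠ univ) {x : Euc d} (hx : x ∈ O) :
    1 ≤ bumpSum 𝒬 x := by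
  obtain ⟨Q, hQ, hxQ⟩ := h.exists_mem hx
  have := (h.summable_bump hO x).le_tsum ⟨Q, hQ⟩ fun Q' _ => Q'.1.bump_nonneg x
  rwa [Q.bump_eq_one hxQ] at this

/-- Only cubes whose doubles contain `x` or `y` contribute, at most `4 * 3 ^ d` for each point.
Their sides exceed `Q.side / 11`, so each bump has slope at most `11 * 32 / Q.side`. -/
theorem abs_bumpSum_sub_le (h : IsWhitneyCovering O 𝒬) (hO : O ≠ univ) {Q : DyadicCube d}
    (hQ : Q ∈ 𝒬) {x y : Euc d} (hx : x ∈ Q.dilate 2) (hy : y ∈ Q.dilate 2) :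
    |bumpSum 𝒬 x - bumpSum 𝒬 y| ≤ 2 * (4 * 3 ^ d) * (11 * 32 / Q.side) * dist x y := by
  classical
  have hs := Q.side_pos
  set A := (h.finite_setOf_mem hO x).toFinset
  set B := (h.finite_setOf_mem hO y).toFinset
  have hA : A.card ≤ 4 * 3 ^ d := by
    rw [← ncard_eq_toFinset_card _ (h.finite_setOf_mem hO x)]; exact h.ncard_setOf_mem_le hO x
  have hB : B.card ≤ 4 * 3 ^ d := by
    rw [← ncard_eq_toFinset_card _ (h.finite_setOf_mem hO y)]; exact h.ncard_setOf_mem_le hO y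
  have hsub : ∀ Q' ∈ A ∪ B, Q' ∈ 𝒬 ∧ Q.side < 11 * Q'.side := by
    intro Q' hQ'
    rcases Finset.mem_union.1 hQ' with h' | h'
    · have h'' := ((h.finite_setOf_mem hO x).mem_toFinset).1 h'
      exact ⟨h''.1, h.side_lt_of_mem hO hQ h''.1 hx h''.2⟩
    · have h'' := ((h.finite_setOf_mem hO y).mem_toFinset).1 h'
      exact ⟨h''.1, h.side_lt_of_mem hO hQ h''.1 hy h''.2⟩
  have hAx : ∀ Q ∈ 𝒬, x ∈ Q.dilate 2 → Q ∈ A ∪ B := fun Q hQ hx =>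
    Finset.mem_union_left _ ((h.finite_setOf_mem hO x).mem_toFinset.2 ⟨hQ, hx⟩)
  have hBy : ∀ Q ∈ 𝒬, y ∈ Q.dilate 2 → Q ∈ A ∪ B := fun Q hQ hy =>
    Finset.mem_union_right _ ((h.finite_setOf_mem hO y).mem_toFinset.2 ⟨hQ, hy⟩)
  have hsub' : ↑(A ∪ B) ⊆ 𝒬 := fun Q' hQ' => (hsub Q' hQ').1
  rw [bumpSum_eq_sum hAx hsub', bumpSum_eq_sum hBy hsub', ← Finset.sum_sub_distrib]
  calc |∑ Q' ∈ A ∪ B, (Q'.bump x - Q'.bump y)| ≤ ∑ Q' ∈ A ∪ B, |Q'.bump x - Q'.bump y| :=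
        Finset.abs_sum_le_sum_abs _ _
    _ ≤ ∑ _Q' ∈ A ∪ B, 11 * 32 / Q.side * dist x y := by
        refine Finset.sum_le_sum fun Q' hQ' => (Q'.abs_bump_sub_le x y).trans ?_
        gcongr ?_ * _
        rw [div_le_div_iff₀ Q'.side_pos hs]
        linarith [(hsub Q' hQ').2]
    _ = (A ∪ B).card * (11 * 32 / Q.side * dist x y) := by simp
    _ ≤ (2 * (4 * 3 ^ d)) * (11 * 32 / Q.side * dist x y) := by
        gcongr
        have : (A ∪ B).card ≤ 2 * (4 * 3 ^ d) :=
          (Finset.card_union_le _ _).trans (by omega)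
        exact_mod_cast this
    _ = _ := by ring

/-- The normalized bumps form a partition of unity. -/
theorem isWhitneyPartition (h : IsWhitneyCovering O 𝒬) (hO : O ≠ univ) :
    IsWhitneyPartition O 𝒬 (fun Q x => Q.bump x / bumpSum 𝒬 x)
      ⟨√d * (32 + 2 * (4 * 3 ^ d) * (11 * 32)), by positivity⟩ := by
  have nonneg : ∀ (Q : DyadicCube d) x, 0 ≤ Q.bump x / bumpSum 𝒬 x := fun Q x =>
    div_nonneg (Q.bump_nonneg x) (tsum_nonneg fun Q => Q.1.bump_nonneg x)
  have le_one : ∀ Q ∈ 𝒬, ∀ x, Q.bump x / bumpSum 𝒬 x ≤ 1 := fun Q hQ x =>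
    div_le_one_of_le₀
      ((h.summable_bump hO x).le_tsum ⟨Q, hQ⟩ fun Q' _ => Q'.1.bump_nonneg x)
      (tsum_nonneg fun Q => Q.1.bump_nonneg x)
  refine ⟨fun x hx => ?_, fun Q hQ x => ?_, fun Q hQ x => ?_, fun Q hQ => ?_⟩
  · rw [tsum_div_const]
    exact div_self (zero_lt_one.trans_le (h.one_le_bumpSum hO hx)).ne'
  · by_cases hx : x ∈ Q.dilate (1 / 2)
    · rw [indicator_of_mem hx]
      have : bumpSum 𝒬 x = Q.bump x := by
        unfold bumpSum
        rw [tsum_eq_single ⟨Q, hQ⟩]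
        intro Q' hQ'
        exact h.bump_eq_zero_of_mem_half hO hQ Q'.2 (fun h' => hQ' (Subtype.ext h')) hx
      have hxc : x ∈ Q.carrier := by
        rw [← DyadicCube.dilate_one]; exact Q.dilate_mono (by norm_num) hx
      rw [this, Q.bump_eq_one hxc, div_one]
    · rw [indicator_of_notMem hx]
      exact nonneg Q x
  · by_cases hx : x ∈ Q.dilate (9 / 8)
    · rw [indicator_of_mem hx]
      exact le_one Q hQ x
    · rw [indicator_of_notMem hx]
      have : Q.bump x = 0 := by
        by_contra hc
        exact hx (Q.mem_dilate_of_bump_ne_zero hc)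
      simp [this]
  · have hs := Q.side_pos
    have key : ∀ x y, Q.bump y ≠ 0 → |Q.bump x / bumpSum 𝒬 x - Q.bump y / bumpSum 𝒬 y|
        ≤ (32 + 2 * (4 * 3 ^ d) * (11 * 32)) / Q.side * dist x y := by
      intro x y hy
      have hy2 := Q.mem_dilate_of_bump_ne_zero hy
      -- Up to distance `side / 16`, `x` stays in `5/4 Q`, where the sum of the bumps is at least
      -- `1` and the quotient can be differenced. Beyond it the trivial bound `1` on the difference
      -- suffices.
      by_cases hxy : dist x y ≤ 1 / 8 * Q.side / 2
      · have hx2 : x ∈ Q.dilate 2 :=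
          Q.dilate_mono (by norm_num) (Q.mem_dilate_of_dist_le hy2 hxy)
        have hy2' := Q.dilate_mono (by norm_num : (9 / 8 : ℝ) ≤ 2) hy2
        have hSx := h.one_le_bumpSum hO (h.mem_of_mem_dilate hO hQ hx2)
        have hSy := h.one_le_bumpSum hO (h.mem_of_mem_dilate hO hQ hy2')
        have hS := h.abs_bumpSum_sub_le hO hQ hx2 hy2'
        have hb := Q.abs_bump_sub_le x y
        have hby := le_one Q hQ y
        have hny := nonneg Q y
        set Sx := bumpSum 𝒬 x
        set Sy := bumpSum 𝒬 y
        have hSx0 : 0 < Sx := by linarith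
        have hSy0 : 0 < Sy := by linarith
        have e : Q.bump x / Sx - Q.bump y / Sy
            = (Q.bump x - Q.bump y) / Sx - (Q.bump y / Sy) * ((Sx - Sy) / Sx) := by
          field_simp
          ring
        rw [e]
        refine (abs_sub _ _).trans ?_
        rw [abs_mul, abs_div, abs_div (Sx - Sy), abs_of_pos hSx0, abs_of_nonneg hny]
        have h1 : |Q.bump x - Q.bump y| / Sx ≤ |Q.bump x - Q.bump y| :=
          div_le_self (abs_nonneg _) hSx
        have h2 : |Sx - Sy| / Sx ≤ |Sx - Sy| := div_le_self (abs_nonneg _) hSx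
        have h3 : Q.bump y / Sy * (|Sx - Sy| / Sx) ≤ 1 * |Sx - Sy| := by
          gcongr
        calc _ ≤ 32 / Q.side * dist x y
              + 2 * (4 * 3 ^ d) * (11 * 32 / Q.side) * dist x y := by linarith
          _ = _ := by ring
      · push Not at hxy
        have h1 : |Q.bump x / bumpSum 𝒬 x - Q.bump y / bumpSum 𝒬 y| ≤ 1 := by
          rw [abs_le]
          constructor <;> linarith [le_one Q hQ x, le_one Q hQ y, nonneg Q x, nonneg Q y]
        refine h1.trans ?_
        calc (1 : ℝ) ≤ 32 / Q.side * (1 / 8 * Q.side / 2) := by field_simp; norm_num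
          _ ≤ (32 + 2 * (4 * 3 ^ d) * (11 * 32)) / Q.side * dist x y := by
            gcongr
            linarith [show (0 : ℝ) ≤ 2 * (4 * 3 ^ d) * (11 * 32) by positivity]
    intro x y
    have hK : (32 + 2 * (4 * 3 ^ d) * (11 * 32)) / Q.side * dist x y
        ≤ √d * (32 + 2 * (4 * 3 ^ d) * (11 * 32)) / Metric.diam Q.carrier * dist x y := by
      -- For `d = 0` the diameter is `0` and so is the quotient by it, but then `x = y`.
      rcases Nat.eq_zero_or_pos d with rfl | hd
      · simp [Subsingleton.elim x y]
      · rw [Q.diam_carrier, mul_div_mul_left]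
        have : (0 : ℝ) < d := by exact_mod_cast hd
        positivity
    refine le_trans ?_ hK
    by_cases hy : Q.bump y = 0
    · by_cases hx : Q.bump x = 0
      · simp only [hx, hy, zero_div, sub_zero, abs_zero]
        positivity
      · rw [abs_sub_comm, dist_comm]
        exact key y x hx
    · exact key x y hy

end IsWhitneyCovering

theorem exists_isWhitneyCovering_isWhitneyPartition {d : ℕ} (hd : 1 ≤ d) :
    ∃ K : ℝ≥0, ∀ O : Set (Euc d), IsOpen O → O ≠ univ →
      ∃ (𝒬 : Set (DyadicCube d)) (ψ : DyadicCube d → Euc d → ℝ),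
        IsWhitneyCovering O 𝒬 ∧ IsWhitneyPartition O 𝒬 ψ K :=
  ⟨_, fun _ hO hO' => ⟨_, _, isWhitneyCovering_maximal hd hO hO',
    (isWhitneyCovering_maximal hd hO hO').isWhitneyPartition hO'⟩⟩

/-! ### The gradient as a tuple of partial derivatives -/

/-- The tuple of partial derivatives of a linear map. -/
noncomputable def gradientMap (d N : ℕ) : (Euc d →L[ℝ] Euc N) →L[ℝ] GradSpace d N :=
  (PiLp.continuousLinearEquiv 2 ℝ fun _ : Fin d => Euc N).symm.toContinuousLinearMap ∘L
    ContinuousLinearMap.pi fun i =>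
      ContinuousLinearMap.apply ℝ (Euc N) (EuclideanSpace.single i (1 : ℝ))

theorem classicalGradient_eq {d N : ℕ} (φ : Euc d → Euc N) (x : Euc d) :
    classicalGradient φ x = gradientMap d N (fderiv ℝ φ x) := rfl

theorem gradientMap_apply {d N : ℕ} (A : Euc d →L[ℝ] Euc N) (i : Fin d) :
    gradientMap d N A i = A (EuclideanSpace.single i (1 : ℝ)) := rfl

/-- Cauchy–Schwarz for `A v = ∑ v_i A e_i`. Together with `norm_gradientMap_le` this permits working
with operator norms of `fderiv` at the cost of a factor `√d`. -/
theorem norm_le_norm_gradientMap {d N : ℕ} (A : Euc d →L[ℝ] Euc N) :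
    ‖A‖ ≤ ‖gradientMap d N A‖ := by
  refine A.opNorm_le_bound (norm_nonneg _) fun v => ?_
  have hv : v = ∑ i, v i • EuclideanSpace.single i (1 : ℝ) := by
    ext j
    simp [Finset.sum_apply, Pi.single_apply]
  calc ‖A v‖ = ‖∑ i, v i • A (EuclideanSpace.single i (1 : ℝ))‖ := by
        conv_lhs => rw [hv]
        simp
    _ ≤ ∑ i, ‖A (EuclideanSpace.single i (1 : ℝ))‖ * ‖v i‖ := by
        refine (norm_sum_le _ _).trans (Finset.sum_le_sum fun i _ => ?_)
        rw [norm_smul, mul_comm]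
    _ ≤ √(∑ i, ‖A (EuclideanSpace.single i (1 : ℝ))‖ ^ 2) * √(∑ i, ‖v i‖ ^ 2) :=
        Real.sum_mul_le_sqrt_mul_sqrt _ _ _
    _ = _ := by rw [PiLp.norm_eq_of_L2, EuclideanSpace.norm_eq]; rfl

theorem norm_gradientMap_le {d N : ℕ} (A : Euc d →L[ℝ] Euc N) :
    ‖gradientMap d N A‖ ≤ √d * ‖A‖ := by
  rw [PiLp.norm_eq_of_L2]
  calc √(∑ i, ‖gradientMap d N A i‖ ^ 2) ≤ √(∑ _i : Fin d, ‖A‖ ^ 2) := by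
        gcongr with i
        rw [gradientMap_apply]
        simpa using A.le_opNorm (EuclideanSpace.single i (1 : ℝ))
    _ = √d * ‖A‖ := by simp

theorem enorm_le_enorm_gradientMap {d N : ℕ} (A : Euc d →L[ℝ] Euc N) :
    ‖A‖ₑ ≤ ‖gradientMap d N A‖ₑ := enorm_le_iff_norm_le.2 (norm_le_norm_gradientMap A)

theorem enorm_gradientMap_le {d N : ℕ} (A : Euc d →L[ℝ] Euc N) :
    ‖gradientMap d N A‖ₑ ≤ ENNReal.ofReal √d * ‖A‖ₑ := by
  rw [← ofReal_norm, ← ofReal_norm, ← ENNReal.ofReal_mul (Real.sqrt_nonneg _)]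
  exact ENNReal.ofReal_le_ofReal (norm_gradientMap_le A)

theorem classicalGradient_sub {d N : ℕ} {f g : Euc d → Euc N} {x : Euc d}
    (hf : DifferentiableAt ℝ f x) (hg : DifferentiableAt ℝ g x) :
    classicalGradient (fun y => f y - g y) x = classicalGradient f x - classicalGradient g x := by
  simp only [classicalGradient_eq, ← map_sub]
  rw [fderiv_fun_sub hf hg]

theorem measurable_classicalGradient {d N : ℕ} (f : Euc d → Euc N) :
    Measurable (classicalGradient f) :=
  (gradientMap d N).continuous.measurable.comp (measurable_fderiv ℝ f)

/-! ### Limits of test functions -/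

theorem IsTestFunction.sub {d : ℕ} {F : Type*} [NormedAddCommGroup F] [NormedSpace ℝ F]
    {Ω : Set (Euc d)} {φ ψ : Euc d → F} (hφ : IsTestFunction Ω φ) (hψ : IsTestFunction Ω ψ) :
    IsTestFunction Ω fun x => φ x - ψ x :=
  ⟨hφ.1.sub hψ.1, hφ.2.1.sub hψ.2.1,
    (tsupport_sub φ ψ).trans (union_subset hφ.2.2 hψ.2.2)⟩

theorem IsTestFunction.eq_zero {d : ℕ} {F : Type*} [NormedAddCommGroup F] [NormedSpace ℝ F]
    {Ω : Set (Euc d)} {φ : Euc d → F} (hφ : IsTestFunction Ω φ) {x : Euc d} (hx : x ∉ Ω) :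
    φ x = 0 :=
  image_eq_zero_of_notMem_tsupport fun h => hx (hφ.2.2 h)

theorem IsTestFunction.fderiv_eq_zero {d : ℕ} {F : Type*} [NormedAddCommGroup F] [NormedSpace ℝ F]
    {Ω : Set (Euc d)} {φ : Euc d → F} (hφ : IsTestFunction Ω φ) {x : Euc d} (hx : x ∉ Ω) :
    fderiv ℝ φ x = 0 :=
  image_eq_zero_of_notMem_tsupport fun h => hx (hφ.2.2 (tsupport_fderiv_subset ℝ h))

theorem IsTestFunction.differentiable {d : ℕ} {F : Type*} [NormedAddCommGroup F] [NormedSpace ℝ F]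
    {Ω : Set (Euc d)} {φ : Euc d → F} (hφ : IsTestFunction Ω φ) : Differentiable ℝ φ :=
  hφ.1.differentiable (by simp)

theorem IsTestFunction.continuous_fderiv {d : ℕ} {F : Type*} [NormedAddCommGroup F]
    [NormedSpace ℝ F] {Ω : Set (Euc d)} {φ : Euc d → F} (hφ : IsTestFunction Ω φ) :
    Continuous (fderiv ℝ φ) :=
  hφ.1.continuous_fderiv (by simp)

theorem IsTestFunction.continuous_classicalGradient {d N : ℕ} {Ω : Set (Euc d)}
    {φ : Euc d → Euc N} (hφ : IsTestFunction Ω φ) : Continuous (classicalGradient φ) :=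
  (gradientMap d N).continuous.comp hφ.continuous_fderiv

theorem IsTestFunction.exists_lipschitzWith {d : ℕ} {F : Type*} [NormedAddCommGroup F]
    [NormedSpace ℝ F] {Ω : Set (Euc d)} {φ : Euc d → F} (hφ : IsTestFunction Ω φ) :
    ∃ L, LipschitzWith L φ :=
  (hφ.1.of_le (m := 1) (by simp)).lipschitzWith_of_hasCompactSupport hφ.2.1 one_ne_zero

/-- `u` and `G` are the limits in `L^p(Ω)` of a sequence of test functions and of their
gradients. -/
def IsTestLimit {d N : ℕ} (Ω : Set (Euc d)) (q : ℝ≥0∞) (u : Euc d → Euc N)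
    (G : Euc d → GradSpace d N) : Prop :=
  MemLp u q (volume.restrict Ω) ∧ MemLp G q (volume.restrict Ω) ∧
    ∃ φ : ℕ → Euc d → Euc N, (∀ n, IsTestFunction Ω (φ n)) ∧
      Tendsto (fun n => eLpNorm (fun x => φ n x - u x) q (volume.restrict Ω)) atTop (𝓝 0) ∧
      Tendsto (fun n => eLpNorm (fun x => classicalGradient (φ n) x - G x) q
        (volume.restrict Ω)) atTop (𝓝 0)

/-- On a finite measure space convergence in `L^q` implies convergence in `L^1`, and a bounded
factor preserves it. This passes both sides of the integration by parts formula to the limit. -/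
theorem tendsto_integral_smul_of_tendsto_eLpNorm {α F : Type*} [MeasurableSpace α]
    [NormedAddCommGroup F] [NormedSpace ℝ F] {μ : Measure α} [IsFiniteMeasure μ] {q : ℝ≥0∞}
    (hq : 1 ≤ q) {a : α → ℝ} (ha : AEStronglyMeasurable a μ) {C : ℝ} (hC : ∀ x, ‖a x‖ ≤ C)
    {f : ℕ → α → F} {u : α → F} (hf : ∀ n, MemLp (f n) q μ) (hu : MemLp u q μ)
    (h : Tendsto (fun n => eLpNorm (fun x => f n x - u x) q μ) atTop (𝓝 0)) :
    Tendsto (fun n => ∫ x, a x • f n x ∂μ) atTop (𝓝 (∫ x, a x • u x ∂μ)) := by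
  have hint : ∀ {g : α → F}, MemLp g q μ → Integrable (fun x => a x • g x) μ := fun hg =>
    (hg.integrable hq).bdd_smul C ha (Eventually.of_forall hC)
  refine tendsto_integral_of_L1' _ (hint hu).1 (Eventually.of_forall fun n => hint (hf n)) ?_
  have hm := fun n => (hf n).1.sub hu.1
  set c : ℝ≥0∞ := μ univ ^ (1 / (1 : ℝ≥0∞).toReal - 1 / q.toReal)
  have hc : c ≠ ⊤ := by
    refine ENNReal.rpow_ne_top_of_nonneg ?_ (measure_ne_top _ _)
    -- For `q = ⊤` one has `q.toReal = 0` and `1 / 0 = 0`, so the exponent is `1`.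
    rcases eq_or_ne q ⊤ with rfl | hq'
    · simp
    · have : 1 ≤ q.toReal := by simpa using ENNReal.toReal_mono hq' hq
      simpa using inv_le_one_of_one_le₀ this
  have lim : Tendsto (fun n => ENNReal.ofReal C * (eLpNorm (fun x => f n x - u x) q μ * c)) atTop
      (𝓝 0) := by
    have h1 := ENNReal.Tendsto.mul_const h (Or.inr hc) (b := c)
    have h2 := ENNReal.Tendsto.const_mul h1 (Or.inr (ENNReal.ofReal_ne_top (r := C)))
    simpa using h2
  refine tendsto_of_tendsto_of_tendsto_of_le_of_le tendsto_const_nhds lim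
    (fun _ => zero_le) fun n => ?_
  calc eLpNorm ((fun x => a x • f n x) - fun x => a x • u x) 1 μ
      ≤ ENNReal.ofReal C * eLpNorm (fun x => f n x - u x) 1 μ := by
        refine eLpNorm_le_mul_eLpNorm_of_ae_le_mul (Eventually.of_forall fun x => ?_) _
        simp only [Pi.sub_apply, ← smul_sub, norm_smul]
        gcongr
        exact hC x
    _ ≤ _ := by
        gcongr
        exact eLpNorm_le_eLpNorm_mul_rpow_measure_univ hq (hm n)

theorem IsTestFunction.memLp {d : ℕ} {F : Type*} [NormedAddCommGroup F]
    [NormedSpace ℝ F] {Ω : Set (Euc d)} {φ : Euc d → F} (hφ : IsTestFunction Ω φ) (q : ℝ≥0∞)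
    (μ : Measure (Euc d)) [IsFiniteMeasureOnCompacts μ] : MemLp φ q μ :=
  hφ.1.continuous.memLp_of_hasCompactSupport hφ.2.1

theorem IsTestFunction.hasCompactSupport_classicalGradient {d N : ℕ} {Ω : Set (Euc d)}
    {φ : Euc d → Euc N} (hφ : IsTestFunction Ω φ) : HasCompactSupport (classicalGradient φ) :=
  (hφ.2.1.fderiv ℝ).comp_left (map_zero (gradientMap d N))

theorem IsTestFunction.memLp_classicalGradient {d N : ℕ} {Ω : Set (Euc d)}
    {φ : Euc d → Euc N} (hφ : IsTestFunction Ω φ) (q : ℝ≥0∞)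
    (μ : Measure (Euc d)) [IsFiniteMeasureOnCompacts μ] : MemLp (classicalGradient φ) q μ :=
  hφ.continuous_classicalGradient.memLp_of_hasCompactSupport hφ.hasCompactSupport_classicalGradient

theorem IsTestFunction.integral_fderiv_smul {d N : ℕ} {Ω : Set (Euc d)}
    {η : Euc d → ℝ} (hη : IsTestFunction Ω η) {φ : Euc d → Euc N} (hφ : IsTestFunction Ω φ)
    (i : Fin d) :
    ∫ x in Ω, (fderiv ℝ η x (EuclideanSpace.single i (1 : ℝ))) • φ x
      = - ∫ x in Ω, η x • classicalGradient φ x i := by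
  set e : Euc d := EuclideanSpace.single i (1 : ℝ)
  rw [setIntegral_eq_integral_of_forall_compl_eq_zero fun x hx => by
      rw [hφ.eq_zero hx, smul_zero],
    setIntegral_eq_integral_of_forall_compl_eq_zero fun x hx => by
      rw [hη.eq_zero hx, zero_smul]]
  have c1 : Continuous fun x => fderiv ℝ η x e := hη.continuous_fderiv.clm_apply continuous_const
  have c2 : Continuous fun x => fderiv ℝ φ x e := hφ.continuous_fderiv.clm_apply continuous_const
  have := integral_bilinear_fderiv_right_eq_neg_left_of_integrable (μ := volume) (v := e)
    (f := η) (g := φ) (B := ContinuousLinearMap.lsmul ℝ ℝ)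
    ((c1.smul hφ.1.continuous).integrable_of_hasCompactSupport hφ.2.1.smul_left)
    ((hη.1.continuous.smul c2).integrable_of_hasCompactSupport hη.2.1.smul_right)
    ((hη.1.continuous.smul hφ.1.continuous).integrable_of_hasCompactSupport hφ.2.1.smul_left)
    (fun x _ => hη.differentiable x) (fun x _ => hφ.differentiable x)
  simp only [ContinuousLinearMap.lsmul_apply] at this
  rw [eq_neg_iff_add_eq_zero, add_comm, ← eq_neg_iff_add_eq_zero]
  exact this

theorem IsTestLimit.hasWeakGradient {d N : ℕ} {Ω : Set (Euc d)} (hb : Bornology.IsBounded Ω)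
    {q : ℝ≥0∞} (hq : 1 ≤ q) {u : Euc d → Euc N} {G : Euc d → GradSpace d N}
    (h : IsTestLimit Ω q u G) : HasWeakGradient Ω u G := by
  have : IsFiniteMeasure (volume.restrict Ω) := isFiniteMeasure_restrict.2 hb.measure_lt_top.ne
  obtain ⟨hu, hG, φ, hφ, h1, h2⟩ := h
  refine ⟨IntegrableOn.locallyIntegrableOn (hu.integrable hq),
    IntegrableOn.locallyIntegrableOn (hG.integrable hq), fun η hη i => ?_⟩
  have c1 : Continuous fun x => fderiv ℝ η x (EuclideanSpace.single i (1 : ℝ)) :=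
    hη.continuous_fderiv.clm_apply continuous_const
  obtain ⟨C, hC⟩ := ((hη.2.1.fderiv_apply ℝ (EuclideanSpace.single i (1 : ℝ)))).exists_bound_of_continuous c1
  obtain ⟨C', hC'⟩ := hη.2.1.exists_bound_of_continuous hη.1.continuous
  have l1 := tendsto_integral_smul_of_tendsto_eLpNorm hq c1.aestronglyMeasurable hC
    (fun n => (hφ n).memLp q _) hu h1
  have proj : ∀ {H : Euc d → GradSpace d N}, MemLp H q (volume.restrict Ω) →
      MemLp (fun x => H x i) q (volume.restrict Ω) := fun hH =>
    hH.of_le ((PiLp.proj 2 (𝕜 := ℝ) (fun _ : Fin d => Euc N) i).continuous.comp_aestronglyMeasurable hH.1)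
      (Eventually.of_forall fun x => PiLp.norm_apply_le _ _)
  have l2 := tendsto_integral_smul_of_tendsto_eLpNorm hq
    (μ := volume.restrict Ω) hη.1.continuous.aestronglyMeasurable hC'
    (f := fun n x => classicalGradient (φ n) x i) (u := fun x => G x i)
    (fun n => proj ((hφ n).memLp_classicalGradient q _)) (proj hG) (by
      refine tendsto_of_tendsto_of_tendsto_of_le_of_le tendsto_const_nhds h2
        (fun _ => zero_le) fun n => eLpNorm_mono fun x => ?_
      exact PiLp.norm_apply_le (classicalGradient (φ n) x - G x) i)
  refine tendsto_nhds_unique l1 ?_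
  refine l2.neg.congr fun n => ?_
  exact (hη.integral_fderiv_smul (hφ n) i).symm

theorem IsTestLimit.memW1p0 {d N : ℕ} {Ω : Set (Euc d)} (hb : Bornology.IsBounded Ω)
    {p : ℝ} (hp : 1 ≤ p) {u : Euc d → Euc N} {G : Euc d → GradSpace d N}
    (h : IsTestLimit Ω (ENNReal.ofReal p) u G) : MemW1p0 Ω p u :=
  ⟨h.1, G, h.hasWeakGradient hb (by simpa using ENNReal.ofReal_le_ofReal hp), h.2.1, h.2.2⟩

theorem IsTestLimit.of_tendsto {d N : ℕ} {Ω : Set (Euc d)} {q : ℝ≥0∞} (hq : 1 ≤ q)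
    {w : ℕ → Euc d → Euc N} {W : ℕ → Euc d → GradSpace d N}
    (h : ∀ n, IsTestLimit Ω q (w n) (W n)) {u : Euc d → Euc N} {G : Euc d → GradSpace d N}
    (hu : MemLp u q (volume.restrict Ω)) (hG : MemLp G q (volume.restrict Ω))
    (h1 : Tendsto (fun n => eLpNorm (fun x => w n x - u x) q (volume.restrict Ω)) atTop (𝓝 0))
    (h2 : Tendsto (fun n => eLpNorm (fun x => W n x - G x) q (volume.restrict Ω)) atTop (𝓝 0)) :
    IsTestLimit Ω q u G := by
  -- A diagonal sequence: the `n`-th test function is `1 / n`-close to the `n`-th pair. For `n = 0`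
  -- the tolerance is `⊤` and nothing is asked.
  have ex : ∀ n, ∃ φ : Euc d → Euc N, IsTestFunction Ω φ ∧
      eLpNorm (fun x => φ x - w n x) q (volume.restrict Ω) ≤ (n : ℝ≥0∞)⁻¹ ∧
      eLpNorm (fun x => classicalGradient φ x - W n x) q (volume.restrict Ω) ≤ (n : ℝ≥0∞)⁻¹ := by
    intro n
    obtain ⟨-, -, φ, hφ, l1, l2⟩ := h n
    have hn : (0 : ℝ≥0∞) < (n : ℝ≥0∞)⁻¹ := by simp
    obtain ⟨k, hk1, hk2⟩ := ((l1.eventually_le_const hn).and (l2.eventually_le_const hn)).exists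
    exact ⟨φ k, hφ k, hk1, hk2⟩
  choose φ hφ e1 e2 using ex
  refine ⟨hu, hG, φ, hφ, ?_, ?_⟩
  · refine tendsto_of_tendsto_of_tendsto_of_le_of_le tendsto_const_nhds
      (by simpa using ENNReal.tendsto_inv_nat_nhds_zero.add h1) (fun _ => zero_le) fun n => ?_
    calc eLpNorm (fun x => φ n x - u x) q (volume.restrict Ω)
        = eLpNorm ((fun x => φ n x - w n x) + fun x => w n x - u x) q (volume.restrict Ω) := by
          congr 1; ext1 x; simp
      _ ≤ _ := (eLpNorm_add_le (((hφ n).memLp q _).1.sub (h n).1.1)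
          ((h n).1.1.sub hu.1) hq).trans (add_le_add_left (e1 n) _)
  · refine tendsto_of_tendsto_of_tendsto_of_le_of_le tendsto_const_nhds
      (by simpa using ENNReal.tendsto_inv_nat_nhds_zero.add h2) (fun _ => zero_le) fun n => ?_
    calc eLpNorm (fun x => classicalGradient (φ n) x - G x) q (volume.restrict Ω)
        = eLpNorm ((fun x => classicalGradient (φ n) x - W n x) + fun x => W n x - G x) q
            (volume.restrict Ω) := by
          congr 1; ext1 x; simp
      _ ≤ _ := (eLpNorm_add_le (((hφ n).memLp_classicalGradient q _).1.sub (h n).2.1.1)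
          ((h n).2.1.1.sub hG.1) hq).trans (add_le_add_left (e2 n) _)

/-- Weak gradients are unique almost everywhere. -/
theorem HasWeakGradient.ae_eq {d N : ℕ} {Ω : Set (Euc d)} (hΩ : IsOpen Ω) {u : Euc d → Euc N}
    {G G' : Euc d → GradSpace d N} (h : HasWeakGradient Ω u G) (h' : HasWeakGradient Ω u G') :
    G =ᵐ[volume.restrict Ω] G' := by
  have proj : ∀ {H : Euc d → GradSpace d N}, LocallyIntegrableOn H Ω → ∀ i,
      LocallyIntegrableOn (fun x => H x i) Ω := fun hH i x hx =>
    let ⟨t, ht, hHt⟩ := hH x hx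
    ⟨t, ht, (PiLp.proj 2 (𝕜 := ℝ) (fun _ : Fin d => Euc N) i).integrable_comp hHt⟩
  have key : ∀ i, ∀ᵐ x, x ∈ Ω → G x i - G' x i = 0 := by
    intro i
    refine hΩ.ae_eq_zero_of_integral_contDiff_smul_eq_zero
      ((proj h.2.1 i).sub (proj h'.2.1 i)) fun g hg hgc hgs => ?_
    have e1 := h.2.2 g ⟨hg, hgc, hgs⟩ i
    have e2 := h'.2.2 g ⟨hg, hgc, hgs⟩ i
    rw [e1, neg_inj] at e2
    have int : ∀ {H : Euc d → GradSpace d N}, LocallyIntegrableOn H Ω →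
        IntegrableOn (fun x => g x • H x i) Ω := by
      intro H hH
      obtain ⟨C, hC⟩ := hgc.exists_bound_of_continuous hg.continuous
      have h1 : IntegrableOn (fun x => H x i) (tsupport g) :=
        (proj hH i).integrableOn_compact_subset hgs hgc
      refine IntegrableOn.of_forall_sdiff_eq_zero (s := tsupport g)
        (Integrable.bdd_smul h1 C hg.continuous.aestronglyMeasurable (Eventually.of_forall hC))
        hΩ.measurableSet fun x hx => ?_
      rw [image_eq_zero_of_notMem_tsupport hx.2, zero_smul]
    rw [← setIntegral_eq_integral_of_forall_compl_eq_zero (s := Ω) fun x hx => by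
      rw [image_eq_zero_of_notMem_tsupport fun h => hx (hgs h), zero_smul]]
    simp only [smul_sub]
    rw [integral_sub (int h.2.1) (int h'.2.1), e2, sub_self]
  rw [EventuallyEq, ae_restrict_iff' hΩ.measurableSet]
  filter_upwards [ae_all_iff.2 key] with x hx hxΩ
  refine PiLp.ext fun i => ?_
  exact sub_eq_zero.1 (hx i hxΩ)

/-! ### Lipschitz functions that vanish outside of a bounded open set -/

theorem tendsto_eLpNorm_sub_of_bounded {α F : Type*} [MeasurableSpace α] [NormedAddCommGroup F]
    {μ : Measure α} [IsFiniteMeasure μ] {q : ℝ≥0∞} (hq : 1 ≤ q) (hq' : q ≠ ⊤)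
    {f : ℕ → α → F} {g : α → F} (hf : ∀ n, AEStronglyMeasurable (f n) μ)
    (hg : AEStronglyMeasurable g μ) {C : ℝ} (hC : ∀ n, ∀ᵐ x ∂μ, ‖f n x - g x‖ ≤ C)
    (h : ∀ᵐ x ∂μ, Tendsto (fun n => f n x) atTop (𝓝 (g x))) :
    Tendsto (fun n => eLpNorm (fun x => f n x - g x) q μ) atTop (𝓝 0) := by
  have hq0 : q ≠ 0 := (zero_lt_one.trans_le hq).ne'
  have hqr : 0 < q.toReal := ENNReal.toReal_pos hq0 hq'
  simp_rw [eLpNorm_eq_lintegral_rpow_enorm_toReal hq0 hq']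
  have h0 : Tendsto (fun n => ∫⁻ x, ‖f n x - g x‖ₑ ^ q.toReal ∂μ) atTop (𝓝 (∫⁻ _, 0 ∂μ)) := by
    refine tendsto_lintegral_of_dominated_convergence' (fun _ => ENNReal.ofReal C ^ q.toReal)
      (fun n => ((hf n).sub hg).enorm.pow_const _) (fun n => ?_) ?_ ?_
    · filter_upwards [hC n] with x hx
      gcongr
      rw [← ofReal_norm]
      exact ENNReal.ofReal_le_ofReal hx
    · rw [lintegral_const]
      exact ENNReal.mul_ne_top (ENNReal.rpow_ne_top_of_nonneg hqr.le ENNReal.ofReal_ne_top)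
        (measure_ne_top _ _)
    · filter_upwards [h] with x hx
      have h1 : Tendsto (fun n => ‖f n x - g x‖ₑ) atTop (𝓝 0) := by
        have := (hx.sub_const (g x)).enorm
        simpa using this
      have h2 := (ENNReal.continuous_rpow_const (y := q.toReal)).tendsto 0 |>.comp h1
      simpa [ENNReal.zero_rpow_of_pos hqr, Function.comp_def] using h2
  have h2 := (ENNReal.continuous_rpow_const (y := 1 / q.toReal)).tendsto _ |>.comp h0
  have h3 : (∫⁻ _ : α, 0 ∂μ) ^ (1 / q.toReal) = 0 := by
    rw [lintegral_zero, ENNReal.zero_rpow_of_pos (by positivity)]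
  rw [h3] at h2
  exact h2

section Cutoff

variable {d N : ℕ} {Ω : Set (Euc d)}

/-- The cutoff function that vanishes where the distance to the complement of `Ω` is at most `ε`
and is `1` where it is at least `2 ε`. -/
noncomputable def cutoff (Ω : Set (Euc d)) (ε : ℝ) (x : Euc d) : ℝ :=
  max 0 (min 1 (Metric.infDist x Ωᶜ / ε - 1))

theorem cutoff_nonneg (ε : ℝ) (x : Euc d) : 0 ≤ cutoff Ω ε x := le_max_left _ _

theorem cutoff_le_one (ε : ℝ) (x : Euc d) : cutoff Ω ε x ≤ 1 :=
  max_le zero_le_one (min_le_left _ _)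

theorem cutoff_eq_one {ε : ℝ} (hε : 0 < ε) {x : Euc d} (hx : 2 * ε ≤ Metric.infDist x Ωᶜ) :
    cutoff Ω ε x = 1 := by
  have : 1 ≤ Metric.infDist x Ωᶜ / ε - 1 := by
    rw [le_sub_iff_add_le, le_div_iff₀ hε]; linarith
  simp [cutoff, this]

theorem cutoff_eq_zero {ε : ℝ} (hε : 0 < ε) {x : Euc d} (hx : Metric.infDist x Ωᶜ ≤ ε) :
    cutoff Ω ε x = 0 := by
  have : Metric.infDist x Ωᶜ / ε - 1 ≤ 0 := by
    rw [sub_nonpos, div_le_one hε]; linarith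
  exact max_eq_left ((min_le_right _ _).trans this)

theorem abs_cutoff_sub_le {ε : ℝ} (hε : 0 < ε) (x y : Euc d) :
    |cutoff Ω ε x - cutoff Ω ε y| ≤ dist x y / ε := by
  unfold cutoff
  refine (abs_max_sub_max_le_max _ _ _ _).trans ?_
  rw [sub_self, abs_zero]
  refine max_le (by positivity) ((abs_min_sub_min_le_max _ _ _ _).trans ?_)
  rw [sub_self, abs_zero]
  refine max_le (by positivity) ?_
  rw [sub_sub_sub_cancel_right, ← sub_div, abs_div, abs_of_pos hε]
  gcongr
  simpa [Real.dist_eq] using (Metric.lipschitz_infDist_pt Ωᶜ).dist_le_mul x y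

theorem norm_le_mul_infDist {w : Euc d → Euc N} {M : ℝ≥0} (hw : LipschitzWith M w)
    {A : Set (Euc d)} (hA : A.Nonempty) (hwA : ∀ x ∈ A, w x = 0) (x : Euc d) :
    ‖w x‖ ≤ M * Metric.infDist x A := by
  rcases eq_or_lt_of_le M.coe_nonneg with hM | hM
  · obtain ⟨y, hy⟩ := hA
    have := hw.dist_le_mul x y
    rw [hwA y hy, dist_zero_right, ← hM, zero_mul] at this
    rwa [← hM, zero_mul]
  · rw [← div_le_iff₀' hM]
    refine (Metric.le_infDist hA).2 fun y hy => ?_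
    rw [div_le_iff₀' hM]
    have := hw.dist_le_mul x y
    rwa [hwA y hy, dist_zero_right] at this

/-- Cutting off a Lipschitz function that vanishes outside of `Ω` increases the Lipschitz constant
at most by a factor of three. -/
theorem lipschitzWith_cutoff_smul {w : Euc d → Euc N} {M : ℝ≥0} (hw : LipschitzWith M w)
    (hne : Ωᶜ.Nonempty) (hwΩ : ∀ x ∈ Ωᶜ, w x = 0) {ε : ℝ} (hε : 0 < ε) :
    LipschitzWith (3 * M) fun x => cutoff Ω ε x • w x := by
  -- Within `2 ε` of `Ωᶜ` the bound `‖w x‖ ≤ 2 ε M` compensates the slope `1 / ε` of the cutoff,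
  -- giving `2 M + M`.
  have key : ∀ x y, Metric.infDist x Ωᶜ ≤ 2 * ε →
      dist (cutoff Ω ε x • w x) (cutoff Ω ε y • w y) ≤ 3 * M * dist x y := by
    intro x y hx
    rw [dist_eq_norm, show cutoff Ω ε x • w x - cutoff Ω ε y • w y
      = (cutoff Ω ε x - cutoff Ω ε y) • w x + cutoff Ω ε y • (w x - w y) by module]
    have h1 : ‖(cutoff Ω ε x - cutoff Ω ε y) • w x‖ ≤ dist x y / ε * (M * (2 * ε)) := by
      rw [norm_smul]
      gcongr
      · exact abs_cutoff_sub_le hε x y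
      · exact (norm_le_mul_infDist hw hne hwΩ x).trans (by gcongr)
    have h2 : ‖cutoff Ω ε y • (w x - w y)‖ ≤ 1 * (M * dist x y) := by
      rw [norm_smul]
      gcongr
      · rw [Real.norm_of_nonneg (cutoff_nonneg _ _)]; exact cutoff_le_one _ _
      · rw [← dist_eq_norm]; exact hw.dist_le_mul x y
    calc _ ≤ dist x y / ε * (M * (2 * ε)) + 1 * (M * dist x y) :=
          (norm_add_le _ _).trans (add_le_add h1 h2)
      _ = _ := by field_simp; ring
  refine LipschitzWith.of_dist_le_mul fun x y => ?_
  push_cast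
  by_cases hx : Metric.infDist x Ωᶜ ≤ 2 * ε
  · exact key x y hx
  · by_cases hy : Metric.infDist y Ωᶜ ≤ 2 * ε
    · rw [dist_comm, dist_comm x]; exact key y x hy
    · rw [cutoff_eq_one hε (not_le.1 hx).le, cutoff_eq_one hε (not_le.1 hy).le, one_smul, one_smul]
      refine (hw.dist_le_mul x y).trans ?_
      gcongr
      linarith [M.coe_nonneg]

open scoped Convolution

/-- The derivative of a mollified Lipschitz function is the mollified derivative. -/
theorem hasFDerivAt_normed_convolution (ρ : ContDiffBump (0 : Euc d)) {w : Euc d → Euc N} {M : ℝ≥0}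
    (hw : LipschitzWith M w) (x : Euc d) :
    HasFDerivAt (ρ.normed volume ⋆[ContinuousLinearMap.lsmul ℝ ℝ, volume] w : Euc d → Euc N)
      ((ρ.normed volume ⋆[ContinuousLinearMap.lsmul ℝ ℝ, volume] fderiv ℝ w :
        Euc d → Euc d →L[ℝ] Euc N) x) x := by
  have hc : Continuous (ρ.normed volume) := ρ.continuous_normed
  have hρ : HasCompactSupport (ρ.normed volume) := ρ.hasCompactSupport_normed
  refine (hasFDerivAt_integral_of_dominated_loc_of_lip (𝕜 := ℝ) (μ := volume) (s := univ)
    (F := fun y t => ρ.normed volume t • w (y - t))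
    (F' := fun t => ρ.normed volume t • fderiv ℝ w (x - t))
    (bound := fun t => ρ.normed volume t * M) univ_mem ?_ ?_ ?_ ?_ ?_ ?_).2
  · refine Eventually.of_forall fun y => Continuous.aestronglyMeasurable ?_
    have := hw.continuous
    fun_prop
  · refine Continuous.integrable_of_hasCompactSupport ?_ hρ.smul_right
    have := hw.continuous
    fun_prop
  · refine hc.aestronglyMeasurable.smul ?_
    exact ((measurable_fderiv ℝ w).comp (by fun_prop)).aestronglyMeasurable
  · refine Eventually.of_forall fun t => LipschitzOnWith.of_dist_le_mul fun y _ z _ => ?_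
    have h0 := ρ.nonneg_normed (μ := volume) t
    rw [dist_eq_norm, ← smul_sub, norm_smul, Real.norm_of_nonneg h0, Real.coe_nnabs,
      abs_of_nonneg (by positivity), mul_assoc]
    gcongr
    rw [← dist_eq_norm]
    simpa using hw.dist_le_mul (y - t) (z - t)
  · exact ρ.integrable_normed.mul_const _
  · have := hw.ae_differentiableAt (μ := volume)
    have h2 := (quasiMeasurePreserving_sub_left volume x).ae this
    filter_upwards [h2] with t ht
    have h3 : HasFDerivAt (fun y => w (y - t)) (fderiv ℝ w (x - t)) x := by
      simpa [Function.comp_def] using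
        HasFDerivAt.comp x ht.hasFDerivAt ((hasFDerivAt_id x).sub_const t)
    exact h3.const_smul (ρ.normed volume t)

theorem norm_fderiv_normed_convolution_le (ρ : ContDiffBump (0 : Euc d)) {w : Euc d → Euc N}
    {M : ℝ≥0} (hw : LipschitzWith M w) (x : Euc d) :
    ‖fderiv ℝ (ρ.normed volume ⋆[ContinuousLinearMap.lsmul ℝ ℝ, volume] w : Euc d → Euc N) x‖
      ≤ M := by
  rw [(hasFDerivAt_normed_convolution ρ hw x).fderiv, convolution_def]
  calc _ ≤ ∫ t, ρ.normed volume t * M := by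
        refine norm_integral_le_of_norm_le (ρ.integrable_normed.mul_const _)
          (Eventually.of_forall fun t => ?_)
        rw [ContinuousLinearMap.lsmul_apply, norm_smul, Real.norm_of_nonneg (ρ.nonneg_normed t)]
        gcongr
        · exact ρ.nonneg_normed t
        · exact norm_fderiv_le_of_lipschitz ℝ hw
    _ = M := by rw [integral_mul_const, ρ.integral_normed, one_mul]

theorem dist_normed_convolution_le_of_lipschitzWith (ρ : ContDiffBump (0 : Euc d))
    {w : Euc d → Euc N} {M : ℝ≥0} (hw : LipschitzWith M w) (x : Euc d) :
    dist ((ρ.normed volume ⋆[ContinuousLinearMap.lsmul ℝ ℝ, volume] w : Euc d → Euc N) x) (w x)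
      ≤ M * ρ.rOut := by
  refine ρ.dist_normed_convolution_le hw.continuous.aestronglyMeasurable fun y hy => ?_
  refine (hw.dist_le_mul y x).trans ?_
  gcongr
  exact (Metric.mem_ball.1 hy).le

/-- A bump function supported in the ball of radius `ε / 2`. -/
noncomputable def halfBump {d : ℕ} {ε : ℝ} (hε : 0 < ε) : ContDiffBump (0 : Euc d) where
  rIn := ε / 4
  rOut := ε / 2
  rIn_pos := by positivity
  rIn_lt_rOut := by linarith

/-- The cutoff vanishes within `ε` of `Ωᶜ` and the kernel has radius `ε / 2`, so the support keeps
the distance `ε / 2` from `Ωᶜ`. -/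
theorem isTestFunction_normed_convolution_cutoff (hb : Bornology.IsBounded Ω)
    {w : Euc d → Euc N} (hw : Continuous w) {ε : ℝ} (hε : 0 < ε) :
    IsTestFunction Ω ((halfBump hε).normed volume ⋆[ContinuousLinearMap.lsmul ℝ ℝ, volume]
      fun x => cutoff Ω ε x • w x : Euc d → Euc N) := by
  have hcut : Continuous (cutoff Ω ε) := by
    unfold cutoff
    have := Metric.continuous_infDist_pt Ωᶜ
    fun_prop
  have hsub : tsupport ((halfBump hε).normed volume ⋆[ContinuousLinearMap.lsmul ℝ ℝ, volume]
      fun x => cutoff Ω ε x • w x : Euc d → Euc N) ⊆ {x | ε / 2 ≤ Metric.infDist x Ωᶜ} := by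
    refine closure_minimal ?_ (isClosed_le continuous_const (Metric.continuous_infDist_pt _))
    intro x hx
    obtain ⟨y, hy, z, hz, rfl⟩ := support_convolution_subset _ hx
    rw [ContDiffBump.support_normed_eq, mem_ball_zero_iff] at hy
    change ‖y‖ < ε / 2 at hy
    have hz' : ε < Metric.infDist z Ωᶜ := by
      by_contra hc
      exact hz (by simp [cutoff_eq_zero hε (not_lt.1 hc)])
    have h1 := Metric.infDist_le_infDist_add_dist (s := Ωᶜ) (x := z) (y := y + z)
    rw [dist_comm, dist_eq_norm, add_sub_cancel_right] at h1
    change ε / 2 ≤ Metric.infDist (y + z) Ωᶜ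
    linarith
  have hsubΩ : {x | ε / 2 ≤ Metric.infDist x Ωᶜ} ⊆ Ω := by
    intro x hx
    by_contra hc
    change ε / 2 ≤ Metric.infDist x Ωᶜ at hx
    rw [Metric.infDist_zero_of_mem (mem_compl hc)] at hx
    linarith
  refine ⟨?_, ?_, hsub.trans hsubΩ⟩
  · exact (halfBump hε).hasCompactSupport_normed.contDiff_convolution_left _
      (halfBump hε).contDiff_normed (hcut.smul hw).locallyIntegrable
  · exact Metric.isCompact_of_isClosed_isBounded (isClosed_tsupport _)
      (hb.subset (hsub.trans hsubΩ))

/-- A Lipschitz function that vanishes outside of a bounded open set `Ω` belongs to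
`W^{1,p}_0(Ω)`. -/
theorem LipschitzWith.isTestLimit (hΩ : IsOpen Ω) (hb : Bornology.IsBounded Ω)
    (hne : Ωᶜ.Nonempty) {q : ℝ≥0∞} (hq : 1 ≤ q) (hq' : q ≠ ⊤) {w : Euc d → Euc N} {M : ℝ≥0}
    (hw : LipschitzWith M w) (hwΩ : ∀ x ∈ Ωᶜ, w x = 0) :
    IsTestLimit Ω q w (classicalGradient w) := by
  have : IsFiniteMeasure (volume.restrict Ω) := isFiniteMeasure_restrict.2 hb.measure_lt_top.ne
  have grad_le : ∀ (f : Euc d → Euc N) (C : ℝ≥0), (∀ x, ‖fderiv ℝ f x‖ ≤ C) →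
      ∀ x, ‖classicalGradient f x‖ ≤ √d * C := fun f C h x =>
    (norm_gradientMap_le _).trans (by gcongr; exact h x)
  set ε : ℕ → ℝ := fun n => 1 / ((n : ℝ) + 1) with hεdef
  have hε : ∀ n, 0 < ε n := fun n => by positivity
  have hε0 : Tendsto ε atTop (𝓝 0) := tendsto_one_div_add_atTop_nhds_zero_nat
  -- The cut-off functions and their mollifications are Lipschitz with the constant `3 M`, uniformly
  -- in `n`. Dominated convergence therefore reduces the convergence of gradients to pointwise
  -- convergence almost everywhere.
  set v : ℕ → Euc d → Euc N := fun n x => cutoff Ω (ε n) x • w x with hv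
  have hvL : ∀ n, LipschitzWith (3 * M) (v n) := fun n =>
    lipschitzWith_cutoff_smul hw hne hwΩ (hε n)
  set φ : ℕ → Euc d → Euc N := fun n =>
    (halfBump (hε n)).normed volume ⋆[ContinuousLinearMap.lsmul ℝ ℝ, volume] v n with hφ
  have hφT : ∀ n, IsTestFunction Ω (φ n) := fun n =>
    isTestFunction_normed_convolution_cutoff hb hw.continuous (hε n)
  have hgw : ∀ x, ‖classicalGradient w x‖ ≤ √d * M :=
    grad_le w M fun x => norm_fderiv_le_of_lipschitz ℝ hw
  have hgφ : ∀ n x, ‖classicalGradient (φ n) x‖ ≤ √d * (3 * M : ℝ≥0) := fun n =>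
    grad_le _ _ fun x => norm_fderiv_normed_convolution_le _ (hvL n) x
  have hdist : ∀ n x, ‖φ n x - w x‖ ≤ 5 * M * ε n := by
    intro n x
    have h1 := dist_normed_convolution_le_of_lipschitzWith (halfBump (hε n)) (hvL n) x
    have h2 : dist (v n x) (w x) ≤ 2 * M * ε n := by
      by_cases hx : 2 * ε n ≤ Metric.infDist x Ωᶜ
      · have := hε n
        simp only [hv, cutoff_eq_one (hε n) hx, one_smul, dist_self]
        positivity
      · have h3 := norm_le_mul_infDist hw hne hwΩ x
        have h4 : dist (v n x) (w x) = (1 - cutoff Ω (ε n) x) * ‖w x‖ := by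
          rw [dist_eq_norm, show v n x - w x = (cutoff Ω (ε n) x - 1) • w x by
            simp only [hv]; module, norm_smul, Real.norm_of_nonpos
            (by linarith [cutoff_le_one (Ω := Ω) (ε n) x])]
          ring
        rw [h4]
        calc (1 - cutoff Ω (ε n) x) * ‖w x‖ ≤ 1 * (M * (2 * ε n)) := by
              gcongr
              · linarith [cutoff_nonneg (Ω := Ω) (ε n) x]
              · exact h3.trans (by gcongr; exact (not_le.1 hx).le)
          _ = _ := by ring
    rw [← dist_eq_norm]
    refine (dist_triangle _ _ _).trans ((add_le_add h1 h2).trans ?_)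
    change ((3 * M : ℝ≥0) : ℝ) * (ε n / 2) + _ ≤ _
    push_cast
    have : 0 ≤ M * ε n := by have := hε n; positivity
    nlinarith
  have hεle : ∀ n, ε n ≤ 1 := fun n => by
    simp only [hεdef]
    rw [div_le_one (by positivity)]
    have : (0 : ℝ) ≤ n := n.cast_nonneg
    linarith
  have hwm : MemLp w q (volume.restrict Ω) := by
    refine hw.continuous.memLp_of_hasCompactSupport (HasCompactSupport.of_support_subset_isCompact
      hb.isCompact_closure fun x hx => subset_closure ?_)
    by_contra hc
    exact hx (hwΩ x hc)
  have hgm : MemLp (classicalGradient w) q (volume.restrict Ω) :=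
    MemLp.of_bound (measurable_classicalGradient w).aestronglyMeasurable _
      (Eventually.of_forall hgw)
  refine ⟨hwm, hgm, φ, hφT, ?_, ?_⟩
  · refine tendsto_eLpNorm_sub_of_bounded hq hq' (fun n => ((hφT n).memLp q _).1) hwm.1
      (C := 5 * M * 1) (fun n => Eventually.of_forall fun x => (hdist n x).trans (by
        gcongr; exact hεle n)) (Eventually.of_forall fun x => ?_)
    rw [tendsto_iff_norm_sub_tendsto_zero]
    refine squeeze_zero (fun _ => norm_nonneg _) (fun n => hdist n x) ?_
    simpa using hε0.const_mul (5 * (M : ℝ))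
  · refine tendsto_eLpNorm_sub_of_bounded hq hq'
      (fun n => ((hφT n).memLp_classicalGradient q _).1) hgm.1
      (C := √d * (3 * M : ℝ≥0) + √d * M) (fun n => Eventually.of_forall fun x =>
        (_root_.norm_sub_le _ _).trans (add_le_add (hgφ n x) (hgw x))) ?_
    have hloc : LocallyIntegrable (fderiv ℝ w) volume :=
      (memLp_top_of_bound (measurable_fderiv ℝ w).aestronglyMeasurable M (Eventually.of_forall
        fun x => norm_fderiv_le_of_lipschitz ℝ hw)).locallyIntegrable le_top
    have hlim := ContDiffBump.ae_convolution_tendsto_right_of_locallyIntegrable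
      (φ := fun n => (halfBump (hε n) : ContDiffBump (0 : Euc d))) (l := atTop) (K := 2)
      (by simpa [halfBump] using hε0.div_const 2)
      (Eventually.of_forall fun n => by simp only [halfBump]; linarith) hloc
    rw [ae_restrict_iff' hΩ.measurableSet]
    filter_upwards [hlim] with x hx hxΩ
    have hδ : 0 < Metric.infDist x Ωᶜ :=
      (hΩ.isClosed_compl.notMem_iff_infDist_pos hne).1 (by simpa using hxΩ)
    have hx' := ((gradientMap d N).continuous.tendsto _).comp hx
    refine hx'.congr' ?_
    filter_upwards [hε0.eventually_le_const (show 0 < Metric.infDist x Ωᶜ / 4 by positivity)]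
      with n hn
    -- For small `ε n` the cutoff equals `1` on the ball seen by the kernel, so the derivative at
    -- `x` is the mollified derivative of `w` itself, to which Lebesgue differentiation applies.
    have heq : fderiv ℝ (φ n) x = ((halfBump (hε n)).normed volume
        ⋆[ContinuousLinearMap.lsmul ℝ ℝ, volume] fderiv ℝ w : Euc d → Euc d →L[ℝ] Euc N) x := by
      rw [(hasFDerivAt_normed_convolution (halfBump (hε n)) (hvL n) x).fderiv]
      simp only [convolution_def, ContinuousLinearMap.lsmul_apply]
      refine integral_congr_ae (Eventually.of_forall fun t => ?_)
      by_cases ht : t ∈ Function.support ((halfBump (hε n) : ContDiffBump (0 : Euc d)).normed volume)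
      · rw [ContDiffBump.support_normed_eq, mem_ball_zero_iff] at ht
        change ‖t‖ < ε n / 2 at ht
        simp only
        congr 1
        refine Filter.EventuallyEq.fderiv_eq ?_
        have : ∀ᶠ y in 𝓝 (x - t), 2 * ε n < Metric.infDist y Ωᶜ := by
          refine (Metric.continuous_infDist_pt Ωᶜ).continuousAt.eventually_const_lt ?_
          have h1 := Metric.infDist_le_infDist_add_dist (s := Ωᶜ) (x := x) (y := x - t)
          rw [dist_self_sub_right] at h1
          linarith [hε n]
        filter_upwards [this] with y hy
        simp only [hv, cutoff_eq_one (hε n) hy.le, one_smul]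
      · rw [Function.notMem_support] at ht
        simp only [ht]
        exact (zero_smul ℝ (fderiv ℝ (v n) (x - t))).trans (zero_smul ℝ (fderiv ℝ w (x - t))).symm
    simp only [Function.comp_apply, classicalGradient_eq, heq]

end Cutoff

/-! ### The Poincaré inequality on convex sets -/

theorem ENNReal.lintegral_rpow_le_of_isProbabilityMeasure {α : Type*} [MeasurableSpace α]
    {μ : Measure α} [IsProbabilityMeasure μ] {p : ℝ} (hp : 1 ≤ p) {f : α → ℝ≥0∞}
    (hf : AEMeasurable f μ) : (∫⁻ x, f x ∂μ) ^ p ≤ ∫⁻ x, f x ^ p ∂μ := by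
  rcases hp.eq_or_lt with rfl | hp1
  · simp
  have hpq := Real.HolderConjugate.conjExponent hp1
  have h := ENNReal.lintegral_mul_le_Lp_mul_Lq μ hpq hf (g := fun _ => 1) aemeasurable_const
  simp only [Pi.mul_apply, mul_one, ENNReal.one_rpow, lintegral_one, measure_univ] at h
  calc (∫⁻ x, f x ∂μ) ^ p ≤ ((∫⁻ x, f x ^ p ∂μ) ^ (1 / p)) ^ p := by gcongr
    _ = ∫⁻ x, f x ^ p ∂μ := by
      rw [← ENNReal.rpow_mul, one_div_mul_cancel (by linarith), ENNReal.rpow_one]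

theorem lintegral_comp_smul_add {d : ℕ} {g : Euc d → ℝ≥0∞} (hg : Measurable g) {r : ℝ}
    (hr : r ≠ 0) (a : Euc d) :
    ∫⁻ x, g (r • x + a) = ENNReal.ofReal |(r ^ d)⁻¹| * ∫⁻ x, g x := by
  have h1 := lintegral_map (μ := (volume : Measure (Euc d))) (f := fun y => g (y + a))
    (g := fun x => r • x) (by fun_prop) (by fun_prop)
  rw [← h1, Measure.map_addHaar_smul _ hr, lintegral_smul_measure, lintegral_add_right_eq_self]
  simp

theorem lintegral_comp_smul_add_le {d : ℕ} {g : Euc d → ℝ≥0∞} (hg : Measurable g) {r : ℝ}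
    (hr : 1 / 2 ≤ r) (a : Euc d) :
    ∫⁻ x, g (r • x + a) ≤ 2 ^ d * ∫⁻ x, g x := by
  rw [lintegral_comp_smul_add hg (by linarith)]
  gcongr
  rw [show (2 : ℝ≥0∞) ^ d = ENNReal.ofReal (2 ^ d) by simp [ENNReal.ofReal_pow]]
  apply ENNReal.ofReal_le_ofReal
  rw [abs_of_nonneg (by positivity), ← inv_pow]
  gcongr
  rw [inv_le_comm₀ (by linarith) two_pos]
  linarith

theorem enorm_sub_le_lintegral_fderiv {E F : Type*} [NormedAddCommGroup E] [NormedSpace ℝ E]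
    [NormedAddCommGroup F] [NormedSpace ℝ F] {f : E → F} (hf : ContDiff ℝ 1 f)
    (x y : E) :
    ‖f y - f x‖ₑ ≤ ∫⁻ t in Icc (0 : ℝ) 1, ‖fderiv ℝ f (x + t • (y - x))‖ₑ * ‖y - x‖ₑ := by
  have h := enorm_sub_le_lintegral_deriv_of_contDiffOn_Icc (a := 0) (b := 1)
    (f := fun t : ℝ => f (x + t • (y - x))) (by fun_prop) zero_le_one
  simp only [one_smul, add_sub_cancel, zero_smul, add_zero] at h
  refine h.trans (lintegral_mono fun t => ?_)
  have h1 : HasDerivAt (fun t : ℝ => x + t • (y - x)) (y - x) t := by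
    simpa using ((hasDerivAt_id t).smul_const (y - x)).const_add x
  have h2 := ((hf.differentiable one_ne_zero (x + t • (y - x))).hasFDerivAt.comp_hasDerivAt t h1)
  rw [show deriv (fun t : ℝ => f (x + t • (y - x))) t = _ from h2.deriv]
  exact ContinuousLinearMap.le_opENorm _ _

/-- The Poincaré inequality on a convex set `D` for the mean value over a subset `B`. -/
theorem lintegral_enorm_sub_average_rpow_le {d N : ℕ} {p : ℝ} (hp : 1 ≤ p)
    {f : Euc d → Euc N} (hf : ContDiff ℝ 1 f) {D B : Set (Euc d)} (hD : Convex ℝ D)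
    (hDm : MeasurableSet D) (hBm : MeasurableSet B) (hBD : B ⊆ D)
    (hB0 : volume B ≠ 0) (hB : volume B ≠ ⊤) (hfB : IntegrableOn f B) {ρ : ℝ}
    (hρ : ∀ x ∈ D, ∀ y ∈ D, dist x y ≤ ρ) :
    ∫⁻ x in D, ‖f x - ⨍ y in B, f y‖ₑ ^ p ≤ ENNReal.ofReal ρ ^ p *
      (2 ^ d * (1 + volume D / volume B)) * ∫⁻ x in D, ‖fderiv ℝ f x‖ₑ ^ p := by
  have hp0 : 0 ≤ p := by linarith
  set ν : Measure (Euc d) := (volume B)⁻¹ • volume.restrict B with hν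
  have : IsProbabilityMeasure ν := ⟨by simpa [hν] using ENNReal.inv_mul_cancel hB0 hB⟩
  have : IsProbabilityMeasure (volume.restrict (Icc (0 : ℝ) 1)) := ⟨by simp⟩
  have hνB : ∀ᵐ y ∂ν, y ∈ B :=
    Measure.ae_smul_measure (ae_restrict_mem hBm) _
  -- Extension by zero loses nothing, because segments between points of the convex set `D` stay in
  -- `D`, and it lets the integrals after a substitution be bounded by one over the whole space.
  set g : Euc d → ℝ≥0∞ := D.indicator fun x => ‖fderiv ℝ f x‖ₑ ^ p with hg
  have hfd : Continuous (fderiv ℝ f) := hf.continuous_fderiv one_ne_zero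
  have hgm : Measurable g :=
    (hfd.enorm.measurable.pow_const p).indicator hDm
  have hgint : ∫⁻ x, g x = ∫⁻ x in D, ‖fderiv ℝ f x‖ₑ ^ p := lintegral_indicator hDm _
  have hgm3 : Measurable fun q : Euc d × Euc d × ℝ => g (q.1 + q.2.2 • (q.2.1 - q.1)) :=
    hgm.comp (by fun_prop)
  have pointwise : ∀ x ∈ D, ‖f x - ⨍ y in B, f y‖ₑ ^ p ≤
      ENNReal.ofReal ρ ^ p * ∫⁻ y, (∫⁻ t in Icc (0 : ℝ) 1, g (x + t • (y - x))) ∂ν := by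
    intro x hx
    have hfν : Integrable f ν := hfB.smul_measure (by simpa using hB0)
    have e : f x - ⨍ y in B, f y = ∫ y, (f x - f y) ∂ν := by
      rw [setAverage_eq', integral_sub (integrable_const _) hfν]
      simp [hν]
    calc ‖f x - ⨍ y in B, f y‖ₑ ^ p ≤ (∫⁻ y, ‖f x - f y‖ₑ ∂ν) ^ p := by
          rw [e]; gcongr; exact enorm_integral_le_lintegral_enorm _
      _ ≤ ∫⁻ y, ‖f x - f y‖ₑ ^ p ∂ν :=
          ENNReal.lintegral_rpow_le_of_isProbabilityMeasure hp
            (by have := hf.continuous; fun_prop)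
      _ ≤ ∫⁻ y, (ENNReal.ofReal ρ ^ p * ∫⁻ t in Icc (0 : ℝ) 1, g (x + t • (y - x))) ∂ν := by
          refine lintegral_mono_ae (hνB.mono fun y hy => ?_)
          calc ‖f x - f y‖ₑ ^ p = ‖f y - f x‖ₑ ^ p := by
                rw [← neg_sub, enorm_neg]
            _ ≤ (∫⁻ t in Icc (0 : ℝ) 1, ‖fderiv ℝ f (x + t • (y - x))‖ₑ * ‖y - x‖ₑ) ^ p := by
                gcongr; exact enorm_sub_le_lintegral_fderiv hf x y
            _ ≤ ∫⁻ t in Icc (0 : ℝ) 1, (‖fderiv ℝ f (x + t • (y - x))‖ₑ * ‖y - x‖ₑ) ^ p := by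
                refine ENNReal.lintegral_rpow_le_of_isProbabilityMeasure hp ?_
                exact ((hfd.comp (g := fderiv ℝ f) (f := fun t : ℝ => x + t • (y - x))
                  (by fun_prop)).enorm.measurable.mul_const _).aemeasurable
            _ ≤ ∫⁻ t in Icc (0 : ℝ) 1, ENNReal.ofReal ρ ^ p * g (x + t • (y - x)) := by
                refine setLIntegral_mono' measurableSet_Icc fun t ht => ?_
                rw [ENNReal.mul_rpow_of_nonneg _ _ hp0, mul_comm]
                have hm : x + t • (y - x) ∈ D := hD.add_smul_sub_mem hx (hBD hy) ht
                rw [hg, indicator_of_mem hm]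
                gcongr
                rw [← edist_eq_enorm_sub, edist_dist]
                exact ENNReal.ofReal_le_ofReal (hρ y (hBD hy) x hx)
            _ = _ := lintegral_const_mul _ (hgm.comp (by fun_prop))
      _ = _ := by
          refine lintegral_const_mul _ ?_
          exact Measurable.lintegral_prod_right'
            (f := fun q : Euc d × ℝ => g (x + q.2 • (q.1 - x))) (hgm.comp (by fun_prop))
  -- Substitution in `x` costs `(1 - t)^(-d)` and in `y` costs `t^(-d)`. Using the former for `t ≤
  -- 1/2` and the latter for `t ≥ 1/2` keeps the Jacobian factor below `2 ^ d`; in the second case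
  -- the idle integration over `D` produces `|D| / |B|`.
  have slice : ∀ t ∈ Icc (0 : ℝ) 1, ∫⁻ x in D, ∫⁻ y, g (x + t • (y - x)) ∂ν ≤
      2 ^ d * (1 + volume D / volume B) * ∫⁻ x, g x := by
    intro t ht
    have swap : ∫⁻ x in D, ∫⁻ y, g (x + t • (y - x)) ∂ν
        = ∫⁻ y, (∫⁻ x in D, g (x + t • (y - x))) ∂ν :=
      lintegral_lintegral_swap (f := fun x y => g (x + t • (y - x))) (Measurable.aemeasurable
        (hgm.comp (by fun_prop : Measurable fun q : Euc d × Euc d => q.1 + t • (q.2 - q.1))))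
    rcases le_total t (1 / 2) with h | h
    · rw [swap]
      calc ∫⁻ y, (∫⁻ x in D, g (x + t • (y - x))) ∂ν ≤ ∫⁻ _y, (2 ^ d * ∫⁻ x, g x) ∂ν := by
            refine lintegral_mono fun y => ?_
            refine (setLIntegral_le_lintegral _ _).trans ?_
            refine le_trans (le_of_eq ?_)
              (lintegral_comp_smul_add_le hgm (r := 1 - t) (by linarith) (t • y))
            congr 1
            ext x
            congr 1
            module
        _ = 2 ^ d * 1 * ∫⁻ x, g x := by simp
        _ ≤ _ := by gcongr; exact le_self_add
    · calc ∫⁻ x in D, ∫⁻ y, g (x + t • (y - x)) ∂ν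
            ≤ ∫⁻ _x in D, (volume B)⁻¹ * (2 ^ d * ∫⁻ x, g x) := by
            refine lintegral_mono fun x => ?_
            rw [hν, lintegral_smul_measure, smul_eq_mul]
            gcongr
            refine (setLIntegral_le_lintegral _ _).trans ?_
            refine le_trans (le_of_eq ?_)
              (lintegral_comp_smul_add_le hgm (r := t) (by linarith) ((1 - t) • x))
            congr 1
            ext y
            congr 1
            module
        _ = 2 ^ d * (volume D / volume B) * ∫⁻ x, g x := by
            rw [setLIntegral_const, div_eq_mul_inv]; ring
        _ ≤ _ := by gcongr; exact le_add_self
  calc ∫⁻ x in D, ‖f x - ⨍ y in B, f y‖ₑ ^ p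
      ≤ ∫⁻ x in D, ENNReal.ofReal ρ ^ p *
          ∫⁻ y, (∫⁻ t in Icc (0 : ℝ) 1, g (x + t • (y - x))) ∂ν :=
        setLIntegral_mono' hDm pointwise
    _ = ENNReal.ofReal ρ ^ p *
          ∫⁻ x in D, ∫⁻ y, (∫⁻ t in Icc (0 : ℝ) 1, g (x + t • (y - x))) ∂ν := by
        refine lintegral_const_mul _ ?_
        refine Measurable.lintegral_prod_right' (ν := ν)
          (f := fun q : Euc d × Euc d => ∫⁻ t in Icc (0 : ℝ) 1, g (q.1 + t • (q.2 - q.1))) ?_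
        exact Measurable.lintegral_prod_right'
          (f := fun q : (Euc d × Euc d) × ℝ => g (q.1.1 + q.2 • (q.1.2 - q.1.1)))
          (hgm.comp (by fun_prop))
    _ = ENNReal.ofReal ρ ^ p *
          ∫⁻ t in Icc (0 : ℝ) 1, ∫⁻ x in D, ∫⁻ y, g (x + t • (y - x)) ∂ν := by
        congr 1
        have h1 : ∀ x, ∫⁻ y, (∫⁻ t in Icc (0 : ℝ) 1, g (x + t • (y - x))) ∂ν
            = ∫⁻ t in Icc (0 : ℝ) 1, ∫⁻ y, g (x + t • (y - x)) ∂ν := fun x =>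
          lintegral_lintegral_swap (Measurable.aemeasurable
            (hgm.comp (f := fun q : Euc d × ℝ => x + q.2 • (q.1 - x)) (by fun_prop)))
        simp_rw [h1]
        exact lintegral_lintegral_swap (f := fun x t => ∫⁻ y, g (x + t • (y - x)) ∂ν)
          (Measurable.lintegral_prod_right'
            (f := fun q : (Euc d × ℝ) × Euc d => g (q.1.1 + q.1.2 • (q.2 - q.1.1)))
            (hgm.comp (by fun_prop))).aemeasurable
    _ ≤ ENNReal.ofReal ρ ^ p *
          ∫⁻ _t in Icc (0 : ℝ) 1, 2 ^ d * (1 + volume D / volume B) * ∫⁻ x, g x := by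
        gcongr _ * ?_
        exact setLIntegral_mono' measurableSet_Icc slice
    _ = _ := by
        rw [setLIntegral_const, hgint]
        simp [mul_assoc]

/-! ### The exterior corkscrew condition -/

/-- Balls of radius at most `r₀` centered in `s \ Ω` contain a ball of `κ` times the radius
outside of `Ω`. -/
def HasCorkscrew {d : ℕ} (Ω s : Set (Euc d)) (r₀ κ : ℝ) : Prop :=
  ∀ z ∈ s, z ∉ Ω → ∀ ρ, 0 < ρ → ρ ≤ r₀ →
    ∃ w, Metric.closedBall w (κ * ρ) ⊆ Metric.closedBall z ρ ∩ Ωᶜ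

theorem HasCorkscrew.mono {d : ℕ} {Ω s s' : Set (Euc d)} {r₀ r₀' κ κ' : ℝ}
    (h : HasCorkscrew Ω s r₀ κ) (hs : s' ⊆ s) (hr : r₀' ≤ r₀) (hκ : κ' ≤ κ) :
    HasCorkscrew Ω s' r₀' κ' := fun z hz hzΩ ρ hρ hρr =>
  let ⟨w, hw⟩ := h z (hs hz) hzΩ ρ hρ (hρr.trans hr)
  ⟨w, (Metric.closedBall_subset_closedBall (by gcongr)).trans hw⟩

theorem HasCorkscrew.of_ball_subset {d : ℕ} {Ω : Set (Euc d)} {x : Euc d} {r : ℝ}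
    (h : Metric.ball x r ⊆ Ωᶜ) : HasCorkscrew Ω (Metric.ball x (r / 2)) (r / 4) 1 := by
  intro z hz hzΩ ρ hρ hρr
  refine ⟨z, ?_⟩
  rw [one_mul]
  refine subset_inter subset_rfl (Subset.trans (fun y hy => ?_) h)
  rw [Metric.mem_ball] at *
  rw [Metric.mem_closedBall] at hy
  linarith [dist_triangle y z x]

/-- A step `ρ / 2` in the direction `-e` from a point outside `Ω` goes below the graph by a margin
`ρ / 2`. A further displacement `y` changes the height above the graph by at most `(L + 1) ‖y‖`, so
the radius `ρ / (2 (L + 1))` is safe. -/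
theorem IsLipschitzDomain.hasCorkscrew_near {d : ℕ} {Ω : Set (Euc d)} (hΩ : IsLipschitzDomain Ω)
    {x : Euc d} (hx : x ∈ frontier Ω) :
    ∃ r > 0, ∃ κ > 0, HasCorkscrew Ω (Metric.ball x (r / 2)) (r / 4) κ := by
  obtain ⟨e, he, r, hr, L, γ, hγ, h⟩ := hΩ.2 x hx
  have hL : (0 : ℝ) < L + 1 := by positivity
  refine ⟨r, hr, 1 / (2 * (L + 1)), by positivity, fun z hz hzΩ ρ hρ hρr => ?_⟩
  refine ⟨z - (ρ / 2) • e, fun v hv => ?_⟩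
  set P := (Submodule.span ℝ {e})ᗮ.orthogonalProjectionOnto
  obtain ⟨y, rfl⟩ : ∃ y, v = z - (ρ / 2) • e + y := ⟨v - (z - (ρ / 2) • e), by abel⟩
  rw [mem_closedBall_iff_norm, add_sub_cancel_left] at hv
  have hy : (L + 1) * ‖y‖ ≤ ρ / 2 := by
    calc (L + 1) * ‖y‖ ≤ (L + 1) * (1 / (2 * (L + 1)) * ρ) := by gcongr
      _ = ρ / 2 := by field_simp
  have hy' : ‖y‖ ≤ ρ / 2 := by
    have : 0 ≤ L * ‖y‖ := by positivity
    linarith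
  have hvz : ‖z - (ρ / 2) • e + y - z‖ ≤ ρ := by
    rw [show z - (ρ / 2) • e + y - z = y - (ρ / 2) • e by abel]
    refine (norm_sub_le _ _).trans ?_
    rw [norm_smul, he, Real.norm_of_nonneg (by positivity)]
    linarith
  refine ⟨by rwa [mem_closedBall_iff_norm], fun hvΩ => ?_⟩
  rw [mem_ball_iff_norm] at hz
  have hvx : z - (ρ / 2) • e + y ∈ Metric.ball x r := by
    rw [mem_ball_iff_norm]
    have := norm_sub_le_norm_sub_add_norm_sub (z - (ρ / 2) • e + y) z x
    linarith
  have h1 := (h _ hvx).1 hvΩ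
  have h2 : inner ℝ e z ≤ γ (P z) := by
    by_contra hc
    push Not at hc
    exact hzΩ ((h z (by rw [mem_ball_iff_norm]; linarith)).2 hc)
  have hPe : P e = 0 :=
    Submodule.orthogonalProjectionOnto_orthogonalComplement_singleton_eq_zero e
  have h3 : P (z - (ρ / 2) • e + y) = P z + P y := by simp [map_add, map_sub, hPe]
  have h4 : ‖P y‖ ≤ ‖y‖ := Submodule.norm_orthogonalProjectionOnto_apply_le _ y
  have h5 := hγ.dist_le_mul (P z + P y) (P z)
  rw [Real.dist_eq, dist_eq_norm, add_sub_cancel_left, abs_le] at h5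
  have h6 : inner ℝ e (z - (ρ / 2) • e + y) = inner ℝ e z - ρ / 2 + inner ℝ e y := by
    rw [inner_add_right, inner_sub_right, inner_smul_right, real_inner_self_eq_norm_sq, he]
    ring
  have h7 : inner ℝ e y ≤ ‖y‖ := by
    have := real_inner_le_norm e y
    rwa [he, one_mul] at this
  have h8 : (L : ℝ) * ‖P y‖ ≤ L * ‖y‖ := by gcongr
  change γ (P (z - (ρ / 2) • e + y)) < _ at h1
  rw [h3, h6] at h1
  linarith

/-- The condition passes to subsets and finite unions, so it only needs to be checked near each
point: a boundary point, a point of `Ω` (where it is vacuous) or an exterior point. -/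
theorem IsLipschitzDomain.exists_hasCorkscrew_of_isCompact {d : ℕ} {Ω : Set (Euc d)}
    (hΩ : IsLipschitzDomain Ω) {s : Set (Euc d)} (hs : IsCompact s) :
    ∃ r > 0, ∃ κ > 0, HasCorkscrew Ω s r κ := by
  refine hs.induction_on (p := fun s => ∃ r > 0, ∃ κ > 0, HasCorkscrew Ω s r κ) ?_ ?_ ?_ ?_
  · exact ⟨1, one_pos, 1, one_pos, fun z hz => hz.elim⟩
  · rintro s t hst ⟨r, hr, κ, hκ, h⟩
    exact ⟨r, hr, κ, hκ, h.mono hst le_rfl le_rfl⟩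
  · rintro s t ⟨r, hr, κ, hκ, h⟩ ⟨r', hr', κ', hκ', h'⟩
    refine ⟨min r r', lt_min hr hr', min κ κ', lt_min hκ hκ', ?_⟩
    rintro z (hz | hz)
    · exact h.mono subset_rfl (min_le_left _ _) (min_le_left _ _) z hz
    · exact h'.mono subset_rfl (min_le_right _ _) (min_le_right _ _) z hz
  · intro x _
    have ball : ∀ r > 0, Metric.ball x (r / 2) ∈ 𝓝[s] x := fun r hr =>
      mem_nhdsWithin_of_mem_nhds (Metric.ball_mem_nhds x (by positivity))
    by_cases hx : x ∈ frontier Ω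
    · obtain ⟨r, hr, κ, hκ, h⟩ := hΩ.hasCorkscrew_near hx
      exact ⟨_, ball r hr, r / 4, by positivity, κ, hκ, h⟩
    · by_cases hxΩ : x ∈ Ω
      · exact ⟨Ω, mem_nhdsWithin_of_mem_nhds (hΩ.1.mem_nhds hxΩ), 1, one_pos, 1, one_pos,
          fun z hz hzΩ => (hzΩ hz).elim⟩
      · have : x ∉ closure Ω := fun hc => hx ⟨hc, fun hi => hxΩ (interior_subset hi)⟩
        obtain ⟨r, hr, h⟩ := Metric.isOpen_iff.1 isClosed_closure.isOpen_compl x this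
        exact ⟨_, ball r hr, r / 4, by positivity, 1, one_pos,
          .of_ball_subset (h.trans (compl_subset_compl.2 subset_closure))⟩

/-- A bounded Lipschitz domain satisfies the exterior corkscrew condition at all scales. -/
theorem IsLipschitzDomain.exists_corkscrew {d : ℕ} (hd : 1 ≤ d) {Ω : Set (Euc d)}
    (hΩ : IsLipschitzDomain Ω) (hb : Bornology.IsBounded Ω) :
    ∃ κ > 0, ∀ r₀, HasCorkscrew Ω univ r₀ κ := by
  obtain ⟨R, hR0, hR⟩ := hb.subset_ball_lt 0 0
  obtain ⟨r, hr, κ, hκ, h⟩ := hΩ.exists_hasCorkscrew_of_isCompact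
    (isCompact_closedBall (0 : Euc d) (5 * R))
  -- If `z` is far away or `ρ` is large, a radial step outwards by `ρ / 2` works: the ball of radius
  -- `ρ / 4` there has norms at least `‖z‖ + ρ / 4 ≥ R`.
  have large : ∀ z : Euc d, ∀ ρ, 0 < ρ → 4 * R ≤ max (‖z‖ - R) ρ →
      ∃ w, Metric.closedBall w (1 / 4 * ρ) ⊆ Metric.closedBall z ρ ∩ Ωᶜ := by
    intro z ρ hρ hz
    obtain ⟨e, he, hez⟩ : ∃ e : Euc d, ‖e‖ = 1 ∧ z = ‖z‖ • e := by
      by_cases hz0 : z = 0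
      · exact ⟨EuclideanSpace.single ⟨0, hd⟩ 1, by simp, by simp [hz0]⟩
      · have := norm_ne_zero_iff.2 hz0
        exact ⟨‖z‖⁻¹ • z, by simp [norm_smul, this], by rw [smul_smul, mul_inv_cancel₀ this, one_smul]⟩
    refine ⟨z + (ρ / 2) • e, fun y hy => ?_⟩
    rw [mem_closedBall_iff_norm] at hy
    have hw : ‖z + (ρ / 2) • e‖ = ‖z‖ + ρ / 2 := by
      conv_lhs => rw [hez, ← add_smul]
      rw [norm_smul, he, mul_one, Real.norm_of_nonneg (by positivity)]
    constructor
    · rw [mem_closedBall_iff_norm]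
      have h1 := norm_sub_le_norm_sub_add_norm_sub y (z + (ρ / 2) • e) z
      rw [add_sub_cancel_left, norm_smul, he, mul_one, Real.norm_of_nonneg (by positivity)] at h1
      linarith
    · intro hyΩ
      have h1 := hR hyΩ
      rw [mem_ball_zero_iff] at h1
      have h2 := norm_sub_norm_le (z + (ρ / 2) • e) y
      rw [norm_sub_rev] at h2
      rcases le_max_iff.1 hz with h3 | h3 <;> linarith [norm_nonneg z]
  -- The third entry serves radii between `r` and `4 R`, for which the ball found at scale `r` is
  -- used.
  refine ⟨min (1 / 4) (min κ (κ * (r / (4 * R)))), by positivity, fun r₀ z _ hz ρ hρ _ => ?_⟩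
  by_cases h1 : 4 * R ≤ max (‖z‖ - R) ρ
  · obtain ⟨w, hw⟩ := large z ρ hρ h1
    refine ⟨w, (Metric.closedBall_subset_closedBall ?_).trans hw⟩
    gcongr
    exact min_le_left _ _
  · push Not at h1
    obtain ⟨h2, h3⟩ := max_lt_iff.1 h1
    have hzm : z ∈ Metric.closedBall (0 : Euc d) (5 * R) := by
      rw [mem_closedBall_zero_iff]; linarith
    obtain ⟨w, hw⟩ := h z hzm hz (min ρ r) (lt_min hρ hr) (min_le_right _ _)
    refine ⟨w, (Metric.closedBall_subset_closedBall ?_).trans (hw.trans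
      (inter_subset_inter_left _ (Metric.closedBall_subset_closedBall (min_le_left _ _))))⟩
    rcases le_total ρ r with h4 | h4
    · rw [min_eq_left h4]
      gcongr
      exact (min_le_right _ _).trans (min_le_left _ _)
    · rw [min_eq_right h4]
      calc _ ≤ κ * (r / (4 * R)) * ρ := by
            gcongr
            exact (min_le_right _ _).trans (min_le_right _ _)
        _ ≤ κ * (r / (4 * R)) * (4 * R) := by gcongr
        _ = κ * r := by field_simp

/-! ### Two facts on Lipschitz functions -/

/-- A function that satisfies a Lipschitz estimate at each point is Lipschitz continuous. -/
theorem lipschitzWith_of_forall_eventually {E F : Type*} [NormedAddCommGroup E] [NormedSpace ℝ E]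
    [NormedAddCommGroup F] {f : E → F} {C : ℝ≥0}
    (h : ∀ x, ∀ᶠ y in 𝓝 x, ‖f y - f x‖ ≤ C * ‖y - x‖) : LipschitzWith C f := by
  have hc : Continuous f := by
    refine continuous_iff_continuousAt.2 fun x => ?_
    rw [ContinuousAt, tendsto_iff_norm_sub_tendsto_zero]
    refine squeeze_zero' (Eventually.of_forall fun _ => norm_nonneg _) (h x) ?_
    have : Continuous fun y : E => (C : ℝ) * ‖y - x‖ := by fun_prop
    simpa using this.tendsto x
  refine LipschitzWith.of_dist_le_mul fun y x => ?_
  rw [dist_eq_norm, dist_eq_norm]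
  refine le_of_forall_pos_le_add fun ε hε => ?_
  set γ : ℝ → E := fun t => x + t • (y - x) with hγ
  have hγc : Continuous γ := by fun_prop
  -- The growth of `f` along the segment has right slopes at most `C ‖y - x‖`; the added `ε`
  -- supplies the strict inequality between slopes and boundary derivative.
  have key := image_norm_le_of_liminf_right_slope_norm_lt_deriv_boundary (a := 0) (b := 1)
    (f := fun t => f (γ t) - f x) (f' := fun _ => C * ‖y - x‖)
    (B := fun t => (C * ‖y - x‖ + ε) * t) (B' := fun _ => C * ‖y - x‖ + ε)
    (by fun_prop) ?_ (by simp [hγ]) (by fun_prop) (fun t _ => by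
      simpa using ((hasDerivAt_id t).const_mul (C * ‖y - x‖ + ε)).hasDerivWithinAt)
    (fun t _ _ => by linarith) (right_mem_Icc.2 zero_le_one)
  · simpa [hγ] using key
  · intro t _ r hr
    refine Eventually.frequently ?_
    have h1 : ∀ᶠ z in 𝓝[>] t, ‖f (γ z) - f (γ t)‖ ≤ C * ‖γ z - γ t‖ :=
      (hγc.tendsto t).mono_left nhdsWithin_le_nhds |>.eventually (h (γ t))
    filter_upwards [h1, self_mem_nhdsWithin] with z hz htz
    refine lt_of_le_of_lt ?_ hr
    have hpos : 0 < z - t := sub_pos.2 htz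
    rw [slope_def_field, div_le_iff₀ hpos]
    have e : γ z - γ t = (z - t) • (y - x) := by simp only [hγ]; module
    rw [e, norm_smul, Real.norm_of_nonneg hpos.le] at hz
    have h2 := norm_sub_norm_le (f (γ z) - f x) (f (γ t) - f x)
    rw [sub_sub_sub_cancel_right] at h2
    simp only [Function.comp_apply]
    linarith

/-- The derivative of a Lipschitz function vanishes almost everywhere on its zero set. -/
theorem LipschitzWith.ae_fderiv_eq_zero {d N : ℕ} (hd : 1 ≤ d) {f : Euc d → Euc N} {C : ℝ≥0}
    (hf : LipschitzWith C f) {A : Set (Euc d)} (hA : MeasurableSet A) (hfA : ∀ x ∈ A, f x = 0) :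
    ∀ᵐ x, x ∈ A → fderiv ℝ f x = 0 := by
  set e : Euc d := EuclideanSpace.single ⟨0, hd⟩ 1
  have he : e ≠ 0 := by
    intro h
    have := congrArg norm h
    simp [e] at this
  have hdiff := hf.ae_differentiableAt (μ := volume)
  set S := A ∩ {x | DifferentiableAt ℝ f x}
  have hS : MeasurableSet S := hA.inter (measurableSet_of_differentiableAt ℝ f)
  have key : ∀ j : Fin N, ∀ᵐ x ∂volume.restrict S, ∀ v, fderiv ℝ f x v j = 0 := by
    intro j
    -- The density-point result below concerns self-maps of `Euc d`, so the `j`-th coordinate is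
    -- placed along the fixed vector `e`. On `S` this map is zero, hence approximated by the zero
    -- map with error `0`.
    set L : Euc N →L[ℝ] Euc d :=
      (EuclideanSpace.proj j : Euc N →L[ℝ] ℝ).smulRight e with hL
    have happ : ApproximatesLinearOn (fun x => L (f x)) (0 : Euc d →L[ℝ] Euc d) S 0 := by
      intro x hx y hy
      simp [hfA x hx.1, hfA y hy.1]
    have := happ.norm_fderiv_sub_le (μ := volume) hS (fun x => L ∘L fderiv ℝ f x)
      fun x hx => (L.hasFDerivAt.comp x hx.2.hasFDerivAt).hasFDerivWithinAt
    filter_upwards [this] with x hx v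
    have h0 : L ∘L fderiv ℝ f x = 0 := by simpa using hx
    have h1 : L (fderiv ℝ f x v) = 0 := congrArg (fun T : Euc d →L[ℝ] Euc d => T v) h0
    simpa [hL, he] using h1
  have key' := ae_all_iff.2 key
  rw [ae_restrict_iff' hS] at key'
  filter_upwards [key', hdiff] with x hx hxd hxA
  ext v j
  exact hx ⟨hxA, hxd⟩ j v

/-! ### The Poincaré inequality on Whitney cubes -/

section WhitneyPoincare

variable {d N : ℕ} {Ω : Set (Euc d)}

theorem DyadicCube.volume_dilate_two_div_le (hd : 1 ≤ d) (Q : DyadicCube d) {B : Set (Euc d)} {w : Euc d}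
    {r : ℝ} (hr : 0 < r) (hB : Metric.closedBall w (r * Q.side) ⊆ B) :
    volume (Q.dilate 2) / volume B ≤ ENNReal.ofReal ((√d / r) ^ d) := by
  have hs := Q.side_pos
  have h1 : volume (Q.dilate 2) ≤ ENNReal.ofReal ((√d * Q.side) ^ d)
      * volume (Metric.ball (0 : Euc d) 1) := by
    have := measure_mono (μ := volume) (Q.dilate_subset_closedBall zero_le_two)
    rw [Measure.addHaar_closedBall _ _ (by positivity)] at this
    refine this.trans (le_of_eq ?_)
    simp only [finrank_euclideanSpace, Fintype.card_fin]
    congr 3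
    ring
  have h2 : ENNReal.ofReal ((r * Q.side) ^ d) * volume (Metric.ball (0 : Euc d) 1) ≤ volume B := by
    have := measure_mono (μ := volume) hB
    rw [Measure.addHaar_closedBall _ _ (by positivity)] at this
    simpa using this
  have hb0 : volume (Metric.ball (0 : Euc d) 1) ≠ 0 := (Metric.measure_ball_pos _ _ one_pos).ne'
  have hb1 : volume (Metric.ball (0 : Euc d) 1) ≠ ⊤ := measure_ball_lt_top.ne
  refine (ENNReal.div_le_div h1 h2).trans ?_
  rw [ENNReal.mul_div_mul_right _ _ hb0 hb1, ← ENNReal.ofReal_div_of_pos (by positivity),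
    ← div_pow, mul_div_mul_right _ _ hs.ne']

/-- The constant in the Poincaré inequality on Whitney cubes, for a set with exterior
corkscrew constant `κ`. -/
noncomputable def whitneyPoincareConst (d : ℕ) (p κ : ℝ) : ℝ≥0∞ :=
  ENNReal.ofReal (√d * 2) ^ p *
    (2 ^ d * (1 + ENNReal.ofReal ((√d / (min (1 / 2) (κ * (7 / 16)))) ^ d)))

theorem whitneyPoincareConst_ne_top {p : ℝ} (hp : 0 ≤ p) (κ : ℝ) :
    whitneyPoincareConst d p κ ≠ ⊤ := by
  refine ENNReal.mul_ne_top (ENNReal.rpow_ne_top_of_nonneg hp ENNReal.ofReal_ne_top)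
    (ENNReal.mul_ne_top (by simp) (by simp))

/-- Interior and boundary cubes are treated alike: in both cases `whitneyMean` is the mean of `φ`
over some `B ⊆ 2 Q` of comparable volume. For an interior cube `B` is `9/8 Q`; otherwise it is a
corkscrew ball outside `Ω`, on which `φ` vanishes. -/
theorem lintegral_enorm_sub_whitneyMean_rpow_le (hd : 1 ≤ d) {p : ℝ} (hp : 1 ≤ p) {κ : ℝ}
    (hκ : 0 < κ)
    (hΩ : ∀ r₀, HasCorkscrew Ω univ r₀ κ) {φ : Euc d → Euc N} (hφ : IsTestFunction Ω φ)
    (Q : DyadicCube d) :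
    ∫⁻ x in Q.dilate 2, ‖φ x - whitneyMean Ω φ Q‖ₑ ^ p ≤
      whitneyPoincareConst d p κ * ENNReal.ofReal Q.side ^ p *
        ∫⁻ x in Q.dilate 2, ‖fderiv ℝ φ x‖ₑ ^ p := by
  have hs := Q.side_pos
  set r := min (1 / 2) (κ * (7 / 16)) with hr
  have hr0 : 0 < r := by positivity
  have general : ∀ (B : Set (Euc d)) (w : Euc d), MeasurableSet B → B ⊆ Q.dilate 2 →
      Metric.closedBall w (r * Q.side) ⊆ B → whitneyMean Ω φ Q = ⨍ y in B, φ y →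
      ∫⁻ x in Q.dilate 2, ‖φ x - whitneyMean Ω φ Q‖ₑ ^ p ≤
        whitneyPoincareConst d p κ * ENNReal.ofReal Q.side ^ p *
          ∫⁻ x in Q.dilate 2, ‖fderiv ℝ φ x‖ₑ ^ p := by
    intro B w hBm hB hw hmean
    rw [hmean]
    refine (lintegral_enorm_sub_average_rpow_le hp (hφ.1.of_le (by simp)) (Q.convex_dilate 2)
      (Q.isClosed_dilate 2).measurableSet hBm hB ?_ ?_
      (hφ.1.continuous.integrable_of_hasCompactSupport hφ.2.1).integrableOn
      fun x hx y hy => Q.dist_le_of_mem_dilate zero_le_two hx hy).trans ?_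
    · exact ((Metric.measure_closedBall_pos volume w (by positivity)).trans_le
        (measure_mono hw)).ne'
    · exact ((measure_mono hB).trans_lt (Q.isCompact_dilate 2).measure_lt_top).ne
    · have h1 := Q.volume_dilate_two_div_le hd hr0 hw
      rw [← mul_assoc √(d : ℝ), ENNReal.ofReal_mul (by positivity),
        ENNReal.mul_rpow_of_nonneg _ _ (by linarith)]
      calc _ ≤ ENNReal.ofReal (√d * 2) ^ p * ENNReal.ofReal Q.side ^ p *
            (2 ^ d * (1 + ENNReal.ofReal ((√d / r) ^ d))) *
              ∫⁻ x in Q.dilate 2, ‖fderiv ℝ φ x‖ₑ ^ p := by gcongr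
        _ = _ := by unfold whitneyPoincareConst; ring
  by_cases h : Q.dilate (9 / 8) ⊆ Ω
  · refine general (Q.dilate (9 / 8)) Q.center (Q.isClosed_dilate _).measurableSet
      (Q.dilate_mono (by norm_num)) ?_ (if_pos h)
    refine (Metric.closedBall_subset_closedBall ?_).trans (Q.closedBall_subset_dilate _)
    have : r * Q.side ≤ 1 / 2 * Q.side := by gcongr; exact min_le_left _ _
    linarith
  · obtain ⟨z, hz, hzΩ⟩ := not_subset.1 h
    -- The radius is chosen so that a ball centered in `9/8 Q` stays in `2 Q`: `9/8 + 7/8 = 2`.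
    obtain ⟨w, hw⟩ := hΩ _ z (mem_univ z) hzΩ (7 / 8 * Q.side / 2) (by positivity) le_rfl
    refine general _ w Metric.isClosed_closedBall.measurableSet
      (hw.trans fun y hy => Q.dilate_mono (by norm_num)
        (Q.mem_dilate_of_dist_le hz (Metric.mem_closedBall.1 hy.1)))
      (Metric.closedBall_subset_closedBall ?_) ?_
    · calc r * Q.side ≤ κ * (7 / 16) * Q.side := by gcongr; exact min_le_right _ _
        _ = _ := by ring
    · rw [whitneyMean, if_neg h, setAverage_eq, setIntegral_eq_zero_of_forall_eq_zero, smul_zero]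
      exact fun y hy => hφ.eq_zero (hw hy).2

/-- The mean lies in the closed ball around `φ x` that contains the values on `9/8 Q`. For a
boundary cube the mean `0` is itself a value of `φ`, taken at a point of `9/8 Q` outside `Ω`. -/
theorem dist_whitneyMean_le {φ : Euc d → Euc N} {M : ℝ≥0} (hφ : LipschitzWith M φ)
    (hφΩ : ∀ x ∉ Ω, φ x = 0) (Q : DyadicCube d) {x : Euc d} (hx : x ∈ Q.dilate 2) :
    ‖whitneyMean Ω φ Q - φ x‖ ≤ M * (√d * (2 * Q.side)) := by
  have hs := Q.side_pos
  have hsub : Q.dilate (9 / 8) ⊆ Q.dilate 2 := Q.dilate_mono (by norm_num)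
  have key : ∀ y ∈ Q.dilate (9 / 8), ‖φ y - φ x‖ ≤ M * (√d * (2 * Q.side)) := by
    intro y hy
    rw [← dist_eq_norm]
    refine (hφ.dist_le_mul y x).trans ?_
    gcongr
    exact Q.dist_le_of_mem_dilate zero_le_two (hsub hy) hx
  unfold whitneyMean
  split_ifs with h
  · rw [← mem_closedBall_iff_norm]
    refine (convex_closedBall (φ x) _).set_average_mem Metric.isClosed_closedBall ?_
      (Q.isCompact_dilate _).measure_lt_top.ne
      ((ae_restrict_mem (Q.isClosed_dilate _).measurableSet).mono fun y hy => ?_)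
      (hφ.continuous.continuousOn.integrableOn_compact (Q.isCompact_dilate _))
    · exact ((Metric.measure_closedBall_pos volume Q.center (by positivity)).trans_le
        (measure_mono (Q.closedBall_subset_dilate _))).ne'
    · exact mem_closedBall_iff_norm.2 (key y hy)
  · obtain ⟨z, hz, hzΩ⟩ := not_subset.1 h
    have := key z hz
    rwa [hφΩ z hzΩ] at this

end WhitneyPoincare

/-! ### Pointwise estimates for the relative truncation -/

namespace IsWhitneyPartition

variable {d : ℕ} {O : Set (Euc d)} {𝒬 : Set (DyadicCube d)} {ψ : DyadicCube d → Euc d → ℝ}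
  {K : ℝ≥0}

theorem nonneg (hψ : IsWhitneyPartition O 𝒬 ψ K) {Q : DyadicCube d} (hQ : Q ∈ 𝒬) (x : Euc d) :
    0 ≤ ψ Q x :=
  (indicator_nonneg (fun _ _ => zero_le_one) x).trans (hψ.indicator_le Q hQ x)

theorem le_one (hψ : IsWhitneyPartition O 𝒬 ψ K) {Q : DyadicCube d} (hQ : Q ∈ 𝒬) (x : Euc d) :
    ψ Q x ≤ 1 :=
  (hψ.le_indicator Q hQ x).trans (indicator_le_self' (fun _ _ => zero_le_one) x)

theorem eq_zero (hψ : IsWhitneyPartition O 𝒬 ψ K) {Q : DyadicCube d} (hQ : Q ∈ 𝒬) {x : Euc d}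
    (hx : x ∉ Q.dilate (9 / 8)) : ψ Q x = 0 := by
  refine le_antisymm ?_ (hψ.nonneg hQ x)
  have := hψ.le_indicator Q hQ x
  rwa [indicator_of_notMem hx] at this

/-- The finite set `t` is left free so that the values at two nearby points can be written as sums
over the same cubes. -/
theorem tsum_smul_eq_sum {F : Type*} [NormedAddCommGroup F] [NormedSpace ℝ F]
    (hψ : IsWhitneyPartition O 𝒬 ψ K) {x : Euc d}
    {t : Finset (DyadicCube d)} (ht : ↑t ⊆ 𝒬) (hxt : ∀ Q ∈ 𝒬, x ∈ Q.dilate (9 / 8) → Q ∈ t)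
    (a : DyadicCube d → F) :
    ∑' Q : 𝒬, ψ Q x • a Q = ∑ Q ∈ t, ψ Q x • a Q := by
  rw [tsum_subtype 𝒬 (fun Q => ψ Q x • a Q), tsum_eq_sum (s := t)]
  · refine Finset.sum_congr rfl fun Q hQ => ?_
    rw [indicator_of_mem (ht hQ)]
  · intro Q hQ
    by_cases h1 : Q ∈ 𝒬
    · rw [indicator_of_mem h1, hψ.eq_zero h1 fun h => hQ (hxt Q h1 h), zero_smul]
    · rw [indicator_of_notMem h1]

theorem sum_eq_one' (hψ : IsWhitneyPartition O 𝒬 ψ K) {x : Euc d} (hx : x ∈ O)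
    {t : Finset (DyadicCube d)} (ht : ↑t ⊆ 𝒬) (hxt : ∀ Q ∈ 𝒬, x ∈ Q.dilate (9 / 8) → Q ∈ t) :
    ∑ Q ∈ t, ψ Q x = 1 := by
  have := hψ.tsum_smul_eq_sum ht hxt (fun _ => (1 : ℝ))
  simp only [smul_eq_mul, mul_one] at this
  rw [← this, hψ.sum_eq_one x hx]

end IsWhitneyPartition

section Truncation

variable {d N : ℕ} {Ω O : Set (Euc d)} {𝒬 : Set (DyadicCube d)} {ψ : DyadicCube d → Euc d → ℝ}
  {K : ℝ≥0}

/-- The cubes of the covering whose doubles contain `x`. -/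
noncomputable def IsWhitneyCovering.near (h : IsWhitneyCovering O 𝒬) (hO : O ≠ univ) (x : Euc d) :
    Finset (DyadicCube d) :=
  (h.finite_setOf_mem hO x).toFinset

theorem IsWhitneyCovering.mem_near (h : IsWhitneyCovering O 𝒬) (hO : O ≠ univ) {x : Euc d}
    {Q : DyadicCube d} : Q ∈ h.near hO x ↔ Q ∈ 𝒬 ∧ x ∈ Q.dilate 2 := by
  simp [near]

theorem IsWhitneyCovering.card_near_le (h : IsWhitneyCovering O 𝒬) (hO : O ≠ univ) (x : Euc d) :
    (h.near hO x).card ≤ 4 * 3 ^ d := by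
  rw [near, ← ncard_eq_toFinset_card _ (h.finite_setOf_mem hO x)]
  exact h.ncard_setOf_mem_le hO x

theorem IsWhitneyCovering.near_subset (h : IsWhitneyCovering O 𝒬) (hO : O ≠ univ) (x : Euc d) :
    ↑(h.near hO x) ⊆ 𝒬 := fun _ hQ => ((h.mem_near hO).1 hQ).1

theorem IsWhitneyCovering.mem_near_of_mem_dilate (h : IsWhitneyCovering O 𝒬) (hO : O ≠ univ)
    (x : Euc d) : ∀ Q ∈ 𝒬, x ∈ Q.dilate (9 / 8) → Q ∈ h.near hO x := fun Q hQ hx =>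
  (h.mem_near hO).2 ⟨hQ, Q.dilate_mono (by norm_num) hx⟩

/-- Cubes that are close to a point close to `x` are close to `x`. -/
theorem IsWhitneyCovering.eventually_mem_near (h : IsWhitneyCovering O 𝒬) (hO : O ≠ univ)
    (hOo : IsOpen O) {x : Euc d} (hx : x ∈ O) :
    ∀ᶠ y in 𝓝 x, ∀ Q ∈ 𝒬, y ∈ Q.dilate (9 / 8) → Q ∈ h.near hO x := by
  have hne : Oᶜ.Nonempty := nonempty_compl.2 hO
  have hδ : 0 < Metric.infDist x Oᶜ :=
    (hOo.isClosed_compl.notMem_iff_infDist_pos hne).1 (by simpa using hx)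
  have hd : 0 ≤ √(d : ℝ) := Real.sqrt_nonneg _
  have h1 : ∀ᶠ y in 𝓝 x, Metric.infDist x Oᶜ / 2 < Metric.infDist y Oᶜ :=
    (Metric.continuous_infDist_pt Oᶜ).continuousAt.eventually_const_lt (half_lt_self hδ)
  -- A cube with `y ∈ 9/8 Q` has side at least `dist(x, Oᶜ) / (11 (√d + 1))`, and moving by `7/16`
  -- of a side leads from `9/8 Q` to `2 Q`. The `+ 1` keeps the denominator positive for `d = 0`.
  have h2 := Metric.ball_mem_nhds x
    (show 0 < 7 / 16 * (Metric.infDist x Oᶜ / (11 * (√d + 1))) by positivity)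
  filter_upwards [h1, h2] with y hy1 hy2 Q hQ hyQ
  have hs := Q.side_pos
  refine (h.mem_near hO).2 ⟨hQ, Q.dilate_mono (by norm_num)
    (Q.mem_dilate_of_dist_le (r := 7 / 8) hyQ ?_)⟩
  have h3 := h.infDist_le hO hQ (Q.dilate_mono (by norm_num) hyQ)
  have h4 : Metric.infDist x Oᶜ / (11 * (√d + 1)) ≤ Q.side := by
    rw [div_le_iff₀ (by positivity)]
    nlinarith
  rw [dist_comm]
  rw [Metric.mem_ball] at hy2
  linarith

theorem relativeTruncation_eq_sum (hψ : IsWhitneyPartition O 𝒬 ψ K)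
    (u : Euc d → Euc N) {x : Euc d} (hx : x ∈ O) {t : Finset (DyadicCube d)} (ht : ↑t ⊆ 𝒬)
    (hxt : ∀ Q ∈ 𝒬, x ∈ Q.dilate (9 / 8) → Q ∈ t) :
    relativeTruncation Ω O 𝒬 ψ u x = ∑ Q ∈ t, ψ Q x • whitneyMean Ω u Q := by
  rw [relativeTruncation, if_pos hx, hψ.tsum_smul_eq_sum ht hxt]

theorem relativeTruncation_of_notMem (u : Euc d → Euc N) {x : Euc d} (hx : x ∉ O) :
    relativeTruncation Ω O 𝒬 ψ u x = Ω.indicator u x := by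
  rw [relativeTruncation, if_neg hx]

theorem norm_relativeTruncation_le (h : IsWhitneyCovering O 𝒬) (hO : O ≠ univ)
    (hψ : IsWhitneyPartition O 𝒬 ψ K) (u : Euc d → Euc N) {x : Euc d} (hx : x ∈ O) :
    ‖relativeTruncation Ω O 𝒬 ψ u x‖ ≤ ∑ Q ∈ h.near hO x, ‖whitneyMean Ω u Q‖ := by
  rw [relativeTruncation_eq_sum hψ u hx (h.near_subset hO x) (h.mem_near_of_mem_dilate hO x)]
  refine (norm_sum_le _ _).trans (Finset.sum_le_sum fun Q hQ => ?_)
  have hQ' := h.near_subset hO x hQ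
  rw [norm_smul, Real.norm_of_nonneg (hψ.nonneg hQ' x)]
  exact mul_le_of_le_one_left (norm_nonneg _) (hψ.le_one hQ' x)

/-- The local Lipschitz constant of the relative truncation in `O`. -/
noncomputable def truncationSlope (h : IsWhitneyCovering O 𝒬) (hO : O ≠ univ) (K : ℝ≥0)
    (Ω : Set (Euc d)) (u : Euc d → Euc N) (b : Euc N) (x : Euc d) : ℝ :=
  ∑ Q ∈ h.near hO x, K / Metric.diam Q.carrier * ‖whitneyMean Ω u Q - b‖

theorem truncationSlope_nonneg (h : IsWhitneyCovering O 𝒬) (hO : O ≠ univ)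
    (u : Euc d → Euc N) (b : Euc N) (x : Euc d) : 0 ≤ truncationSlope h hO K Ω u b x :=
  Finset.sum_nonneg fun Q _ => by
    have : 0 ≤ Metric.diam Q.carrier := Metric.diam_nonneg
    positivity

/-- The weights sum to one at `x` and at `y`, so subtracting any constant `b` from all means leaves
the difference unchanged. The choice `b = φ x` later turns the slope into local oscillations. -/
theorem eventually_norm_relativeTruncation_sub_le (h : IsWhitneyCovering O 𝒬) (hO : O ≠ univ)
    (hOo : IsOpen O) (hψ : IsWhitneyPartition O 𝒬 ψ K) (u : Euc d → Euc N) (b : Euc N)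
    {x : Euc d} (hx : x ∈ O) :
    ∀ᶠ y in 𝓝 x, ‖relativeTruncation Ω O 𝒬 ψ u y - relativeTruncation Ω O 𝒬 ψ u x‖
      ≤ truncationSlope h hO K Ω u b x * ‖y - x‖ := by
  filter_upwards [h.eventually_mem_near hO hOo hx, hOo.mem_nhds hx] with y hy hyO
  have hsub := h.near_subset hO x
  have hx' := h.mem_near_of_mem_dilate hO x
  rw [relativeTruncation_eq_sum hψ u hx hsub hx', relativeTruncation_eq_sum hψ u hyO hsub hy]
  have e : ∑ Q ∈ h.near hO x, ψ Q y • whitneyMean Ω u Q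
      - ∑ Q ∈ h.near hO x, ψ Q x • whitneyMean Ω u Q
      = ∑ Q ∈ h.near hO x, (ψ Q y - ψ Q x) • (whitneyMean Ω u Q - b) := by
    have h0 : ∑ Q ∈ h.near hO x, (ψ Q y - ψ Q x) • b = 0 := by
      rw [← Finset.sum_smul, Finset.sum_sub_distrib, hψ.sum_eq_one' hx hsub hx',
        hψ.sum_eq_one' hyO hsub hy, sub_self, zero_smul]
    calc _ = ∑ Q ∈ h.near hO x, (ψ Q y - ψ Q x) • whitneyMean Ω u Q
          - ∑ Q ∈ h.near hO x, (ψ Q y - ψ Q x) • b := by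
          rw [h0, sub_zero]
          simp only [sub_smul, Finset.sum_sub_distrib]
      _ = _ := by
          rw [← Finset.sum_sub_distrib]
          simp only [smul_sub]
  rw [e, truncationSlope, Finset.sum_mul]
  refine (norm_sum_le _ _).trans (Finset.sum_le_sum fun Q hQ => ?_)
  rw [norm_smul, Real.norm_eq_abs, mul_right_comm]
  gcongr
  rw [← dist_eq_norm]
  exact hψ.lipschitz Q (hsub hQ) y x

theorem continuousOn_relativeTruncation (h : IsWhitneyCovering O 𝒬) (hO : O ≠ univ)
    (hOo : IsOpen O) (hψ : IsWhitneyPartition O 𝒬 ψ K) (u : Euc d → Euc N) :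
    ContinuousOn (relativeTruncation Ω O 𝒬 ψ u) O := by
  intro x hx
  refine ContinuousAt.continuousWithinAt ?_
  rw [ContinuousAt, tendsto_iff_norm_sub_tendsto_zero]
  refine squeeze_zero' (Eventually.of_forall fun _ => norm_nonneg _)
    (eventually_norm_relativeTruncation_sub_le h hO hOo hψ u 0 hx) ?_
  have : Continuous fun y : Euc d => truncationSlope h hO K Ω u 0 x * ‖y - x‖ := by fun_prop
  simpa using this.tendsto x

/-- A cube that contributes at `x ∉ Ω` has `x ∈ 9/8 Q`, so its mean was set to `0`; this convention
preserves zero boundary values. -/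
theorem relativeTruncation_eq_zero (h : IsWhitneyCovering O 𝒬) (hO : O ≠ univ)
    (hψ : IsWhitneyPartition O 𝒬 ψ K) (u : Euc d → Euc N) {x : Euc d} (hx : x ∉ Ω) :
    relativeTruncation Ω O 𝒬 ψ u x = 0 := by
  by_cases hxO : x ∈ O
  · rw [relativeTruncation_eq_sum hψ u hxO (h.near_subset hO x) (h.mem_near_of_mem_dilate hO x)]
    refine Finset.sum_eq_zero fun Q hQ => ?_
    by_cases hxQ : x ∈ Q.dilate (9 / 8)
    · rw [whitneyMean, if_neg fun hc => hx (hc hxQ), smul_zero]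
    · rw [hψ.eq_zero (h.near_subset hO x hQ) hxQ, zero_smul]
  · rw [relativeTruncation_of_notMem u hxO, indicator_of_notMem hx]

theorem truncationSlope_le (hd : 1 ≤ d) (h : IsWhitneyCovering O 𝒬) (hO : O ≠ univ)
    {φ : Euc d → Euc N} {M : ℝ≥0} (hφ : LipschitzWith M φ) (hφΩ : ∀ x ∉ Ω, φ x = 0) (x : Euc d) :
    truncationSlope h hO K Ω φ (φ x) x ≤ 4 * 3 ^ d * (2 * K * M) := by
  have hd0 : 0 < √(d : ℝ) := by have : 0 < d := hd; positivity
  calc truncationSlope h hO K Ω φ (φ x) x ≤ ∑ _Q ∈ h.near hO x, (2 * K * M : ℝ) := by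
        refine Finset.sum_le_sum fun Q hQ => ?_
        have hs := Q.side_pos
        rw [Q.diam_carrier]
        calc _ ≤ K / (√d * Q.side) * (M * (√d * (2 * Q.side))) := by
              gcongr
              exact dist_whitneyMean_le hφ hφΩ Q ((h.mem_near hO).1 hQ).2
          _ = 2 * K * M := by field_simp
    _ = (h.near hO x).card * (2 * K * M : ℝ) := by simp
    _ ≤ (4 * 3 ^ d : ℕ) * (2 * K * M : ℝ) := by
        gcongr
        exact h.card_near_le hO x
    _ = _ := by push_cast; ring

/-- The truncation is a convex combination of means, each within `2 M √d side` of `φ x`, while `√d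
side / 2` is below the distance to `Oᶜ`. This glues the truncation continuously to `φ` along the
boundary of `O`. -/
theorem norm_relativeTruncation_sub_le (h : IsWhitneyCovering O 𝒬) (hO : O ≠ univ)
    (hψ : IsWhitneyPartition O 𝒬 ψ K) {φ : Euc d → Euc N} {M : ℝ≥0} (hφ : LipschitzWith M φ)
    (hφΩ : ∀ x ∉ Ω, φ x = 0) {x : Euc d} (hx : x ∈ O) :
    ‖relativeTruncation Ω O 𝒬 ψ φ x - φ x‖ ≤ 4 * M * Metric.infDist x Oᶜ := by
  have hsub := h.near_subset hO x
  have hx' := h.mem_near_of_mem_dilate hO x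
  have hone := hψ.sum_eq_one' hx hsub hx'
  rw [relativeTruncation_eq_sum hψ φ hx hsub hx']
  have e : ∑ Q ∈ h.near hO x, ψ Q x • whitneyMean Ω φ Q - φ x
      = ∑ Q ∈ h.near hO x, ψ Q x • (whitneyMean Ω φ Q - φ x) := by
    simp only [smul_sub, Finset.sum_sub_distrib]
    rw [← Finset.sum_smul, hone, one_smul]
  rw [e]
  calc _ ≤ ∑ Q ∈ h.near hO x, ψ Q x * (4 * M * Metric.infDist x Oᶜ) := by
        refine (norm_sum_le _ _).trans (Finset.sum_le_sum fun Q hQ => ?_)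
        obtain ⟨hQ', hxQ⟩ := (h.mem_near hO).1 hQ
        have h0 := hψ.nonneg hQ' x
        rw [norm_smul, Real.norm_of_nonneg h0]
        gcongr
        refine (dist_whitneyMean_le hφ hφΩ Q hxQ).trans ?_
        have h1 := (h.lt_infDist hO hQ' hxQ).le
        have h2 : M * (√d * (Q.side / 2)) ≤ M * Metric.infDist x Oᶜ := by gcongr
        linarith
    _ = _ := by rw [← Finset.sum_mul, hone, one_mul]

/-- The relative truncation of a Lipschitz function is Lipschitz. -/
theorem lipschitzWith_relativeTruncation (hd : 1 ≤ d) (h : IsWhitneyCovering O 𝒬) (hO : O ≠ univ)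
    (hOo : IsOpen O) (hψ : IsWhitneyPartition O 𝒬 ψ K) {φ : Euc d → Euc N} {M : ℝ≥0}
    (hφ : LipschitzWith M φ) (hφΩ : ∀ x ∉ Ω, φ x = 0) :
    LipschitzWith (4 * 3 ^ d * (2 * K * M) + 5 * M) (relativeTruncation Ω O 𝒬 ψ φ) := by
  have hoff : ∀ x ∉ O, relativeTruncation Ω O 𝒬 ψ φ x = φ x := by
    intro x hx
    rw [relativeTruncation_of_notMem φ hx]
    by_cases hxΩ : x ∈ Ω
    · rw [indicator_of_mem hxΩ]
    · rw [indicator_of_notMem hxΩ, hφΩ x hxΩ]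
  refine lipschitzWith_of_forall_eventually fun x => ?_
  push_cast
  by_cases hx : x ∈ O
  · filter_upwards [eventually_norm_relativeTruncation_sub_le h hO hOo hψ φ (φ x) hx] with y hy
    refine hy.trans ?_
    gcongr
    have := truncationSlope_le (K := K) hd h hO hφ hφΩ x
    linarith [M.coe_nonneg]
  -- For `x ∉ O` the distance from `y` to `Oᶜ` is at most `‖y - x‖`, so passing from the truncation
  -- to `φ` at `y` costs `4 M ‖y - x‖`.
  · refine Eventually.of_forall fun y => ?_
    rw [hoff x hx]
    have h1 : ‖φ y - φ x‖ ≤ M * ‖y - x‖ := by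
      rw [← dist_eq_norm, ← dist_eq_norm]; exact hφ.dist_le_mul y x
    have h2 : ‖relativeTruncation Ω O 𝒬 ψ φ y - φ y‖ ≤ 4 * M * ‖y - x‖ := by
      by_cases hy : y ∈ O
      · refine (norm_relativeTruncation_sub_le h hO hψ hφ hφΩ hy).trans ?_
        gcongr
        rw [← dist_eq_norm]
        exact Metric.infDist_le_dist_of_mem hx
      · rw [hoff y hy, sub_self, norm_zero]; positivity
    have h3 : (0 : ℝ) ≤ 4 * 3 ^ d * (2 * K * M) * ‖y - x‖ := by positivity
    have := norm_sub_le_norm_sub_add_norm_sub (relativeTruncation Ω O 𝒬 ψ φ y) (φ y) (φ x)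
    linarith

/-! ### Summation over the cubes -/

/-- Trades a finite sum whose index set depends on `x` for a fixed countable sum, which can be
interchanged with the integral. -/
theorem IsWhitneyCovering.sum_near_eq_tsum (h : IsWhitneyCovering O 𝒬) (hO : O ≠ univ)
    (a : DyadicCube d → ℝ≥0∞) (x : Euc d) :
    ∑ Q ∈ h.near hO x, a Q = ∑' Q : 𝒬, (Q.1.dilate 2).indicator (fun _ => a Q) x := by
  rw [tsum_subtype 𝒬 (fun Q => (Q.dilate 2).indicator (fun _ => a Q) x),
    tsum_eq_sum (s := h.near hO x)]
  · refine Finset.sum_congr rfl fun Q hQ => ?_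
    obtain ⟨h1, h2⟩ := (h.mem_near hO).1 hQ
    rw [indicator_of_mem h1, indicator_of_mem h2]
  · intro Q hQ
    by_cases h1 : Q ∈ 𝒬
    · rw [indicator_of_mem h1, indicator_of_notMem fun h2 => hQ ((h.mem_near hO).2 ⟨h1, h2⟩)]
    · rw [indicator_of_notMem h1]

/-- The power mean inequality for at most `4 * 3 ^ d` terms, followed by monotone interchange of sum
and integral. -/
theorem IsWhitneyCovering.lintegral_sum_near_rpow_le (h : IsWhitneyCovering O 𝒬) (hO : O ≠ univ)
    {p : ℝ} (hp : 1 ≤ p) {a : DyadicCube d → Euc d → ℝ≥0∞} (ha : ∀ Q, Measurable (a Q)) :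
    ∫⁻ x in O, (∑ Q ∈ h.near hO x, a Q x) ^ p ≤
      (4 * 3 ^ d : ℕ) ^ (p - 1) * ∑' Q : 𝒬, ∫⁻ x in Q.1.dilate 2, a Q x ^ p := by
  have hm : ∀ Q : 𝒬, Measurable ((Q.1.dilate 2).indicator fun x => a Q x ^ p) := fun Q =>
    ((ha Q).pow_const p).indicator (Q.1.isClosed_dilate 2).measurableSet
  calc ∫⁻ x in O, (∑ Q ∈ h.near hO x, a Q x) ^ p
      ≤ ∫⁻ x, (4 * 3 ^ d : ℕ) ^ (p - 1) *
          ∑' Q : 𝒬, (Q.1.dilate 2).indicator (fun x => a Q x ^ p) x := by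
        refine (setLIntegral_le_lintegral _ _).trans (lintegral_mono fun x => ?_)
        refine (ENNReal.rpow_sum_le_const_mul_sum_rpow _ _ hp).trans ?_
        have e := h.sum_near_eq_tsum hO (fun Q => a Q x ^ p) x
        rw [e]
        have hc : ((h.near hO x).card : ℝ≥0∞) ≤ (4 * 3 ^ d : ℕ) := by
          exact_mod_cast h.card_near_le hO x
        refine mul_le_mul' (ENNReal.rpow_le_rpow hc (by linarith)) (le_of_eq ?_)
        rfl
    _ = _ := by
        rw [lintegral_const_mul _ (Measurable.tsum hm), lintegral_tsum fun Q =>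
          (hm Q).aemeasurable]
        congr 2
        ext1 Q
        rw [lintegral_indicator (Q.1.isClosed_dilate 2).measurableSet]

/-- The doubles lie in `O`, and each point is in at most `4 * 3 ^ d` of them. -/
theorem IsWhitneyCovering.tsum_lintegral_le (h : IsWhitneyCovering O 𝒬) (hO : O ≠ univ)
    {g : Euc d → ℝ≥0∞} (hg : AEMeasurable g (volume.restrict O)) :
    ∑' Q : 𝒬, ∫⁻ x in Q.1.dilate 2, g x ≤ (4 * 3 ^ d : ℕ) * ∫⁻ x in O, g x := by
  have hsub : ∀ Q : 𝒬, Q.1.dilate 2 ⊆ O := fun Q x hx => h.mem_of_mem_dilate hO Q.2 hx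
  have e : ∀ Q : 𝒬, ∫⁻ x in Q.1.dilate 2, g x
      = ∫⁻ x in O, (Q.1.dilate 2).indicator g x := fun Q => by
    rw [lintegral_indicator (Q.1.isClosed_dilate 2).measurableSet,
      Measure.restrict_restrict (Q.1.isClosed_dilate 2).measurableSet,
      inter_eq_left.2 (hsub Q)]
  simp_rw [e]
  rw [← lintegral_tsum fun Q => hg.indicator (Q.1.isClosed_dilate 2).measurableSet,
    ← lintegral_const_mul'' _ hg]
  refine lintegral_mono fun x => ?_
  have e := h.sum_near_eq_tsum hO (fun _ => g x) x
  calc ∑' Q : 𝒬, (Q.1.dilate 2).indicator g x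
      = ∑ Q ∈ h.near hO x, g x := by
        rw [e]
        rfl
    _ = (h.near hO x).card * g x := by simp
    _ ≤ _ := by
        gcongr
        exact h.card_near_le hO x

end Truncation

/-! ### Stability for test functions -/

section Stability

variable {d N : ℕ} {Ω O : Set (Euc d)} {𝒬 : Set (DyadicCube d)} {ψ : DyadicCube d → Euc d → ℝ}
  {K : ℝ≥0}

theorem enorm_fderiv_relativeTruncation_le (h : IsWhitneyCovering O 𝒬) (hO : O ≠ univ)
    (hOo : IsOpen O) (hψ : IsWhitneyPartition O 𝒬 ψ K) (φ : Euc d → Euc N) {x : Euc d}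
    (hx : x ∈ O) :
    ‖fderiv ℝ (relativeTruncation Ω O 𝒬 ψ φ) x‖ₑ ≤ ∑ Q ∈ h.near hO x,
      ENNReal.ofReal (K / Metric.diam Q.carrier) * ‖φ x - whitneyMean Ω φ Q‖ₑ := by
  have h1 := norm_fderiv_le_of_lip' ℝ (truncationSlope_nonneg h hO (K := K) (Ω := Ω) φ (φ x) x)
    (eventually_norm_relativeTruncation_sub_le h hO hOo hψ φ (φ x) hx)
  rw [← ofReal_norm]
  refine (ENNReal.ofReal_le_ofReal h1).trans (le_of_eq ?_)
  have hK : ∀ Q : DyadicCube d, 0 ≤ K / Metric.diam Q.carrier := fun Q =>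
    div_nonneg K.coe_nonneg Metric.diam_nonneg
  rw [truncationSlope, ENNReal.ofReal_sum_of_nonneg fun Q _ =>
    mul_nonneg (hK Q) (norm_nonneg _)]
  refine Finset.sum_congr rfl fun Q _ => ?_
  rw [ENNReal.ofReal_mul (hK Q), ofReal_norm, ← enorm_neg, neg_sub]

/-- The stability constant. -/
noncomputable def stabilityConst (d : ℕ) (p κ : ℝ) (K : ℝ≥0) : ℝ≥0∞ :=
  ENNReal.ofReal √d ^ p * (2 ^ (p - 1) * (1 + (4 * 3 ^ d : ℕ) ^ (p - 1) *
    (whitneyPoincareConst d p κ * ENNReal.ofReal (K / √d) ^ p * (4 * 3 ^ d : ℕ))))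

theorem stabilityConst_ne_top {p : ℝ} (hp : 1 ≤ p) (κ : ℝ) (K : ℝ≥0) :
    stabilityConst d p κ K ≠ ⊤ := by
  have hp0 : 0 ≤ p := by linarith
  have hp1 : 0 ≤ p - 1 := by linarith
  have h1 : ∀ a : ℝ, ENNReal.ofReal a ^ p ≠ ⊤ := fun a =>
    ENNReal.rpow_ne_top_of_nonneg hp0 ENNReal.ofReal_ne_top
  have h2 : ∀ n : ℕ, (n : ℝ≥0∞) ^ (p - 1) ≠ ⊤ := fun n =>
    ENNReal.rpow_ne_top_of_nonneg hp1 (ENNReal.natCast_ne_top n)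
  exact ENNReal.mul_ne_top (h1 _) (ENNReal.mul_ne_top
    (ENNReal.rpow_ne_top_of_nonneg hp1 ENNReal.ofNat_ne_top) (ENNReal.add_ne_top.2
      ⟨ENNReal.one_ne_top, ENNReal.mul_ne_top (h2 _) (ENNReal.mul_ne_top
        (ENNReal.mul_ne_top (whitneyPoincareConst_ne_top hp0 κ) (h1 _))
        (ENNReal.natCast_ne_top _))⟩))

/-- The factor `K / diam Q` from the partition cancels the side length from the Poincaré inequality
on `2 Q`, leaving the scale-free `K / √d`; bounded overlap then sums the cubes. -/
theorem lintegral_enorm_fderiv_relativeTruncation_rpow_le (hd : 1 ≤ d)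
    (h : IsWhitneyCovering O 𝒬) (hO : O ≠ univ) (hOo : IsOpen O)
    (hψ : IsWhitneyPartition O 𝒬 ψ K) {p : ℝ} (hp : 1 ≤ p) {κ : ℝ} (hκ : 0 < κ)
    (hΩ : ∀ r₀, HasCorkscrew Ω univ r₀ κ) {φ : Euc d → Euc N} (hφ : IsTestFunction Ω φ) :
    ∫⁻ x in O, ‖fderiv ℝ (relativeTruncation Ω O 𝒬 ψ φ) x‖ₑ ^ p ≤
      (4 * 3 ^ d : ℕ) ^ (p - 1) * (whitneyPoincareConst d p κ * ENNReal.ofReal (K / √d) ^ p *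
        (4 * 3 ^ d : ℕ)) * ∫⁻ x in O, ‖fderiv ℝ φ x‖ₑ ^ p := by
  have hp0 : 0 ≤ p := by linarith
  have hd0 : 0 < √(d : ℝ) := by have : 0 < d := hd; positivity
  have hφc := hφ.1.continuous
  have hm : Measurable fun x => ‖fderiv ℝ φ x‖ₑ ^ p :=
    (measurable_fderiv ℝ φ).enorm.pow_const p
  set a : DyadicCube d → Euc d → ℝ≥0∞ := fun Q x =>
    ENNReal.ofReal (K / Metric.diam Q.carrier) * ‖φ x - whitneyMean Ω φ Q‖ₑ
  have ham : ∀ Q, Measurable (a Q) := fun Q =>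
    ((hφc.sub continuous_const).measurable.enorm).const_mul _
  calc ∫⁻ x in O, ‖fderiv ℝ (relativeTruncation Ω O 𝒬 ψ φ) x‖ₑ ^ p
      ≤ ∫⁻ x in O, (∑ Q ∈ h.near hO x, a Q x) ^ p := by
        refine setLIntegral_mono' hOo.measurableSet fun x hx => ?_
        gcongr
        exact enorm_fderiv_relativeTruncation_le h hO hOo hψ φ hx
    _ ≤ (4 * 3 ^ d : ℕ) ^ (p - 1) * ∑' Q : 𝒬, ∫⁻ x in Q.1.dilate 2, a Q x ^ p :=
        h.lintegral_sum_near_rpow_le hO hp ham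
    _ ≤ (4 * 3 ^ d : ℕ) ^ (p - 1) * ∑' Q : 𝒬, whitneyPoincareConst d p κ *
          ENNReal.ofReal (K / √d) ^ p * ∫⁻ x in Q.1.dilate 2, ‖fderiv ℝ φ x‖ₑ ^ p := by
        gcongr with Q
        have hs := Q.1.side_pos
        simp only [a, ENNReal.mul_rpow_of_nonneg _ _ hp0]
        have hmQ : Measurable fun x => ‖φ x - whitneyMean Ω φ Q‖ₑ ^ p :=
          ((hφc.sub continuous_const).measurable.enorm).pow_const p
        rw [lintegral_const_mul _ hmQ]
        calc _ ≤ ENNReal.ofReal (K / Metric.diam Q.1.carrier) ^ p *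
              (whitneyPoincareConst d p κ * ENNReal.ofReal Q.1.side ^ p *
                ∫⁻ x in Q.1.dilate 2, ‖fderiv ℝ φ x‖ₑ ^ p) := by
              gcongr
              exact lintegral_enorm_sub_whitneyMean_rpow_le hd hp hκ hΩ hφ Q
          _ = whitneyPoincareConst d p κ *
              (ENNReal.ofReal (K / Metric.diam Q.1.carrier) ^ p * ENNReal.ofReal Q.1.side ^ p) *
                ∫⁻ x in Q.1.dilate 2, ‖fderiv ℝ φ x‖ₑ ^ p := by ring
          _ = _ := by
              rw [← ENNReal.mul_rpow_of_nonneg _ _ hp0, ← ENNReal.ofReal_mul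
                (div_nonneg K.coe_nonneg Metric.diam_nonneg), DyadicCube.diam_carrier]
              congr 4
              field_simp
    _ = (4 * 3 ^ d : ℕ) ^ (p - 1) * (whitneyPoincareConst d p κ * ENNReal.ofReal (K / √d) ^ p *
          ∑' Q : 𝒬, ∫⁻ x in Q.1.dilate 2, ‖fderiv ℝ φ x‖ₑ ^ p) := by rw [ENNReal.tsum_mul_left]
    _ ≤ (4 * 3 ^ d : ℕ) ^ (p - 1) * (whitneyPoincareConst d p κ * ENNReal.ofReal (K / √d) ^ p *
          ((4 * 3 ^ d : ℕ) * ∫⁻ x in O, ‖fderiv ℝ φ x‖ₑ ^ p)) := by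
        gcongr
        exact h.tsum_lintegral_le hO hm.aemeasurable
    _ = _ := by ring

theorem lintegral_enorm_gradient_sub_relativeTruncation_rpow_le (hd : 1 ≤ d)
    (h : IsWhitneyCovering O 𝒬) (hO : O ≠ univ) (hOo : IsOpen O)
    (hψ : IsWhitneyPartition O 𝒬 ψ K) {p : ℝ} (hp : 1 ≤ p) {κ : ℝ} (hκ : 0 < κ)
    (hΩ : ∀ r₀, HasCorkscrew Ω univ r₀ κ) (hΩo : IsOpen Ω)
    {φ : Euc d → Euc N} (hφ : IsTestFunction Ω φ) :
    ∫⁻ x in Ω, ‖classicalGradient φ x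
        - classicalGradient (relativeTruncation Ω O 𝒬 ψ φ) x‖ₑ ^ p ≤
      stabilityConst d p κ K * ∫⁻ x in O ∩ Ω, ‖classicalGradient φ x‖ₑ ^ p := by
  have hp0 : 0 < p := by linarith
  set w := relativeTruncation Ω O 𝒬 ψ φ with hw
  obtain ⟨M, hM⟩ := hφ.exists_lipschitzWith
  have hφΩ : ∀ x ∉ Ω, φ x = 0 := fun x hx => hφ.eq_zero hx
  have hwL := lipschitzWith_relativeTruncation hd h hO hOo hψ hM hφΩ
  -- The Lipschitz function `φ - w` vanishes on `Oᶜ`, so its derivative does almost everywhere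
  -- there, even if the boundary of `O` has positive measure.
  have hzero : ∀ᵐ x, x ∈ Oᶜ → classicalGradient φ x - classicalGradient w x = 0 := by
    have h1 := (hM.sub hwL).ae_fderiv_eq_zero hd hOo.isClosed_compl.measurableSet fun x hx => by
      change φ x - relativeTruncation Ω O 𝒬 ψ φ x = 0
      rw [relativeTruncation_of_notMem φ hx, sub_eq_zero]
      by_cases hxΩ : x ∈ Ω
      · rw [indicator_of_mem hxΩ]
      · rw [indicator_of_notMem hxΩ, hφΩ x hxΩ]
    filter_upwards [h1, hwL.ae_differentiableAt (μ := volume)] with x hx hd hxO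
    rw [classicalGradient_eq, classicalGradient_eq, ← map_sub,
      ← fderiv_sub (hφ.differentiable x) hd]
    have h2 := hx hxO
    change fderiv ℝ (φ - w) x = 0 at h2
    rw [h2, map_zero]
  set E : Euc d → ℝ≥0∞ := fun x => ‖classicalGradient φ x - classicalGradient w x‖ₑ ^ p
  have hm1 : Measurable fun x => ‖fderiv ℝ φ x‖ₑ ^ p :=
    (measurable_fderiv ℝ φ).enorm.pow_const p
  have hm2 : Measurable fun x => ‖fderiv ℝ w x‖ₑ ^ p :=
    (measurable_fderiv ℝ w).enorm.pow_const p
  calc ∫⁻ x in Ω, E x ≤ ∫⁻ x, E x := setLIntegral_le_lintegral _ _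
    _ = ∫⁻ x in O, E x := by
        rw [← lintegral_add_compl E hOo.measurableSet]
        have : ∫⁻ x in Oᶜ, E x = 0 := by
          rw [setLIntegral_congr_fun_ae hOo.measurableSet.compl (g := fun _ => 0), lintegral_zero]
          filter_upwards [hzero] with x hx hxO
          simp [E, hx hxO, hp0]
        rw [this, add_zero]
    _ ≤ ∫⁻ x in O, ENNReal.ofReal √d ^ p *
          (2 ^ (p - 1) * (‖fderiv ℝ φ x‖ₑ ^ p + ‖fderiv ℝ w x‖ₑ ^ p)) := by
        refine lintegral_mono fun x => ?_
        calc E x ≤ (ENNReal.ofReal √d * (‖fderiv ℝ φ x‖ₑ + ‖fderiv ℝ w x‖ₑ)) ^ p := by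
              simp only [E]
              gcongr
              rw [mul_add]
              exact enorm_sub_le.trans (add_le_add (enorm_gradientMap_le _) (enorm_gradientMap_le _))
          _ ≤ _ := by
              rw [ENNReal.mul_rpow_of_nonneg _ _ hp0.le]
              gcongr
              exact ENNReal.rpow_add_le_mul_rpow_add_rpow _ _ hp
    _ = ENNReal.ofReal √d ^ p * (2 ^ (p - 1) *
          ((∫⁻ x in O, ‖fderiv ℝ φ x‖ₑ ^ p) + ∫⁻ x in O, ‖fderiv ℝ w x‖ₑ ^ p)) := by
        have hm3 : Measurable fun x => ‖fderiv ℝ φ x‖ₑ ^ p + ‖fderiv ℝ w x‖ₑ ^ p := hm1.add hm2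
        rw [lintegral_const_mul _ (hm3.const_mul _), lintegral_const_mul _ hm3,
          lintegral_add_left hm1]
    _ ≤ ENNReal.ofReal √d ^ p * (2 ^ (p - 1) *
          ((∫⁻ x in O, ‖fderiv ℝ φ x‖ₑ ^ p) + (4 * 3 ^ d : ℕ) ^ (p - 1) *
            (whitneyPoincareConst d p κ * ENNReal.ofReal (K / √d) ^ p *
              (4 * 3 ^ d : ℕ)) * ∫⁻ x in O, ‖fderiv ℝ φ x‖ₑ ^ p)) := by
        gcongr
        exact lintegral_enorm_fderiv_relativeTruncation_rpow_le hd h hO hOo hψ hp hκ hΩ hφ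
    _ = stabilityConst d p κ K * ∫⁻ x in O, ‖fderiv ℝ φ x‖ₑ ^ p := by
        unfold stabilityConst; ring
    _ ≤ stabilityConst d p κ K * ∫⁻ x in O ∩ Ω, ‖classicalGradient φ x‖ₑ ^ p := by
        gcongr _ * ?_
        have e : ∫⁻ x in O, ‖fderiv ℝ φ x‖ₑ ^ p = ∫⁻ x in O ∩ Ω, ‖fderiv ℝ φ x‖ₑ ^ p := by
          rw [← lintegral_inter_add_sdiff _ O hΩo.measurableSet]
          have : ∫⁻ x in O \ Ω, ‖fderiv ℝ φ x‖ₑ ^ p = 0 := by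
            rw [setLIntegral_congr_fun (hOo.measurableSet.diff hΩo.measurableSet)
              (g := fun _ => 0) (fun x hx => by
                have : ‖fderiv ℝ φ x‖ₑ = 0 := by
                  rw [← ofReal_norm, hφ.fderiv_eq_zero hx.2, ContinuousLinearMap.opNorm_zero,
                    ENNReal.ofReal_zero]
                simp only [this, ENNReal.zero_rpow_of_pos hp0]), lintegral_zero]
          rw [this, add_zero]
        rw [e]
        refine lintegral_mono fun x => ?_
        gcongr
        exact enorm_le_enorm_gradientMap _

/-! ### The bound in `L^p` -/

/-- Jensen's inequality, with the volumes of `2 Q` and `9/8 Q` comparable; the means that were set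
to `0` contribute nothing. -/
theorem enorm_whitneyMean_rpow_mul_le (hd : 1 ≤ d) {p : ℝ} (hp : 1 ≤ p) {u : Euc d → Euc N}
    (hu : AEStronglyMeasurable u (volume.restrict Ω)) (Q : DyadicCube d) :
    ‖whitneyMean Ω u Q‖ₑ ^ p * volume (Q.dilate 2) ≤
      ENNReal.ofReal ((√d / (1 / 2)) ^ d) * ∫⁻ x in Q.dilate 2, Ω.indicator (fun x => ‖u x‖ₑ ^ p) x := by
  have hs := Q.side_pos
  unfold whitneyMean
  split_ifs with hQ
  · set B := Q.dilate (9 / 8)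
    have hB : Metric.closedBall Q.center (1 / 2 * Q.side) ⊆ B :=
      (Metric.closedBall_subset_closedBall (by linarith)).trans (Q.closedBall_subset_dilate _)
    have hB0 : volume B ≠ 0 := ((Metric.measure_closedBall_pos volume Q.center
      (by positivity)).trans_le (measure_mono hB)).ne'
    have hB1 : volume B ≠ ⊤ := (Q.isCompact_dilate _).measure_lt_top.ne
    have hBm : MeasurableSet B := (Q.isClosed_dilate _).measurableSet
    have : IsProbabilityMeasure ((volume B)⁻¹ • volume.restrict B) :=
      ⟨by simpa using ENNReal.inv_mul_cancel hB0 hB1⟩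
    have h1 : ‖⨍ x in B, u x‖ₑ ^ p ≤ (volume B)⁻¹ * ∫⁻ x in B, ‖u x‖ₑ ^ p := by
      rw [setAverage_eq']
      calc _ ≤ (∫⁻ x, ‖u x‖ₑ ∂((volume B)⁻¹ • volume.restrict B)) ^ p := by
            gcongr; exact enorm_integral_le_lintegral_enorm _
        _ ≤ ∫⁻ x, ‖u x‖ₑ ^ p ∂((volume B)⁻¹ • volume.restrict B) :=
            ENNReal.lintegral_rpow_le_of_isProbabilityMeasure hp
              ((hu.mono_set hQ).enorm.smul_measure _)
        _ = _ := by rw [lintegral_smul_measure, smul_eq_mul]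
    calc _ ≤ ((volume B)⁻¹ * ∫⁻ x in B, ‖u x‖ₑ ^ p) * volume (Q.dilate 2) := by gcongr
      _ = volume (Q.dilate 2) / volume B * ∫⁻ x in B, ‖u x‖ₑ ^ p := by
          rw [div_eq_mul_inv]; ring
      _ ≤ _ := by
          refine mul_le_mul' (Q.volume_dilate_two_div_le hd (by norm_num) hB) ?_
          calc ∫⁻ x in B, ‖u x‖ₑ ^ p = ∫⁻ x in B, Ω.indicator (fun x => ‖u x‖ₑ ^ p) x :=
                setLIntegral_congr_fun hBm fun x hx => by
                  simp only [indicator_of_mem (hQ hx)]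
            _ ≤ ∫⁻ x in Q.dilate 2, Ω.indicator (fun x => ‖u x‖ₑ ^ p) x :=
                lintegral_mono_set (Q.dilate_mono (by norm_num))
  · simp [show (0 : ℝ) < p by linarith]

/-- The constant in the bound of the relative truncation in `L^p`. -/
noncomputable def truncationConst (d : ℕ) (p : ℝ) : ℝ≥0∞ :=
  (4 * 3 ^ d : ℕ) ^ (p - 1) * (ENNReal.ofReal ((√d / (1 / 2)) ^ d) * (4 * 3 ^ d : ℕ)) + 1

theorem truncationConst_ne_top {p : ℝ} (hp : 1 ≤ p) : truncationConst d p ≠ ⊤ :=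
  ENNReal.add_ne_top.2 ⟨ENNReal.mul_ne_top
    (ENNReal.rpow_ne_top_of_nonneg (by linarith) (ENNReal.natCast_ne_top _))
    (ENNReal.mul_ne_top ENNReal.ofReal_ne_top (ENNReal.natCast_ne_top _)), ENNReal.one_ne_top⟩

/-- No derivative is involved, so the bound applies to `u` and to `φ_n - u` directly and gives
convergence of the truncations in `L^p`. -/
theorem lintegral_enorm_relativeTruncation_rpow_le (hd : 1 ≤ d)
    (h : IsWhitneyCovering O 𝒬) (hO : O ≠ univ) (hOo : IsOpen O)
    (hψ : IsWhitneyPartition O 𝒬 ψ K) {p : ℝ} (hp : 1 ≤ p) (hΩo : IsOpen Ω)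
    {u : Euc d → Euc N} (hu : AEStronglyMeasurable u (volume.restrict Ω)) :
    ∫⁻ x in Ω, ‖relativeTruncation Ω O 𝒬 ψ u x‖ₑ ^ p ≤
      truncationConst d p * ∫⁻ x in Ω, ‖u x‖ₑ ^ p := by
  set g : Euc d → ℝ≥0∞ := Ω.indicator fun x => ‖u x‖ₑ ^ p
  have hg : AEMeasurable g := (aemeasurable_indicator_iff hΩo.measurableSet).2 (hu.enorm.pow_const p)
  have onO : ∫⁻ x in O, ‖relativeTruncation Ω O 𝒬 ψ u x‖ₑ ^ p ≤
      (4 * 3 ^ d : ℕ) ^ (p - 1) * (ENNReal.ofReal ((√d / (1 / 2)) ^ d) * (4 * 3 ^ d : ℕ)) *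
        ∫⁻ x in Ω, ‖u x‖ₑ ^ p := by
    calc ∫⁻ x in O, ‖relativeTruncation Ω O 𝒬 ψ u x‖ₑ ^ p
        ≤ ∫⁻ x in O, (∑ Q ∈ h.near hO x, ‖whitneyMean Ω u Q‖ₑ) ^ p := by
          refine setLIntegral_mono' hOo.measurableSet fun x hx => ?_
          gcongr
          have h1 := norm_relativeTruncation_le (Ω := Ω) h hO hψ u hx
          rw [← ofReal_norm]
          refine (ENNReal.ofReal_le_ofReal h1).trans (le_of_eq ?_)
          rw [ENNReal.ofReal_sum_of_nonneg fun _ _ => norm_nonneg _]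
          simp only [ofReal_norm]
      _ ≤ (4 * 3 ^ d : ℕ) ^ (p - 1) *
            ∑' Q : 𝒬, ∫⁻ _ in Q.1.dilate 2, ‖whitneyMean Ω u Q‖ₑ ^ p :=
          h.lintegral_sum_near_rpow_le hO hp (a := fun Q _ => ‖whitneyMean Ω u Q‖ₑ)
            fun _ => measurable_const
      _ ≤ (4 * 3 ^ d : ℕ) ^ (p - 1) * ∑' Q : 𝒬, ENNReal.ofReal ((√d / (1 / 2)) ^ d) *
            ∫⁻ x in Q.1.dilate 2, g x := by
          gcongr with Q
          rw [setLIntegral_const]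
          exact enorm_whitneyMean_rpow_mul_le hd hp hu Q
      _ ≤ (4 * 3 ^ d : ℕ) ^ (p - 1) * (ENNReal.ofReal ((√d / (1 / 2)) ^ d) *
            ((4 * 3 ^ d : ℕ) * ∫⁻ x in O, g x)) := by
          rw [ENNReal.tsum_mul_left]
          gcongr
          exact h.tsum_lintegral_le hO hg.restrict
      _ ≤ (4 * 3 ^ d : ℕ) ^ (p - 1) * (ENNReal.ofReal ((√d / (1 / 2)) ^ d) *
            ((4 * 3 ^ d : ℕ) * ∫⁻ x in Ω, ‖u x‖ₑ ^ p)) := by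
          gcongr _ * (_ * (_ * ?_))
          refine (setLIntegral_le_lintegral _ _).trans (le_of_eq ?_)
          rw [lintegral_indicator hΩo.measurableSet]
      _ = _ := by ring
  calc ∫⁻ x in Ω, ‖relativeTruncation Ω O 𝒬 ψ u x‖ₑ ^ p
      = (∫⁻ x in Ω ∩ O, ‖relativeTruncation Ω O 𝒬 ψ u x‖ₑ ^ p)
        + ∫⁻ x in Ω \ O, ‖relativeTruncation Ω O 𝒬 ψ u x‖ₑ ^ p :=
        (lintegral_inter_add_sdiff _ Ω hOo.measurableSet).symm
    _ ≤ (∫⁻ x in O, ‖relativeTruncation Ω O 𝒬 ψ u x‖ₑ ^ p) + ∫⁻ x in Ω, ‖u x‖ₑ ^ p := by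
        refine add_le_add ?_ ?_
        · exact lintegral_mono_set inter_subset_right
        · rw [setLIntegral_congr_fun (hΩo.measurableSet.diff hOo.measurableSet)
            (g := fun x => ‖u x‖ₑ ^ p) fun x hx => by
              simp only [relativeTruncation_of_notMem u hx.2, indicator_of_mem hx.1]]
          exact lintegral_mono_set sdiff_subset
    _ ≤ _ := by
        rw [truncationConst, add_mul, one_mul]
        gcongr

theorem aestronglyMeasurable_relativeTruncation (h : IsWhitneyCovering O 𝒬) (hO : O ≠ univ)
    (hOo : IsOpen O) (hψ : IsWhitneyPartition O 𝒬 ψ K) (hΩo : IsOpen Ω)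
    {u : Euc d → Euc N} (hu : AEStronglyMeasurable u (volume.restrict Ω)) :
    AEStronglyMeasurable (relativeTruncation Ω O 𝒬 ψ u) (volume.restrict Ω) := by
  rw [show volume.restrict Ω = volume.restrict (Ω ∩ O ∪ Ω \ O) by rw [inter_union_sdiff],
    aestronglyMeasurable_union_iff]
  constructor
  · exact ((continuousOn_relativeTruncation h hO hOo hψ u).aestronglyMeasurable
      hOo.measurableSet).mono_set inter_subset_right
  · refine (hu.mono_set sdiff_subset).congr ?_
    filter_upwards [ae_restrict_mem (hΩo.measurableSet.diff hOo.measurableSet)] with x hx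
    rw [relativeTruncation_of_notMem u hx.2, indicator_of_mem hx.1]

/-! ### Linearity -/

theorem whitneyMean_sub {u v : Euc d → Euc N} (hu : IntegrableOn u Ω) (hv : IntegrableOn v Ω)
    (Q : DyadicCube d) :
    whitneyMean Ω (fun x => u x - v x) Q = whitneyMean Ω u Q - whitneyMean Ω v Q := by
  unfold whitneyMean
  split_ifs with hQ
  · simp only [setAverage_eq]
    rw [integral_sub (hu.mono_set hQ) (hv.mono_set hQ), smul_sub]
  · rw [sub_zero]

theorem relativeTruncation_sub (h : IsWhitneyCovering O 𝒬) (hO : O ≠ univ)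
    (hψ : IsWhitneyPartition O 𝒬 ψ K) {u v : Euc d → Euc N} (hu : IntegrableOn u Ω)
    (hv : IntegrableOn v Ω) (x : Euc d) :
    relativeTruncation Ω O 𝒬 ψ (fun x => u x - v x) x
      = relativeTruncation Ω O 𝒬 ψ u x - relativeTruncation Ω O 𝒬 ψ v x := by
  by_cases hx : x ∈ O
  · have hsub := h.near_subset hO x
    have hx' := h.mem_near_of_mem_dilate hO x
    simp only [relativeTruncation_eq_sum hψ _ hx hsub hx', whitneyMean_sub hu hv, smul_sub,
      Finset.sum_sub_distrib]
  · simp only [relativeTruncation_of_notMem _ hx]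
    by_cases hxΩ : x ∈ Ω <;> simp [hxΩ]

end Stability

/-! ### Passage to the limit -/

theorem eLpNorm_ofReal_rpow {α F : Type*} [MeasurableSpace α] [NormedAddCommGroup F]
    {μ : Measure α} {p : ℝ} (hp : 1 ≤ p) (f : α → F) :
    eLpNorm f (ENNReal.ofReal p) μ ^ p = ∫⁻ x, ‖f x‖ₑ ^ p ∂μ := by
  have hp0 : 0 < p := by linarith
  rw [eLpNorm_eq_lintegral_rpow_enorm_toReal (by simpa using hp0) ENNReal.ofReal_ne_top,
    ENNReal.toReal_ofReal hp0.le, ← ENNReal.rpow_mul, one_div_mul_cancel hp0.ne',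
    ENNReal.rpow_one]

theorem eLpNorm_ofReal_le_of_lintegral_le {α β F G : Type*} [MeasurableSpace α] [MeasurableSpace β]
    [NormedAddCommGroup F] [NormedAddCommGroup G] {μ : Measure α} {ν : Measure β} {p : ℝ}
    (hp : 1 ≤ p) {f : α → F} {g : β → G} {c : ℝ≥0∞}
    (h : ∫⁻ x, ‖f x‖ₑ ^ p ∂μ ≤ c * ∫⁻ x, ‖g x‖ₑ ^ p ∂ν) :
    eLpNorm f (ENNReal.ofReal p) μ ≤ c ^ (1 / p) * eLpNorm g (ENNReal.ofReal p) ν := by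
  have hp0 : 0 < p := by linarith
  rw [← ENNReal.rpow_le_rpow_iff hp0, ENNReal.mul_rpow_of_nonneg _ _ hp0.le,
    ← ENNReal.rpow_mul, one_div_mul_cancel hp0.ne', ENNReal.rpow_one, eLpNorm_ofReal_rpow hp,
    eLpNorm_ofReal_rpow hp]
  exact h

/-- A sequence in `L^q` that is controlled by a convergent sequence converges. -/
theorem exists_tendsto_eLpNorm_of_le {α F G : Type*} [MeasurableSpace α] [NormedAddCommGroup F]
    [CompleteSpace F] [NormedAddCommGroup G] {μ : Measure α} {q : ℝ≥0∞} (hq : 1 ≤ q)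
    {f : ℕ → α → F} (hf : ∀ n, MemLp (f n) q μ) {g : ℕ → α → G} {g₀ : α → G}
    (hg : ∀ n, MemLp (g n) q μ) (hg₀ : MemLp g₀ q μ)
    (hlim : Tendsto (fun n => eLpNorm (fun x => g n x - g₀ x) q μ) atTop (𝓝 0))
    {c : ℝ≥0∞} (hc : c ≠ ⊤)
    (h : ∀ n m, eLpNorm (fun x => f n x - f m x) q μ ≤ c * eLpNorm (fun x => g n x - g m x) q μ) :
    ∃ f₀, MemLp f₀ q μ ∧ Tendsto (fun n => eLpNorm (fun x => f n x - f₀ x) q μ) atTop (𝓝 0) := by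
  have : Fact (1 ≤ q) := ⟨hq⟩
  have hgc : CauchySeq fun n => (hg n).toLp (g n) := by
    refine Tendsto.cauchySeq (x := hg₀.toLp g₀) ?_
    rw [Lp.tendsto_Lp_iff_tendsto_eLpNorm'']
    exact hlim
  have hfc : CauchySeq fun n => (hf n).toLp (f n) := by
    rw [Metric.cauchySeq_iff'] at hgc ⊢
    intro ε hε
    obtain ⟨n₀, hn₀⟩ := hgc (ε / (c.toReal + 1)) (by positivity)
    refine ⟨n₀, fun n hn => ?_⟩
    have h1 := hn₀ n hn
    rw [Lp.dist_def, eLpNorm_congr_ae ((hg n).coeFn_toLp.sub (hg n₀).coeFn_toLp)] at h1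
    rw [Lp.dist_def, eLpNorm_congr_ae ((hf n).coeFn_toLp.sub (hf n₀).coeFn_toLp)]
    have h2 := ENNReal.toReal_mono (ENNReal.mul_ne_top hc ((hg n).sub (hg n₀)).2.ne) (h n n₀)
    rw [ENNReal.toReal_mul] at h2
    refine lt_of_le_of_lt h2 ?_
    rw [lt_div_iff₀ (by positivity)] at h1
    refine lt_of_le_of_lt ?_ h1
    have h3 : 0 ≤ (eLpNorm (g n - g n₀) q μ).toReal := ENNReal.toReal_nonneg
    change c.toReal * (eLpNorm (g n - g n₀) q μ).toReal ≤ _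
    nlinarith
  obtain ⟨v, hv⟩ := cauchySeq_tendsto_of_complete hfc
  refine ⟨v, Lp.memLp v, ?_⟩
  have := (Lp.tendsto_Lp_iff_tendsto_eLpNorm' _ _).1 hv
  refine this.congr fun n => eLpNorm_congr_ae ?_
  filter_upwards [(hf n).coeFn_toLp] with x hx
  simp [hx]

section Limit

variable {d N : ℕ} {Ω O : Set (Euc d)} {𝒬 : Set (DyadicCube d)} {ψ : DyadicCube d → Euc d → ℝ}
  {K : ℝ≥0}

theorem compl_nonempty_of_isBounded (hd : 1 ≤ d) (hb : Bornology.IsBounded Ω) : Ωᶜ.Nonempty := by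
  rw [nonempty_compl]
  rintro rfl
  have : Nonempty (Fin d) := ⟨⟨0, hd⟩⟩
  exact NormedSpace.unbounded_univ ℝ (Euc d) hb

/-- The relative truncation of a function in `W^{1,p}_0(Ω)` is in `W^{1,p}_0(Ω)`, and the difference
of the gradients is controlled by the gradient in `O`. -/
theorem exists_isTestLimit_relativeTruncation (hd : 1 ≤ d)
    (h : IsWhitneyCovering O 𝒬) (hO : O ≠ univ) (hOo : IsOpen O)
    (hψ : IsWhitneyPartition O 𝒬 ψ K) {p : ℝ} (hp : 1 ≤ p) {κ : ℝ} (hκ : 0 < κ)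
    (hΩ : ∀ r₀, HasCorkscrew Ω univ r₀ κ) (hΩo : IsOpen Ω) (hb : Bornology.IsBounded Ω)
    {u : Euc d → Euc N} {G : Euc d → GradSpace d N} (hu : IsTestLimit Ω (ENNReal.ofReal p) u G) :
    ∃ H, IsTestLimit Ω (ENNReal.ofReal p) (relativeTruncation Ω O 𝒬 ψ u) H ∧
      ∫⁻ x in Ω, ‖G x - H x‖ₑ ^ p ≤ stabilityConst d p κ K * ∫⁻ x in O ∩ Ω, ‖G x‖ₑ ^ p := by
  have hp0 : 0 < p := by linarith
  have hq : 1 ≤ ENNReal.ofReal p := by simpa using ENNReal.ofReal_le_ofReal hp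
  have hq' : ENNReal.ofReal p ≠ ⊤ := ENNReal.ofReal_ne_top
  have hfin : IsFiniteMeasure (volume.restrict Ω) := isFiniteMeasure_restrict.2 hb.measure_lt_top.ne
  have hne := compl_nonempty_of_isBounded hd hb
  obtain ⟨hum, hGm, φ, hφ, l1, l2⟩ := hu
  set q := ENNReal.ofReal p
  set T : (Euc d → Euc N) → Euc d → Euc N := relativeTruncation Ω O 𝒬 ψ with hT
  have hTL : ∀ f, IsTestFunction Ω f → ∃ C, LipschitzWith C (T f) := fun f hf =>
    let ⟨M, hM⟩ := hf.exists_lipschitzWith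
    ⟨_, lipschitzWith_relativeTruncation hd h hO hOo hψ hM fun x hx => hf.eq_zero hx⟩
  have hTlim : ∀ f, IsTestFunction Ω f → IsTestLimit Ω q (T f) (classicalGradient (T f)) :=
    fun f hf =>
    let ⟨_, hC⟩ := hTL f hf
    hC.isTestLimit hΩo hb hne hq hq' fun x hx => relativeTruncation_eq_zero h hO hψ f hx
  have hφint : ∀ n, IntegrableOn (φ n) Ω := fun n => (memLp_one_iff_integrable.1 ((hφ n).memLp 1 volume)).integrableOn
  have huint : IntegrableOn u Ω := hum.integrable hq
  set A := truncationConst d p ^ (1 / p)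
  have hA : A ≠ ⊤ := ENNReal.rpow_ne_top_of_nonneg (by positivity) (truncationConst_ne_top hp)
  have hTbound : ∀ v : Euc d → Euc N, AEStronglyMeasurable v (volume.restrict Ω) →
      eLpNorm (T v) q (volume.restrict Ω) ≤ A * eLpNorm v q (volume.restrict Ω) := fun v hv =>
    eLpNorm_ofReal_le_of_lintegral_le hp
      (lintegral_enorm_relativeTruncation_rpow_le hd h hO hOo hψ hp hΩo hv)
  have hTu : MemLp (T u) q (volume.restrict Ω) :=
    ⟨aestronglyMeasurable_relativeTruncation h hO hOo hψ hΩo hum.1,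
      (hTbound u hum.1).trans_lt (ENNReal.mul_lt_top hA.lt_top hum.2)⟩
  have lT : Tendsto (fun n => eLpNorm (fun x => T (φ n) x - T u x) q (volume.restrict Ω)) atTop
      (𝓝 0) := by
    refine tendsto_of_tendsto_of_tendsto_of_le_of_le tendsto_const_nhds
      (by simpa using ENNReal.Tendsto.const_mul l1 (Or.inr hA)) (fun _ => zero_le) fun n => ?_
    refine le_trans (le_of_eq ?_) (hTbound (fun x => φ n x - u x) (((hφ n).memLp q _).1.sub hum.1))
    congr 1
    ext1 x
    exact (relativeTruncation_sub h hO hψ (hφint n) huint x).symm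
  -- The differences `∇φ_n - ∇T φ_n`, rather than `∇T φ_n`, are followed to the limit, since
  -- stability bounds them by the gradient in `O ∩ Ω` alone.
  set V : ℕ → Euc d → GradSpace d N := fun n x =>
    classicalGradient (φ n) x - classicalGradient (T (φ n)) x with hV
  have hVm : ∀ n, MemLp (V n) q (volume.restrict Ω) := fun n =>
    ((hφ n).memLp_classicalGradient q _).sub (hTlim _ (hφ n)).2.1
  set B := stabilityConst d p κ K ^ (1 / p) with hB
  have hBt : B ≠ ⊤ := ENNReal.rpow_ne_top_of_nonneg (by positivity) (stabilityConst_ne_top hp κ K)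
  have stab : ∀ f, IsTestFunction Ω f →
      eLpNorm (fun x => classicalGradient f x - classicalGradient (T f) x) q (volume.restrict Ω) ≤
        B * eLpNorm (classicalGradient f) q (volume.restrict (O ∩ Ω)) := fun f hf =>
    eLpNorm_ofReal_le_of_lintegral_le hp
      (lintegral_enorm_gradient_sub_relativeTruncation_rpow_le hd h hO hOo hψ hp hκ hΩ hΩo hf)
  have mono : ∀ f : Euc d → GradSpace d N,
      eLpNorm f q (volume.restrict (O ∩ Ω)) ≤ eLpNorm f q (volume.restrict Ω) := fun f =>
    eLpNorm_mono_measure f (Measure.restrict_mono_set _ inter_subset_right)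
  -- By linearity `V n - V m` is, almost everywhere, the same difference of gradients for the test
  -- function `φ n - φ m`, to which stability applies.
  have cauchy : ∀ n m, eLpNorm (fun x => V n x - V m x) q (volume.restrict Ω) ≤
      B * eLpNorm (fun x => classicalGradient (φ n) x - classicalGradient (φ m) x) q
        (volume.restrict Ω) := by
    intro n m
    have hdiff := (hφ n).sub (hφ m)
    have e1 : classicalGradient (fun x => φ n x - φ m x)
        = fun x => classicalGradient (φ n) x - classicalGradient (φ m) x := by
      ext1 x
      exact classicalGradient_sub ((hφ n).differentiable x) ((hφ m).differentiable x)
    have e2 : T (fun x => φ n x - φ m x) = fun x => T (φ n) x - T (φ m) x := by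
      ext1 x
      exact relativeTruncation_sub h hO hψ (hφint n) (hφint m) x
    have h1 := (stab _ hdiff).trans (mul_le_mul' le_rfl (mono _))
    rw [e1, e2] at h1
    refine le_trans (le_of_eq (eLpNorm_congr_ae (ae_restrict_of_ae ?_))) h1
    obtain ⟨_, hn⟩ := hTL _ (hφ n)
    obtain ⟨_, hm⟩ := hTL _ (hφ m)
    filter_upwards [hn.ae_differentiableAt (μ := volume), hm.ae_differentiableAt (μ := volume)]
      with x hxn hxm
    rw [classicalGradient_sub hxn hxm]
    simp only [hV]
    abel
  obtain ⟨V₀, hV₀, lV⟩ := exists_tendsto_eLpNorm_of_le hq hVm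
    (fun n => (hφ n).memLp_classicalGradient q (volume.restrict Ω)) hGm l2 hBt cauchy
  refine ⟨fun x => G x - V₀ x, ?_, ?_⟩
  · refine IsTestLimit.of_tendsto hq (fun n => hTlim _ (hφ n)) hTu (hGm.sub hV₀) lT ?_
    refine tendsto_of_tendsto_of_tendsto_of_le_of_le tendsto_const_nhds
      (by simpa using l2.add lV) (fun _ => zero_le) fun n => ?_
    refine le_trans (le_of_eq ?_) (eLpNorm_sub_le
      (((hφ n).memLp_classicalGradient q (volume.restrict Ω)).sub hGm).1 ((hVm n).sub hV₀).1 hq)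
    congr 1
    ext1 x
    simp only [hV, Pi.sub_apply]
    abel
  -- The norm of `V n` is bounded by that of `∇φ_n` on `O ∩ Ω` only, and the latter tends to the
  -- norm of `G` there, so the localized estimate survives the limit.
  · have key : eLpNorm V₀ q (volume.restrict Ω) ≤ B * eLpNorm G q (volume.restrict (O ∩ Ω)) := by
      have lim : Tendsto (fun n => eLpNorm (fun x => V n x - V₀ x) q (volume.restrict Ω)
          + B * (eLpNorm (fun x => classicalGradient (φ n) x - G x) q (volume.restrict Ω)
            + eLpNorm G q (volume.restrict (O ∩ Ω)))) atTop
          (𝓝 (B * eLpNorm G q (volume.restrict (O ∩ Ω)))) := by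
        have h1 := lV.add (ENNReal.Tendsto.const_mul
          (l2.add_const (eLpNorm G q (volume.restrict (O ∩ Ω)))) (Or.inr hBt))
        simpa using h1
      refine ge_of_tendsto' lim fun n => ?_
      calc eLpNorm V₀ q (volume.restrict Ω)
          ≤ eLpNorm (fun x => V n x - V₀ x) q (volume.restrict Ω)
            + eLpNorm (V n) q (volume.restrict Ω) := by
            have h1 := eLpNorm_sub_le (hVm n).1 ((hVm n).sub hV₀).1 hq
            rw [add_comm]
            refine le_trans (le_of_eq ?_) h1
            congr 1
            ext1 x
            simp
        _ ≤ _ := by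
            gcongr
            refine (stab _ (hφ n)).trans ?_
            gcongr
            have hGO : AEStronglyMeasurable G (volume.restrict (O ∩ Ω)) :=
              hGm.1.mono_set inter_subset_right
            have h1 := eLpNorm_add_le (f := fun x => classicalGradient (φ n) x - G x) (g := G)
              (((hφ n).memLp_classicalGradient q (volume.restrict (O ∩ Ω))).1.sub hGO) hGO hq
            refine le_trans (le_of_eq ?_) (h1.trans (add_le_add (mono _) le_rfl))
            congr 1
            ext1 x
            simp
    have h1 := ENNReal.rpow_le_rpow key hp0.le
    rw [ENNReal.mul_rpow_of_nonneg _ _ hp0.le, hB, ← ENNReal.rpow_mul, one_div_mul_cancel hp0.ne',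
      ENNReal.rpow_one, eLpNorm_ofReal_rpow hp, eLpNorm_ofReal_rpow hp] at h1
    simpa using h1

end Limit

theorem mainTheorem5 (d : ℕ) (hd : 1 ≤ d) :
    -- Whitney coverings with a partition of unity exist, with a constant depending only on `d`
    (∃ K : ℝ≥0, ∀ O : Set (Euc d), IsOpen O → O ≠ univ →
      ∃ (𝒬 : Set (DyadicCube d)) (ψ : DyadicCube d → Euc d → ℝ),
        IsWhitneyCovering O 𝒬 ∧ IsWhitneyPartition O 𝒬 ψ K) ∧
    -- stability of every relative truncation built from such data
    ∀ (K : ℝ≥0) (p : ℝ), 1 ≤ p →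
      ∀ Ω : Set (Euc d), IsLipschitzDomain Ω → Bornology.IsBounded Ω →
        ∃ c : ℝ≥0, ∀ (O : Set (Euc d)), IsOpen O → O ≠ univ →
          ∀ (𝒬 : Set (DyadicCube d)) (ψ : DyadicCube d → Euc d → ℝ),
            IsWhitneyCovering O 𝒬 → IsWhitneyPartition O 𝒬 ψ K →
              ∀ (N : ℕ) (u : Euc d → Euc N), MemW1p0 Ω p u →
                MemW1p0 Ω p (relativeTruncation Ω O 𝒬 ψ u) ∧
                ∀ G H : Euc d → GradSpace d N, HasWeakGradient Ω u G →
                  HasWeakGradient Ω (relativeTruncation Ω O 𝒬 ψ u) H →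
                    ∫⁻ x in Ω, ‖G x - H x‖ₑ ^ p ≤ c * ∫⁻ x in O ∩ Ω, ‖G x‖ₑ ^ p := by
  refine ⟨exists_isWhitneyCovering_isWhitneyPartition hd, fun K p hp Ω hΩ hb => ?_⟩
  -- The corkscrew constant is the only trace of `Ω` in the final constant, which is thus fixed
  -- before `O`, the covering and `u`.
  obtain ⟨κ, hκ, hcork⟩ := hΩ.exists_corkscrew hd hb
  refine ⟨(stabilityConst d p κ K).toNNReal, fun O hOo hO 𝒬 ψ h hψ N u hu => ?_⟩
  have hq : 1 ≤ ENNReal.ofReal p := by simpa using ENNReal.ofReal_le_ofReal hp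
  obtain ⟨hum, G₀, hG₀, hGm, hlim⟩ := hu
  obtain ⟨H₀, hH₀, hle⟩ := exists_isTestLimit_relativeTruncation hd h hO hOo hψ hp hκ hcork hΩ.1 hb
    (⟨hum, hGm, hlim⟩ : IsTestLimit Ω (ENNReal.ofReal p) u G₀)
  refine ⟨hH₀.memW1p0 hb hp, fun G H hG hH => ?_⟩
  -- Arbitrary weak gradients agree almost everywhere in `Ω` with the constructed pair, so no
  -- integrability of `G` and `H` beyond the local one has to be assumed.
  have eG := hG.ae_eq hΩ.1 hG₀
  have eH := hH.ae_eq hΩ.1 (hH₀.hasWeakGradient hb hq)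
  rw [ENNReal.coe_toNNReal (stabilityConst_ne_top hp κ K)]
  calc ∫⁻ x in Ω, ‖G x - H x‖ₑ ^ p = ∫⁻ x in Ω, ‖G₀ x - H₀ x‖ₑ ^ p := by
        refine lintegral_congr_ae ?_
        filter_upwards [eG, eH] with x h1 h2
        rw [h1, h2]
    _ ≤ stabilityConst d p κ K * ∫⁻ x in O ∩ Ω, ‖G₀ x‖ₑ ^ p := hle
    _ = _ := by
        congr 1
        refine lintegral_congr_ae ?_
        filter_upwards [ae_restrict_of_ae_restrict_of_subset inter_subset_right eG] with x h1
        rw [h1]
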